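/- Let $\mathbb H$ and $\mathbb U$ be (real or complex) Hilbert spaces, let $(S(t))_{t\in\mathbb R}$ be a strongly continuous group of bounded operators on $\mathbb H$ with infinitesimal generator $(A,\mathcal D(A))$, let $\mathcal D(A^*)$ carry the graph norm and let $\mathcal D(A^*)'$ be its dual with respect to the pivot space $\mathbb H$. Let $B\in\mathcal L(\mathbb U,\mathcal D(A^*)')$ be an admissible control operator, i.e. for all $T>0$ and $u\in L^2((0,T);\mathbb U)$ the function $t\mapsto\int_0^tS(t-s)Bu(s)\,ds$ (understood in $\mathcal D(A^*)'$) belongs to $C([0,T];\mathbb H)$. Weak solutions: $y\in C([0,T];\mathbb H)$ is a weak solution of $y'=Ay+f$, $y(0)=y_0$, if $y(0)=y_0$ and, for all $\varphi\in\mathcal D(A^*)$, $\frac{d}{dt}\langle y,\varphi\rangle=\langle y,A^*\varphi\rangle+\langle f,\varphi\rangle$ in the sense of distributions in $(0,T)$, where $\langle Bu,\varphi\rangle=\langle u,B^*\varphi\rangle_{\mathbb U}$ when $f$ contains $Bu$. Assume that the system $y'=Ay+Bu$ is exactly controllable in some time $T>0$: for all $y_0,y_T\in\mathbb H$ there is $u\in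 L^2((0,T);\mathbb U)$ such that the weak solution with $y(0)=y_0$ satisfies $y(T)=y_T$. Then the system is rapidly dynamically stabilizable, i.e. for every $\mu>0$ it can be embedded as a subsystem of a larger well-posed system that is exponentially stable with decay rate $\mu$. Precisely: for every $\mu>0$ there are a Hilbert space $\mathbb Z$ over the same field, the generator $N$ of a strongly continuous semigroup on $\mathbb Z$, bounded operators $L\in\mathcal L(\mathbb H,\mathbb Z)$ and $F\in\mathcal L(\mathbb H,\mathbb U)$, and a linear operator $K:\mathcal D(N)\to\mathbb U$ that is continuous for the graph norm of $N$, such that the closed-loop system $$y'=Ay+Bu,\qquad z'=Nz+Ly,\qquad u=Fy+Kz,\qquad y(0)=y_0,\quad z(0)=z_0,$$ has the following properties. Here $u-Fy\in L^2((0,T);\mathbb U)$, the two differential equations are understood in the weak sense, and $u-Fy=Kz$ means that, for all $t\in[0,T]$, $\int_0^tz\,ds\in\mathcal D(N)$ and $K\int_0^tz\,ds=\int_0^t(u-Fy)\,ds$. (i) For all $(y_0,z_0)\in\mathbb H\times\mathbb Z$ there is a solution $(y,z)$ on $[0,+\infty)$, continuous with values in $\mathbb H\times\mathbb Z$, and solutions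 on $[0,T]$ are unique for every $T>0$. (ii) There is a constant $C>0$, independent of $t$, $T$, $y_0$ and $z_0$, such that every solution on $[0,T]$ satisfies $$\|y(t)\|_{\mathbb H}+\|z(t)\|_{\mathbb Z}\le Ce^{-\mu t}\big(\|y_0\|_{\mathbb H}+\|z_0\|_{\mathbb Z}\big)\qquad\text{for }t\in[0,T].$$ -/

import Mathlib

open MeasureTheory Set Filter
open scoped Topology ContDiff

namespace ControlSystem

universe u v

section Semigroups

variable {𝕜 : Type*} [RCLike 𝕜] {H : Type*} [NormedAddCommGroup H] [InnerProductSpace 𝕜 H]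

/-- `(S t)`, `t ∈ ℝ`, is a strongly continuous group of bounded operators. -/
structure IsC0Group (S : ℝ → H →L[𝕜] H) : Prop where
  map_zero : S 0 = ContinuousLinearMap.id 𝕜 H
  map_add : ∀ s t : ℝ, S (s + t) = (S s).comp (S t)
  tendsto : ∀ x : H, Tendsto (fun t : ℝ => S t x) (𝓝 0) (𝓝 x)

/-- `(S t)`, `t ≥ 0`, is a strongly continuous semigroup of bounded operators (the values of `S` at
negative times are irrelevant). -/
structure IsC0Semigroup (S : ℝ → H →L[𝕜] H) : Prop where
  map_zero : S 0 = ContinuousLinearMap.id 𝕜 H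
  map_add : ∀ s t : ℝ, 0 ≤ s → 0 ≤ t → S (s + t) = (S s).comp (S t)
  tendsto : ∀ x : H, Tendsto (fun t : ℝ => S t x) (𝓝[>] 0) (𝓝 x)

/-- `A` is the infinitesimal generator of `S`: `x ∈ D(A)` and `A x = y` if and only if
`t⁻¹ (S t x - x) → y` as `t → 0+`. -/
def IsGenerator (S : ℝ → H →L[𝕜] H) (A : H →ₗ.[𝕜] H) : Prop :=
  ∀ x y : H, (x, y) ∈ A.graph ↔
    Tendsto (fun t : ℝ => ((t : 𝕜)⁻¹) • (S t x - x)) (𝓝[>] 0) (𝓝 y)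

/-- The Hilbert graph norm `(‖x‖² + ‖A x‖²)^(1/2)` on `D(A)`. -/
noncomputable def graphNorm {H' : Type*} [NormedAddCommGroup H'] [InnerProductSpace 𝕜 H']
    (A : H →ₗ.[𝕜] H') (x : A.domain) : ℝ :=
  Real.sqrt (‖(x : H)‖ ^ 2 + ‖A x‖ ^ 2)

variable [CompleteSpace H]

/-- `S(t)*` maps `D(A*)` into itself. -/
theorem adjoint_apply_mem_domain {S : ℝ → H →L[𝕜] H} (hS : IsC0Group S) {A : H →ₗ.[𝕜] H}
    (hA : IsGenerator S A) (t : ℝ) (φ : A.adjoint.domain) :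
    (S t).adjoint (φ : H) ∈ A.adjoint.domain := by
  have key : ∀ v : A.domain, (S t (v : H), S t (A v)) ∈ A.graph := by
    intro v
    rw [hA]
    have h := (hA v (A v)).1 (A.mem_graph v)
    have h2 := ((S t).continuous.tendsto (A v)).comp h
    refine h2.congr fun s => ?_
    have hc : S t (S s (v : H)) = S s (S t (v : H)) := by
      have h1 := congrArg (fun L => L (v : H)) (hS.map_add t s)
      have h3 := congrArg (fun L => L (v : H)) (hS.map_add s t)
      rw [add_comm] at h3
      exact h1.symm.trans h3
    simp only [Function.comp, map_smul, map_sub, hc]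
  have hmem : ∀ v : A.domain, S t (v : H) ∈ A.domain := fun v =>
    LinearPMap.mem_domain_of_mem_graph (key v)
  have hφ : Continuous ((innerₛₗ 𝕜 (φ : H)).comp A.toFun) :=
    (A.mem_adjoint_domain_iff (φ : H)).1 φ.2
  rw [A.mem_adjoint_domain_iff]
  have hcont : Continuous (fun v : A.domain => (⟨S t (v : H), hmem v⟩ : A.domain)) := by
    fun_prop
  convert hφ.comp hcont using 1
  funext v
  obtain ⟨w, hw1, hw2⟩ := (LinearPMap.mem_graph_iff A).1 (key v)
  have hw : w = ⟨S t (v : H), hmem v⟩ := Subtype.ext hw1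
  subst hw
  change inner 𝕜 ((S t).adjoint (φ : H)) (A v) = inner 𝕜 (φ : H) (A _)
  rw [ContinuousLinearMap.adjoint_inner_left]
  exact congrArg _ hw2.symm

/-- The operator `S(t)*` on `D(A*)`. -/
noncomputable def adjointFlow {S : ℝ → H →L[𝕜] H} (hS : IsC0Group S) {A : H →ₗ.[𝕜] H}
    (hA : IsGenerator S A) (t : ℝ) (φ : A.adjoint.domain) : A.adjoint.domain :=
  ⟨(S t).adjoint (φ : H), adjoint_apply_mem_domain hS hA t φ⟩

end Semigroups

section ControlSystems

variable {𝕜 : Type*} [RCLike 𝕜] {H : Type u} [NormedAddCommGroup H] [InnerProductSpace 𝕜 H]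
  [CompleteSpace H]

/-- A bounded linear operator `B` from `U` to `D(A*)'`, the space of continuous conjugate-linear
functionals on `D(A*)` with its graph norm. The number `B u φ` is the pairing of `B u` with `φ`.
The space `H` is embedded in `D(A*)'` by `h ↦ (φ ↦ ⟪φ, h⟫)`; Mathlib's inner product is
conjugate-linear in its first argument. -/
structure ControlOperator (A : H →ₗ.[𝕜] H) (U : Type v) [NormedAddCommGroup U]
    [InnerProductSpace 𝕜 U] where
  toLinearMap : U →ₗ[𝕜] (A.adjoint.domain →ₗ⋆[𝕜] 𝕜)
  bound : ∃ C : ℝ, ∀ (w : U) (φ : A.adjoint.domain),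
    ‖toLinearMap w φ‖ ≤ C * ‖w‖ * graphNorm A.adjoint φ

/-- `y ∈ C([0, T]; H)` is a weak solution of `y' = A y + f` in `(0, T)`, `y(0) = y₀`, where
`f t` is a functional on `D(A*)`: for every `φ ∈ D(A*)`, the identity
`d/dt ⟪φ, y⟫ = ⟪A* φ, y⟫ + f φ` holds in the sense of distributions in `(0, T)`. -/
def IsWeakSolution (A : H →ₗ.[𝕜] H) (f : ℝ → A.adjoint.domain → 𝕜) (T : ℝ) (y₀ : H)
    (y : ℝ → H) : Prop :=
  ContinuousOn y (Icc 0 T) ∧ y 0 = y₀ ∧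
    ∀ (φ : A.adjoint.domain) (η : ℝ → ℝ), ContDiff ℝ ∞ η → HasCompactSupport η →
      tsupport η ⊆ Ioo 0 T →
      - ∫ t in (0 : ℝ)..T, deriv η t • inner 𝕜 (φ : H) (y t) =
        ∫ t in (0 : ℝ)..T, η t • (inner 𝕜 (A.adjoint φ) (y t) + f t φ)

variable {U : Type v} [NormedAddCommGroup U] [InnerProductSpace 𝕜 U]

/-- `w` belongs to `L²((0, T); V)`. -/
def IsL2 {V : Type*} [NormedAddCommGroup V] (T : ℝ) (w : ℝ → V) : Prop :=
  MemLp w 2 (volume.restrict (Ioo 0 T))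

/-- `B` is an admissible control operator: for all `T > 0` and `w ∈ L²((0, T); U)`, the
`D(A*)'`-valued function `t ↦ ∫₀ᵗ S(t - s) B w(s) ds` belongs to `C([0, T]; H)`. -/
def IsAdmissible {S : ℝ → H →L[𝕜] H} (hS : IsC0Group S) {A : H →ₗ.[𝕜] H}
    (hA : IsGenerator S A) (B : ControlOperator A U) : Prop :=
  ∀ T : ℝ, 0 < T → ∀ w : ℝ → U, IsL2 T w →
    ∃ Φ : ℝ → H, ContinuousOn Φ (Icc 0 T) ∧
      ∀ t ∈ Icc 0 T, ∀ φ : A.adjoint.domain,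
        inner 𝕜 (φ : H) (Φ t) =
          ∫ s in (0 : ℝ)..t, B.toLinearMap (w s) (adjointFlow hS hA (t - s) φ)

/-- The system `y' = A y + B w` is exactly controllable in time `T`. -/
def IsExactlyControllable (A : H →ₗ.[𝕜] H) (B : ControlOperator A U) (T : ℝ) : Prop :=
  ∀ y₀ yT : H, ∃ (w : ℝ → U) (y : ℝ → H), IsL2 T w ∧
    IsWeakSolution A (fun t φ => B.toLinearMap (w t) φ) T y₀ y ∧ y T = yT

variable (𝕜 H U) in
/-- The data of a dynamic feedback for a system with state `y ∈ H` and control `w ∈ U`: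
a Hilbert space `Z` of auxiliary states, with dynamics `z' = N z + L y`, and the feedback law
`w = F y + K z`. Here `N` is the generator of a strongly continuous semigroup on `Z`, the
operators `L` and `F` are bounded, and `K` may be unbounded on `Z`: it is only assumed to be
continuous on `D(N)` for the graph norm. -/
structure DynamicFeedback where
  Z : Type u
  [instNormed : NormedAddCommGroup Z]
  [instInner : InnerProductSpace 𝕜 Z]
  [instComplete : CompleteSpace Z]
  G : ℝ → Z →L[𝕜] Z
  isC0Semigroup : IsC0Semigroup G
  N : Z →ₗ.[𝕜] Z
  isGenerator : IsGenerator G N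
  L : H →L[𝕜] Z
  F : H →L[𝕜] U
  K : N.domain →ₗ[𝕜] U
  K_bound : ∃ C : ℝ, ∀ x : N.domain, ‖K x‖ ≤ C * graphNorm N x

attribute [instance] DynamicFeedback.instNormed DynamicFeedback.instInner
  DynamicFeedback.instComplete

/-- `w = K z` on `(0, T)`, for `w ∈ L²((0, T); U)` and `z ∈ C([0, T]; Z)` with values that need not
lie in `D(N)`. The identity is understood in the time-integrated sense: for every `t ∈ [0, T]`,
`∫₀ᵗ z ds ∈ D(N)` and `K (∫₀ᵗ z ds) = ∫₀ᵗ w ds` (both integrals are written weakly). -/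
def DynamicFeedback.IsOutput (D : DynamicFeedback 𝕜 H U) (T : ℝ) (z : ℝ → D.Z)
    (w : ℝ → U) : Prop :=
  IsL2 T w ∧ ∀ t ∈ Icc 0 T, ∃ x : D.N.domain,
    (∀ ζ : D.Z, inner 𝕜 ζ (x : D.Z) = ∫ s in (0 : ℝ)..t, inner 𝕜 ζ (z s)) ∧
    (∀ ξ : U, inner 𝕜 ξ (D.K x) = ∫ s in (0 : ℝ)..t, inner 𝕜 ξ (w s))

/-- `(y, z) ∈ C([0, T]; H × Z)` is a weak solution of the closed-loop system
`y' = A y + B (F y + K z)`, `z' = N z + L y` in `(0, T)`, `y(0) = y₀`, `z(0) = z₀`. -/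
def DynamicFeedback.IsSolution (D : DynamicFeedback 𝕜 H U) {A : H →ₗ.[𝕜] H}
    (B : ControlOperator A U) (T : ℝ) (y₀ : H) (z₀ : D.Z) (y : ℝ → H) (z : ℝ → D.Z) : Prop :=
  ∃ w : ℝ → U, D.IsOutput T z w ∧
    IsWeakSolution A (fun t φ => B.toLinearMap (D.F (y t) + w t) φ) T y₀ y ∧
    IsWeakSolution D.N (fun t φ => inner 𝕜 (φ : D.Z) (D.L (y t))) T z₀ z

/-- The closed-loop system is well-posed: for all initial data there is a weak solution on
`[0, +∞)`, and weak solutions are unique on every interval `[0, T]`. -/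
def DynamicFeedback.IsWellPosed (D : DynamicFeedback 𝕜 H U) {A : H →ₗ.[𝕜] H}
    (B : ControlOperator A U) : Prop :=
  ∀ (y₀ : H) (z₀ : D.Z),
    (∃ (y : ℝ → H) (z : ℝ → D.Z), ∀ T : ℝ, 0 < T → D.IsSolution B T y₀ z₀ y z) ∧
    ∀ T : ℝ, 0 < T → ∀ (y y' : ℝ → H) (z z' : ℝ → D.Z),
      D.IsSolution B T y₀ z₀ y z → D.IsSolution B T y₀ z₀ y' z' →
        EqOn y y' (Icc 0 T) ∧ EqOn z z' (Icc 0 T)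

/-- The closed-loop system is exponentially stable with decay rate `μ`. -/
def DynamicFeedback.IsExponentiallyStable (D : DynamicFeedback 𝕜 H U) {A : H →ₗ.[𝕜] H}
    (B : ControlOperator A U) (μ : ℝ) : Prop :=
  ∃ C : ℝ, 0 < C ∧ ∀ (y₀ : H) (z₀ : D.Z) (T : ℝ), 0 < T →
    ∀ (y : ℝ → H) (z : ℝ → D.Z), D.IsSolution B T y₀ z₀ y z →
      ∀ t ∈ Icc 0 T, ‖y t‖ + ‖z t‖ ≤ C * Real.exp (-μ * t) * (‖y₀‖ + ‖z₀‖)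

/-- The system `y' = A y + B w` is dynamically stabilizable with decay rate `μ`. -/
def IsDynamicallyStabilizable (A : H →ₗ.[𝕜] H) (B : ControlOperator A U) (μ : ℝ) : Prop :=
  ∃ D : DynamicFeedback 𝕜 H U, D.IsWellPosed B ∧ D.IsExponentiallyStable B μ

/-- The system `y' = A y + B w` is rapidly dynamically stabilizable: it is dynamically
stabilizable with every decay rate. -/
def IsRapidlyDynamicallyStabilizable (A : H →ₗ.[𝕜] H) (B : ControlOperator A U) : Prop :=
  ∀ μ : ℝ, 0 < μ → IsDynamicallyStabilizable A B μ

end ControlSystems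

end ControlSystem

/-! Write `B* = C₁ + C₂ A*` on `D(A*)`, with `C₁`, `C₂` bounded. For `σ` large, the weighted Gramian
`Λ = ∫₀^∞ e^{-σt} S(-t) B B* S(-t)* dt` is bounded because `B` is admissible, coercive because exact
controllability is an observability inequality for `B* S(-t)*`, and it solves the Lyapunov equation
`AΛ + ΛA* + σΛ = BB*` tested on `D(A*)` (`exists_lyapunov`). Let `Γ = Λ⁻¹`.

The classical feedback `u = -B*Λ⁻¹y` is awkward because `B*` is unbounded. Here `Λ⁻¹y` is replaced
by a new state: `z' = -(A* + σ + k)z + kΓy`, `u = -B*z`. Put `e = y - Λz`. By the Lyapunov equation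
the closed loop becomes triangular: `e' = (A - k)e`, `z' = -(A* + σ)z + kΓe`. If `‖S(t)‖ ≤ M
e^{a|t|}`, then `k = μ + a` makes `e` decay at rate `μ`, and `σ ≥ μ + 1 + a` makes `z` follow.

The analytic difficulty is that `z` need not lie in `D(A*)`. All equations are therefore integrated
in time: `∫₀ᵗ z` does lie in `D(A*)`, and the Lyapunov identity is applied to it
(`dualFeedback_isSolution_iff`, `closedLoop_eq_zero`). For existence, `z` is given by Duhamel's
formula and the `L²` output `-B*z` comes from the Riesz theorem, by duality with the admissible
input map (`exists_output`). -/

set_option linter.unusedSectionVars false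

namespace ControlSystem

universe u v

/-! ### Inner products, scalars and integrals. -/

/-- A vector whose inner products with a dense set are bounded is bounded. -/
theorem norm_le_of_forall_dense_inner {𝕜 H : Type*} [RCLike 𝕜] [NormedAddCommGroup H]
    [InnerProductSpace 𝕜 H] {D : Set H} (hD : Dense D) {x : H} {C : ℝ} (hC : 0 ≤ C)
    (h : ∀ φ ∈ D, ‖inner 𝕜 φ x‖ ≤ C * ‖φ‖) : ‖x‖ ≤ C := by
  have key : ∀ φ : H, ‖inner 𝕜 φ x‖ ≤ C * ‖φ‖ := by
    intro φ
    refine hD.induction (P := fun φ => ‖inner 𝕜 φ x‖ ≤ C * ‖φ‖) h ?_ φ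
    exact isClosed_le (by fun_prop) (by fun_prop)
  have h1 := key x
  rw [inner_self_eq_norm_sq_to_K, norm_pow, RCLike.norm_ofReal, abs_norm] at h1
  by_contra! hx
  nlinarith [norm_nonneg x]

theorem inv_ofReal_smul {𝕜 H : Type*} [RCLike 𝕜] [NormedAddCommGroup H] [NormedSpace 𝕜 H]
    [NormedSpace ℝ H] [IsScalarTower ℝ 𝕜 H] (r : ℝ) (x : H) : ((r : 𝕜)⁻¹) • x = r⁻¹ • x := by
  rw [← RCLike.ofReal_inv, RCLike.real_smul_eq_coe_smul (K := 𝕜)]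

theorem intervalIntegral_inner {𝕜 H : Type*} [RCLike 𝕜] [NormedAddCommGroup H]
    [InnerProductSpace 𝕜 H] [CompleteSpace H] [NormedSpace ℝ H] {f : ℝ → H} {a b : ℝ}
    (hf : IntervalIntegrable f volume a b) (c : H) :
    ∫ t in a..b, inner 𝕜 c (f t) = inner 𝕜 c (∫ t in a..b, f t) :=
  (innerSL 𝕜 c).intervalIntegral_comp_comm hf

theorem intervalIntegral_inner_left {𝕜 H : Type*} [RCLike 𝕜] [NormedAddCommGroup H]
    [InnerProductSpace 𝕜 H] [CompleteSpace H] [NormedSpace ℝ H] {f : ℝ → H} {a b : ℝ}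
    (hf : IntervalIntegrable f volume a b) (c : H) :
    ∫ t in a..b, inner 𝕜 (f t) c = inner 𝕜 (∫ t in a..b, f t) c := by
  rw [← inner_conj_symm, ← intervalIntegral_inner hf]
  have h := (RCLike.conjLIE (K := 𝕜)).toLinearIsometry.intervalIntegral_comp_comm
    (a := a) (b := b) (μ := volume) (fun t => inner 𝕜 c (f t))
  refine Eq.trans (intervalIntegral.integral_congr fun t _ => ?_) h
  exact (inner_conj_symm _ _).symm

/-! ### Strongly continuous groups, their generators and the dual group. -/

namespace IsC0Group

variable {𝕜 : Type*} [RCLike 𝕜] {H : Type*} [NormedAddCommGroup H] [InnerProductSpace 𝕜 H]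
  {S : ℝ → H →L[𝕜] H}

theorem map_add_apply (hS : IsC0Group S) (s t : ℝ) (x : H) : S (s + t) x = S s (S t x) := by
  rw [hS.map_add]; rfl

theorem map_zero_apply (hS : IsC0Group S) (x : H) : S 0 x = x := by
  rw [hS.map_zero]; rfl

theorem neg_apply_apply (hS : IsC0Group S) (t : ℝ) (x : H) : S (-t) (S t x) = x := by
  rw [← hS.map_add_apply, neg_add_cancel, hS.map_zero_apply]

theorem apply_neg_apply (hS : IsC0Group S) (t : ℝ) (x : H) : S t (S (-t) x) = x := by
  rw [← hS.map_add_apply, add_neg_cancel, hS.map_zero_apply]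

theorem apply_comm (hS : IsC0Group S) (s t : ℝ) (x : H) : S s (S t x) = S t (S s x) := by
  rw [← hS.map_add_apply, add_comm, hS.map_add_apply]

theorem continuous_apply (hS : IsC0Group S) (x : H) : Continuous fun t => S t x := by
  rw [continuous_iff_continuousAt]
  intro t
  have h : Tendsto (fun s : ℝ => S t (S (s - t) x)) (𝓝 t) (𝓝 (S t x)) := by
    refine ((S t).continuous.tendsto x).comp ((hS.tendsto x).comp ?_)
    have : Tendsto (fun s : ℝ => s - t) (𝓝 t) (𝓝 (t - t)) := by
      exact (continuous_id.sub continuous_const).tendsto t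
    simpa using this
  refine h.congr fun s => ?_
  rw [← hS.map_add_apply]; congr 2; ring

theorem isC0Semigroup (hS : IsC0Group S) : IsC0Semigroup S :=
  ⟨hS.map_zero, fun s t _ _ => hS.map_add s t,
    fun x => (hS.tendsto x).mono_left nhdsWithin_le_nhds⟩

variable [CompleteSpace H]

theorem exists_norm_le_of_mem_Icc (hS : IsC0Group S) (R : ℝ) :
    ∃ M : ℝ, 1 ≤ M ∧ ∀ t ∈ Icc (-R) R, ‖S t‖ ≤ M := by
  obtain ⟨C, hC⟩ := banach_steinhaus (g := fun t : Icc (-R) R => S t) (fun x => by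
    obtain ⟨C, hC⟩ := (isCompact_Icc (a := -R) (b := R)).exists_bound_of_continuousOn
      (hS.continuous_apply x).continuousOn
    exact ⟨C, fun i => hC i i.2⟩)
  exact ⟨max 1 C, le_max_left _ _, fun t ht => (hC ⟨t, ht⟩).trans (le_max_right _ _)⟩

/-- Cut `[0, t]` into `⌊|t|⌋ + 1` equal steps of length at most `1` and multiply the bounds; the
exponent is `a = log M`. -/
theorem exists_norm_le_exp (hS : IsC0Group S) :
    ∃ M a : ℝ, 1 ≤ M ∧ 0 ≤ a ∧ ∀ t, ‖S t‖ ≤ M * Real.exp (a * |t|) := by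
  obtain ⟨M, hM, hSM⟩ := hS.exists_norm_le_of_mem_Icc 1
  have hM0 : 0 < M := by linarith
  have key : ∀ (h : ℝ), |h| ≤ 1 → ∀ n : ℕ, ‖S (n * h)‖ ≤ M ^ n := by
    intro h hh n
    induction n with
    | zero => simpa [hS.map_zero] using ContinuousLinearMap.norm_id_le
    | succ n ih =>
      rw [show ((n + 1 : ℕ) : ℝ) * h = n * h + h by push_cast; ring, hS.map_add, pow_succ]
      exact (ContinuousLinearMap.opNorm_comp_le _ _).trans
        (mul_le_mul ih (hSM h (abs_le.1 hh)) (norm_nonneg _) (by positivity))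
  refine ⟨M, Real.log M, hM, Real.log_nonneg hM, fun t => ?_⟩
  have hn := Nat.lt_floor_add_one |t|
  have hn' := Nat.floor_le (abs_nonneg t)
  set n := ⌊|t|⌋₊
  have hpos : (0 : ℝ) < n + 1 := by positivity
  have h1 := key (t / (n + 1)) (by
    rw [abs_div, abs_of_pos hpos, div_le_one hpos]; exact hn.le) (n + 1)
  rw [show ((n + 1 : ℕ) : ℝ) * (t / (n + 1)) = t by push_cast; field_simp] at h1
  refine h1.trans ?_
  rw [pow_succ', ← Real.rpow_natCast, ← Real.rpow_def_of_pos hM0]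
  gcongr

section Calculus

variable [NormedSpace ℝ H] [IsScalarTower ℝ 𝕜 H] {A : H →ₗ.[𝕜] H}

theorem intervalIntegrable_apply (hS : IsC0Group S) (x : H) (a b : ℝ) :
    IntervalIntegrable (fun t => S t x) volume a b :=
  (hS.continuous_apply x).intervalIntegrable a b

/-- The orbit of a point of the domain of the generator is differentiable. -/
theorem hasDerivAt_apply (hS : IsC0Group S) (hA : IsGenerator S A) (x : A.domain) (t : ℝ) :
    HasDerivAt (fun s => S s (x : H)) (S t (A x)) t := by
  have hright : ∀ s, HasDerivWithinAt (fun s => S s (x : H)) (S s (A x)) (Ioi s) s := by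
    intro s
    rw [hasDerivWithinAt_iff_tendsto_slope' (by simp)]
    have h1 : Tendsto (fun r : ℝ => r - s) (𝓝[>] s) (𝓝[>] 0) := by
      refine tendsto_nhdsWithin_iff.2 ⟨?_, ?_⟩
      · have : Tendsto (fun r : ℝ => r - s) (𝓝 s) (𝓝 (s - s)) :=
          (continuous_id.sub continuous_const).tendsto s
        rw [sub_self] at this
        exact this.mono_left nhdsWithin_le_nhds
      · filter_upwards [self_mem_nhdsWithin] with r hr
        exact sub_pos.2 (mem_Ioi.1 hr)
    have h2 := ((S s).continuous.tendsto (A x)).comp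
      (((hA x (A x)).1 (A.mem_graph x)).comp h1)
    refine h2.congr fun r => ?_
    simp only [Function.comp, slope, map_smul, (S s).map_sub, vsub_eq_sub]
    rw [← hS.map_add_apply, add_sub_cancel, inv_ofReal_smul]
  -- The generator only controls right difference quotients. A continuous function with a continuous
  -- right derivative is a primitive of it, hence differentiable on both sides.
  have hint : ∀ b, ∫ s in t..b, S s (A x) = S b (x : H) - S t (x : H) := fun b =>
    intervalIntegral.integral_eq_sub_of_hasDeriv_right
      (hS.continuous_apply _).continuousOn (fun s _ => hright s)
      (hS.intervalIntegrable_apply _ _ _)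
  have h3 := ((hS.continuous_apply (A x)).integral_hasStrictDerivAt t t).hasDerivAt
  have h4 : (fun b => S b (x : H)) = fun b => (∫ s in t..b, S s (A x)) + S t (x : H) := by
    funext b; rw [hint]; abel
  rw [h4]
  exact h3.add_const _

theorem apply_mem_graph (hS : IsC0Group S) (hA : IsGenerator S A) (t : ℝ) (x : A.domain) :
    (S t (x : H), S t (A x)) ∈ A.graph := by
  rw [hA]
  have h := (hA x (A x)).1 (A.mem_graph x)
  refine (((S t).continuous.tendsto (A x)).comp h).congr fun s => ?_
  simp only [Function.comp, map_smul, map_sub, hS.apply_comm t s]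

/-- Applying `S t` shifts the window of integration, and the difference of the two windows reduces
to the short integrals over `[h, h + t]` and `[0, t]`, differentiable at `t = 0`. -/
theorem integral_apply_mem_graph (hS : IsC0Group S) (hA : IsGenerator S A) (h : ℝ) (x : H) :
    (∫ s in (0 : ℝ)..h, S s x, S h x - x) ∈ A.graph := by
  rw [hA]
  have hd : HasDerivAt (fun t => (∫ s in h..(h + t), S s x) - ∫ s in (0 : ℝ)..t, S s x)
      (S h x - x) 0 := by
    have h1 := ((hS.continuous_apply x).integral_hasStrictDerivAt 0 0).hasDerivAt
    have h2 := ((hS.continuous_apply x).integral_hasStrictDerivAt h (h + 0)).hasDerivAt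
    have h3 := (h2.scomp 0 ((hasDerivAt_id (0 : ℝ)).const_add h)).sub h1
    simp only [add_zero, one_smul, hS.map_zero_apply] at h3
    exact h3
  have ht := hd.hasDerivWithinAt (s := Ioi 0)
  rw [hasDerivWithinAt_iff_tendsto_slope' (by simp)] at ht
  refine ht.congr fun t => ?_
  have e1 : S t (∫ s in (0 : ℝ)..h, S s x) = ∫ s in t..(h + t), S s x := by
    rw [← ContinuousLinearMap.intervalIntegral_comp_comm _ (hS.intervalIntegrable_apply _ _ _)]
    simp_rw [← hS.map_add_apply]
    rw [intervalIntegral.integral_comp_add_left (fun s => S s x)]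
    simp [add_comm]
  have e2 : (∫ s in t..(h + t), S s x) - ∫ s in (0 : ℝ)..h, S s x =
      (∫ s in h..(h + t), S s x) - ∫ s in (0 : ℝ)..t, S s x := by
    have i := fun a b => hS.intervalIntegrable_apply x a b
    rw [← intervalIntegral.integral_add_adjacent_intervals (i 0 t) (i t h) ,
      ← intervalIntegral.integral_add_adjacent_intervals (i t h) (i h (h + t))]
    abel
  simp only [slope, vsub_eq_sub, sub_zero]
  rw [e1, e2, inv_ofReal_smul]
  simp

/-- The integral `∫₀ʰ S(s) ds` as a bounded operator. -/
theorem exists_integral_operator (hS : IsC0Group S) (h : ℝ) :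
    ∃ J : H →L[𝕜] H, ∀ x, J x = ∫ s in (0 : ℝ)..h, S s x := by
  obtain ⟨M, hM, hSM⟩ := hS.exists_norm_le_of_mem_Icc |h|
  refine ⟨LinearMap.mkContinuous
    { toFun := fun x => ∫ s in (0 : ℝ)..h, S s x
      map_add' := fun x y => ?_
      map_smul' := fun c x => ?_ } (M * |h|) (fun x => ?_), fun x => rfl⟩
  · exact (intervalIntegral.integral_congr fun t _ => (S t).map_add x y).trans
      (intervalIntegral.integral_add (hS.intervalIntegrable_apply _ _ _)
        (hS.intervalIntegrable_apply _ _ _))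
  · exact (intervalIntegral.integral_congr fun t _ => (S t).map_smul c x).trans
      (intervalIntegral.integral_smul c _)
  · have := intervalIntegral.norm_integral_le_of_norm_le_const (a := 0) (b := h)
      (f := fun s => S s x) (C := M * ‖x‖) (fun s hs => ?_)
    · simpa [mul_right_comm] using this
    · refine (S s).le_of_opNorm_le (hSM s ?_) x
      rcases le_total 0 h with h0 | h0
      · rw [uIoc_of_le h0] at hs
        rw [abs_of_nonneg h0]; exact ⟨by linarith [hs.1], hs.2⟩
      · rw [uIoc_of_ge h0] at hs
        rw [abs_of_nonpos h0]; exact ⟨by linarith [hs.1], by linarith [hs.2]⟩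

theorem eq_zero_of_integral_eq_zero (hS : IsC0Group S) {x : H}
    (h : ∀ t, ∫ s in (0 : ℝ)..t, S s x = 0) : x = 0 := by
  have h1 := ((hS.continuous_apply x).integral_hasStrictDerivAt 0 0).hasDerivAt
  simp_rw [h, hS.map_zero_apply] at h1
  exact h1.unique (hasDerivAt_const _ _)

/-- If `x` is orthogonal to the domain, `h ↦ ∫₀ʰ ⟪x, S(s)x⟫ ds` vanishes identically, while its
derivative at `0` is `‖x‖²`. -/
theorem dense_domain (hS : IsC0Group S) (hA : IsGenerator S A) : Dense (A.domain : Set H) := by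
  have hd : (A.domain).topologicalClosure = ⊤ := by
    rw [Submodule.topologicalClosure_eq_top_iff, Submodule.eq_bot_iff]
    intro x hx
    have hx0 : ∀ h, ∫ s in (0 : ℝ)..h, inner 𝕜 x (S s x) = 0 := fun h => by
      rw [intervalIntegral_inner (hS.intervalIntegrable_apply _ _ _)]
      exact (Submodule.mem_orthogonal' _ _).1 hx _
        (LinearPMap.mem_domain_of_mem_graph (hS.integral_apply_mem_graph hA h x))
    have h1 := ((continuous_const.inner (𝕜 := 𝕜) (hS.continuous_apply x)
      (f := fun _ => x)).integral_hasStrictDerivAt 0 0).hasDerivAt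
    simp_rw [hx0, hS.map_zero_apply] at h1
    exact inner_self_eq_zero.1 (h1.unique (hasDerivAt_const _ _))
  exact (Submodule.dense_iff_topologicalClosure_eq_top).2 hd

/-- With `J = ∫₀ᵗ S(s) ds`, every `J*φ` lies in `D(A*)`, since `JAy = S(t)y - y` is bounded in `y`.
A vector orthogonal to `D(A*)` is thus killed by `J` for every `t`, hence zero. -/
theorem dense_adjoint_domain (hS : IsC0Group S) (hA : IsGenerator S A) :
    Dense (A.adjoint.domain : Set H) := by
  rw [Submodule.dense_iff_topologicalClosure_eq_top, Submodule.topologicalClosure_eq_top_iff,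
    Submodule.eq_bot_iff]
  intro x hx
  refine hS.eq_zero_of_integral_eq_zero fun t => ?_
  obtain ⟨J, hJ⟩ := hS.exists_integral_operator t
  rw [← hJ]
  refine ext_inner_left 𝕜 fun φ => ?_
  rw [← ContinuousLinearMap.adjoint_inner_left, inner_zero_right]
  refine (Submodule.mem_orthogonal _ _).1 hx _ ?_
  refine LinearPMap.mem_adjoint_domain_of_exists _ ⟨(S t).adjoint φ - φ, fun y => ?_⟩
  have hJA : J (A y) = S t y - y := by
    rw [hJ]
    simpa [hS.map_zero_apply] using intervalIntegral.integral_eq_sub_of_hasDerivAt (a := 0) (b := t)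
      (fun s _ => hS.hasDerivAt_apply hA y s) (hS.intervalIntegrable_apply _ _ _)
  rw [ContinuousLinearMap.adjoint_inner_left, hJA, inner_sub_left, inner_sub_right,
    ContinuousLinearMap.adjoint_inner_left]


theorem adjoint_inner (hS : IsC0Group S) (hA : IsGenerator S A) (φ : A.adjoint.domain)
    (x : A.domain) : inner 𝕜 (A.adjoint φ) (x : H) = inner 𝕜 (φ : H) (A x) :=
  LinearPMap.adjoint_isFormalAdjoint (hS.dense_domain hA) φ x

theorem adjoint_adjointFlow (hS : IsC0Group S) (hA : IsGenerator S A) (t : ℝ)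
    (φ : A.adjoint.domain) :
    A.adjoint (adjointFlow hS hA t φ) = (S t).adjoint (A.adjoint φ) := by
  refine LinearPMap.adjoint_apply_eq (hS.dense_domain hA) _ fun x => ?_
  obtain ⟨w, hw1, hw2⟩ := (LinearPMap.mem_graph_iff A).1 (hS.apply_mem_graph hA t x)
  simp only at hw1 hw2
  rw [ContinuousLinearMap.adjoint_inner_left, ← hw1, hS.adjoint_inner hA, hw2]
  exact (ContinuousLinearMap.adjoint_inner_left _ _ _).symm

end Calculus

/-- The group `t ↦ S(-t)*`. -/
noncomputable def _root_.ControlSystem.dualGroup (S : ℝ → H →L[𝕜] H) (t : ℝ) : H →L[𝕜] H :=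
  (S (-t)).adjoint

theorem dualGroup_inner_left (x y : H) (t : ℝ) :
    inner 𝕜 (dualGroup S t x) y = inner 𝕜 x (S (-t) y) :=
  ContinuousLinearMap.adjoint_inner_left _ _ _

theorem norm_dualGroup (t : ℝ) : ‖dualGroup S t‖ = ‖S (-t)‖ :=
  (ContinuousLinearMap.adjoint (𝕜 := 𝕜)).norm_map _

theorem dualGroup_add (hS : IsC0Group S) (s t : ℝ) :
    dualGroup S (s + t) = (dualGroup S s).comp (dualGroup S t) := by
  rw [dualGroup, dualGroup, dualGroup, ← ContinuousLinearMap.adjoint_comp, ← hS.map_add]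
  congr 2; ring

theorem dualGroup_zero (hS : IsC0Group S) : dualGroup S 0 = ContinuousLinearMap.id 𝕜 H := by
  refine ContinuousLinearMap.ext fun x => ext_inner_right 𝕜 fun y => ?_
  rw [dualGroup_inner_left, neg_zero, hS.map_zero_apply]
  rfl

section Dual

variable [NormedSpace ℝ H] [IsScalarTower ℝ 𝕜 H] {A : H →ₗ.[𝕜] H}

/-- Pairing `S(t)x - x = A ∫₀ᵗ S(s)x ds` with `φ` moves `A` onto `φ`. No regularity of `x` is
needed, so continuity and differentiability of the dual group follow from this formula. -/
theorem inner_apply_neg_sub (hS : IsC0Group S) (hA : IsGenerator S A) (φ : A.adjoint.domain)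
    (x : H) (t : ℝ) :
    inner 𝕜 (φ : H) (S t x - x) = inner 𝕜 (A.adjoint φ) (∫ s in (0 : ℝ)..t, S s x) := by
  obtain ⟨w, hw1, hw2⟩ := (LinearPMap.mem_graph_iff A).1 (hS.integral_apply_mem_graph hA t x)
  simp only at hw1 hw2
  rw [← hw1, ← hw2, hS.adjoint_inner hA]

theorem norm_dualGroup_apply_sub_le (hS : IsC0Group S) (hA : IsGenerator S A)
    {M : ℝ} (hM : ∀ t ∈ Icc (-1 : ℝ) 1, ‖S t‖ ≤ M) (φ : A.adjoint.domain) {t : ℝ}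
    (ht : t ∈ Icc (-1 : ℝ) 1) :
    ‖dualGroup S t (φ : H) - φ‖ ≤ ‖A.adjoint φ‖ * (M * |t|) := by
  have hM0 : 0 ≤ M := (norm_nonneg _).trans (hM 0 (by simp))
  refine norm_le_of_forall_dense_inner (𝕜 := 𝕜) dense_univ (by positivity) fun x _ => ?_
  rw [norm_inner_symm, inner_sub_left, dualGroup_inner_left, ← inner_sub_right,
    hS.inner_apply_neg_sub hA, mul_assoc]
  refine (norm_inner_le_norm _ _).trans (mul_le_mul_of_nonneg_left ?_ (norm_nonneg _))
  have := intervalIntegral.norm_integral_le_of_norm_le_const (a := 0) (b := -t)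
    (f := fun s => S s x) (C := M * ‖x‖) (fun s hs => (S s).le_of_opNorm_le (hM s ?_) x)
  · simpa [mul_right_comm] using this
  · rcases le_total 0 (-t) with h0 | h0
    · rw [uIoc_of_le h0] at hs
      exact ⟨by linarith [hs.1], by linarith [hs.2, ht.1]⟩
    · rw [uIoc_of_ge h0] at hs
      exact ⟨by linarith [hs.1, ht.2], by linarith [hs.2]⟩

/-- On `D(A*)` the orbits are Lipschitz near `0`; density and the uniform bound `M` on `[-1, 1]`
extend the continuity by an `ε/3` argument. -/
theorem isC0Group_dualGroup (hS : IsC0Group S) (hA : IsGenerator S A) :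
    IsC0Group (dualGroup S) := by
  refine ⟨hS.dualGroup_zero, hS.dualGroup_add, fun x => ?_⟩
  obtain ⟨M, hM1, hM⟩ := hS.exists_norm_le_of_mem_Icc 1
  rw [Metric.tendsto_nhds]
  intro ε hε
  obtain ⟨φ, hφ, hxφ⟩ := (hS.dense_adjoint_domain hA).exists_dist_lt x
    (show 0 < ε / (3 * M) by positivity)
  rw [dist_eq_norm] at hxφ
  have hc : Tendsto (fun t : ℝ => ‖A.adjoint ⟨φ, hφ⟩‖ * (M * |t|)) (𝓝 0) (𝓝 0) := by
    have : Continuous fun t : ℝ => ‖A.adjoint ⟨φ, hφ⟩‖ * (M * |t|) := by fun_prop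
    simpa using this.tendsto 0
  filter_upwards [hc.eventually_lt_const (show 0 < ε / 3 by positivity),
    Icc_mem_nhds (show (-1 : ℝ) < 0 by norm_num) (show (0 : ℝ) < 1 by norm_num)] with t ht1 ht2
  have h1 := hS.norm_dualGroup_apply_sub_le hA hM ⟨φ, hφ⟩ ht2
  have h2 : ‖dualGroup S t (x - φ)‖ ≤ M * ‖x - φ‖ := by
    refine ContinuousLinearMap.le_of_opNorm_le _ ?_ _
    rw [norm_dualGroup]
    exact hM _ ⟨by linarith [ht2.2], by linarith [ht2.1]⟩
  have h3 : M * ‖x - φ‖ < ε / 3 := by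
    have := mul_lt_mul_of_pos_left hxφ (show 0 < M by linarith)
    calc _ < _ := this
      _ = ε / 3 := by field_simp
  have h4 : ‖x - φ‖ ≤ M * ‖x - φ‖ := le_mul_of_one_le_left (norm_nonneg _) hM1
  rw [dist_eq_norm]
  calc ‖dualGroup S t x - x‖
      = ‖dualGroup S t (x - φ) + (dualGroup S t φ - φ) - (x - φ)‖ := by
        rw [map_sub]; congr 1; abel
    _ ≤ ‖dualGroup S t (x - φ)‖ + ‖dualGroup S t φ - φ‖ + ‖x - φ‖ :=
        (norm_sub_le _ _).trans (by gcongr; exact norm_add_le _ _)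
    _ < ε := by simp only at h1; linarith

theorem hasDerivAt_dualGroup (hS : IsC0Group S) (hA : IsGenerator S A) (φ : A.adjoint.domain)
    (t : ℝ) :
    HasDerivAt (fun s => dualGroup S s (φ : H)) (-dualGroup S t (A.adjoint φ)) t := by
  have hV := hS.isC0Group_dualGroup hA
  have hint : ∀ b, dualGroup S b (φ : H) = φ - ∫ s in (0 : ℝ)..b, dualGroup S s (A.adjoint φ) := by
    intro b
    refine ext_inner_right 𝕜 fun x => ?_
    rw [inner_sub_left, ← intervalIntegral_inner_left (hV.intervalIntegrable_apply _ _ _)]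
    simp_rw [dualGroup_inner_left]
    rw [eq_sub_iff_add_eq, ← eq_sub_iff_add_eq', ← neg_sub, ← inner_sub_right, hS.inner_apply_neg_sub hA,
      intervalIntegral_inner (f := fun s => S (-s) x)
        (((hS.continuous_apply x).comp continuous_neg).intervalIntegrable _ _),
      intervalIntegral.integral_comp_neg (fun s => S s x), neg_zero,
      intervalIntegral.integral_symm, inner_neg_right]
  rw [funext hint]
  have := ((hV.continuous_apply (A.adjoint φ)).integral_hasStrictDerivAt 0 t).hasDerivAt
  exact this.const_sub _

end Dual

end IsC0Group

/-! ### The observation operator `B*`. -/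

namespace ControlOperator

variable {𝕜 : Type*} [RCLike 𝕜] {H : Type*} [NormedAddCommGroup H] [InnerProductSpace 𝕜 H]
  [CompleteSpace H] {U : Type*} [NormedAddCommGroup U] [InnerProductSpace 𝕜 U] [CompleteSpace U]
  {A : H →ₗ.[𝕜] H}

/-- The adjoint `B* : D(A*) → U` of a control operator. -/
theorem exists_adjoint (B : ControlOperator A U) :
    ∃ b : A.adjoint.domain →ₗ[𝕜] U, (∀ w φ, inner 𝕜 (b φ) w = B.toLinearMap w φ) ∧
      ∃ C, ∀ φ, ‖b φ‖ ≤ C * graphNorm A.adjoint φ := by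
  obtain ⟨C, hC⟩ := B.bound
  have hex : ∀ φ : A.adjoint.domain, ∃ x : U, (∀ w, inner 𝕜 x w = B.toLinearMap w φ) ∧
      ‖x‖ ≤ |C| * graphNorm A.adjoint φ := by
    intro φ
    have hg : 0 ≤ graphNorm A.adjoint φ := Real.sqrt_nonneg _
    let f : U →L[𝕜] 𝕜 := LinearMap.mkContinuous
      { toFun := fun w => B.toLinearMap w φ
        map_add' := fun x y => by simp
        map_smul' := fun c x => by simp } (|C| * graphNorm A.adjoint φ) (fun w => by
          refine (hC w φ).trans ?_
          rw [mul_right_comm]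
          gcongr
          exact le_abs_self C)
    refine ⟨(InnerProductSpace.toDual 𝕜 U).symm f, fun w => ?_, ?_⟩
    · rw [InnerProductSpace.toDual_symm_apply]; rfl
    · rw [LinearIsometryEquiv.norm_map]
      exact LinearMap.mkContinuous_norm_le _ (by positivity) _
  choose b hb hbn using hex
  refine ⟨{ toFun := b, map_add' := fun φ ψ => ?_, map_smul' := fun c φ => ?_ },
    fun w φ => hb φ w, |C|, hbn⟩
  · refine ext_inner_right 𝕜 fun w => ?_
    rw [inner_add_left, hb, hb, hb, map_add]
  · refine ext_inner_right 𝕜 fun w => ?_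
    rw [RingHom.id_apply, inner_smul_left, hb, hb, LinearMap.map_smulₛₗ]
    rfl

/-- The adjoint `B*` extends from the graph of `A*` to a bounded operator on `H × H`. -/
theorem exists_observation (B : ControlOperator A U) :
    ∃ C₁ C₂ : H →L[𝕜] U, ∀ (w : U) (φ : A.adjoint.domain),
      B.toLinearMap w φ = inner 𝕜 (C₁ (φ : H) + C₂ (A.adjoint φ)) w := by
  obtain ⟨b, hb, C, hC⟩ := B.exists_adjoint
  let E := WithLp 2 (H × H)
  let ι : (H × H) ≃L[𝕜] E := (WithLp.prodContinuousLinearEquiv 2 𝕜 H H).symm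
  let e : A.adjoint.domain →ₗ[𝕜] E :=
    ι.toLinearMap.comp ((A.adjoint.domain.subtype).prod A.adjoint.toFun)
  -- Graph continuity makes `b` bounded on the graph of `A*` inside the Hilbert sum `H × H`. It
  -- extends to the closure by density and to the whole sum by orthogonal projection; restriction to
  -- the two factors gives `C₁` and `C₂`.
  let K : Submodule 𝕜 E := (LinearMap.range e).topologicalClosure
  have hK : CompleteSpace K := (Submodule.isClosed_topologicalClosure _).completeSpace_coe
  have heK : ∀ φ, e φ ∈ K := fun φ => Submodule.le_topologicalClosure _ ⟨φ, rfl⟩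
  let e' : A.adjoint.domain →ₗ[𝕜] K := e.codRestrict K heK
  have hdense : DenseRange e' := by
    intro x
    rw [Metric.mem_closure_iff]
    intro ε hε
    obtain ⟨y, ⟨φ, rfl⟩, hy⟩ := Metric.mem_closure_iff.1 x.2 ε hε
    exact ⟨e' φ, ⟨φ, rfl⟩, hy⟩
  have hnorm : ∀ φ, ‖b φ‖ ≤ C * ‖e' φ‖ := by
    intro φ
    refine (hC φ).trans (le_of_eq ?_)
    congr 1
    have : ‖e' φ‖ = ‖e φ‖ := rfl
    rw [this, WithLp.prod_norm_eq_of_L2]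
    rfl
  let T : H × H →L[𝕜] U := ((b.extendOfNorm e').comp K.orthogonalProjectionOnto).comp (ι : H × H →L[𝕜] E)
  have hT : ∀ φ : A.adjoint.domain, T (φ, A.adjoint φ) = b φ := by
    intro φ
    have h1 : K.orthogonalProjectionOnto (e φ) = e' φ :=
      Submodule.orthogonalProjectionOnto_mem_subspace_eq_self (e' φ)
    have h2 : T (φ, A.adjoint φ) = b.extendOfNorm e' (K.orthogonalProjectionOnto (e φ)) := rfl
    rw [h2, h1, LinearMap.extendOfNorm_eq hdense ⟨C, hnorm⟩]
  refine ⟨T.comp (ContinuousLinearMap.inl 𝕜 H H), T.comp (ContinuousLinearMap.inr 𝕜 H H),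
    fun w φ => ?_⟩
  rw [← hb, ← hT]
  congr 1
  simp only [ContinuousLinearMap.comp_apply, ← map_add]
  simp

end ControlOperator

/-! ### The product rule for a moving test vector. -/

/-- A function whose increments over short intervals are small compared to those of a scalar
function takes the same value at the end points. -/
theorem eq_of_norm_sub_le_increment {E : Type*} [NormedAddCommGroup E] {h : ℝ → E} {m : ℝ → ℝ}
    {a b : ℝ} (hab : a ≤ b)
    (H : ∀ ε > 0, ∃ δ > 0, ∀ s t, a ≤ s → s ≤ t → t ≤ b → t - s < δ →
      ‖h t - h s‖ ≤ ε * (m t - m s)) : h b = h a := by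
  have key : ∀ ε > 0, ‖h b - h a‖ ≤ ε * (m b - m a) := by
    intro ε hε
    obtain ⟨δ, hδ, hH⟩ := H ε hε
    obtain ⟨n, hn⟩ := exists_nat_gt ((b - a) / δ)
    have hn0 : (0 : ℝ) < n := lt_of_le_of_lt (by have := sub_nonneg.2 hab; positivity) hn
    have hd : (b - a) / n < δ := by
      rw [div_lt_iff₀ hn0]; rw [div_lt_iff₀ hδ] at hn; linarith
    have hd0 : 0 ≤ (b - a) / n := by have := sub_nonneg.2 hab; positivity
    have hend : a + n * ((b - a) / n) = b := by field_simp; ring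
    have hind : ∀ j : ℕ, j ≤ n → ‖h (a + j * ((b - a) / n)) - h a‖ ≤
        ε * (m (a + j * ((b - a) / n)) - m a) := by
      intro j
      induction j with
      | zero => intro _; simp
      | succ j ih =>
        intro hj
        have h1 := ih (by omega)
        have hle : a + ((j + 1 : ℕ) : ℝ) * ((b - a) / n) ≤ b := by
          conv_rhs => rw [← hend]
          gcongr
        have h2 := hH (a + j * ((b - a) / n)) (a + (j + 1 : ℕ) * ((b - a) / n))
          (by have : 0 ≤ (j : ℝ) * ((b - a) / n) := by positivity
              linarith) (by push_cast; linarith) hle (by push_cast; linarith)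
        calc _ = ‖(h (a + (j + 1 : ℕ) * ((b - a) / n)) - h (a + j * ((b - a) / n))) +
              (h (a + j * ((b - a) / n)) - h a)‖ := by congr 1; abel
          _ ≤ _ := norm_add_le _ _
          _ ≤ _ := by linarith
    have := hind n le_rfl
    rwa [hend] at this
  by_contra hne
  have hpos : 0 < ‖h b - h a‖ := norm_pos_iff.2 (sub_ne_zero.2 hne)
  -- This `ε` makes the bound at most half of `‖h b - h a‖`. The absolute value and the `+ 1` are
  -- there because `m b - m a` has no prescribed sign and may vanish.
  have := key (‖h b - h a‖ / (2 * (|m b - m a| + 1))) (by positivity)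
  rw [div_mul_eq_mul_div, le_div_iff₀ (by positivity)] at this
  nlinarith [le_abs_self (m b - m a), abs_nonneg (m b - m a)]

section Pairing

variable {𝕜 : Type*} [RCLike 𝕜] {H : Type*} [NormedAddCommGroup H] [InnerProductSpace 𝕜 H]
  [CompleteSpace H] {U : Type*} [NormedAddCommGroup U] [InnerProductSpace 𝕜 U] [CompleteSpace U]

theorem intervalIntegrable_inner {β w : ℝ → U} {a b : ℝ} (hβ : Continuous β)
    (hw : IntervalIntegrable w volume a b) :
    IntervalIntegrable (fun t => inner 𝕜 (β t) (w t)) volume a b := by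
  obtain ⟨C, hC⟩ := (isCompact_uIcc (a := a) (b := b)).exists_bound_of_continuousOn hβ.continuousOn
  rw [intervalIntegrable_iff] at hw ⊢
  refine (hw.norm.const_mul C).mono' (hβ.aestronglyMeasurable.inner hw.aestronglyMeasurable) ?_
  filter_upwards [ae_restrict_mem measurableSet_uIoc] with t ht
  exact (norm_inner_le_norm _ _).trans
    (mul_le_mul_of_nonneg_right (hC t (uIoc_subset_uIcc ht)) (norm_nonneg _))

/-- Differentiation of `⟪φ, y⟫` when `φ` is continuously differentiable and `y` solves an equation
in the weak sense. -/
theorem inner_sub_inner_eq_integral [NormedSpace ℝ H] [IsScalarTower ℝ 𝕜 H]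
    {φ φ' α : ℝ → H} {β : ℝ → U} {y : ℝ → H} {w : ℝ → U} {a b : ℝ} (hab : a ≤ b)
    (hφ : ∀ t, HasDerivAt φ (φ' t) t) (hφ' : Continuous φ') (hα : Continuous α)
    (hβ : Continuous β) (hy : ContinuousOn y (Icc a b)) (hw : IntervalIntegrable w volume a b)
    (h : ∀ s t₁ t₂, a ≤ s → s ≤ b → a ≤ t₁ → t₁ ≤ t₂ → t₂ ≤ b →
      inner 𝕜 (φ s) (y t₂ - y t₁) = ∫ τ in t₁..t₂, (inner 𝕜 (α s) (y τ) + inner 𝕜 (β s) (w τ))) :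
    inner 𝕜 (φ b) (y b) - inner 𝕜 (φ a) (y a) =
      ∫ τ in a..b, (inner 𝕜 (φ' τ + α τ) (y τ) + inner 𝕜 (β τ) (w τ)) := by
  have hsub : ∀ {s t}, a ≤ s → s ≤ t → t ≤ b → uIcc s t ⊆ Icc a b := by
    intro s t h1 h2 h3
    rw [uIcc_of_le h2]
    exact Icc_subset_Icc h1 h3
  have iy : ∀ {s t} {γ : ℝ → H}, Continuous γ → a ≤ s → s ≤ t → t ≤ b →
      IntervalIntegrable (fun τ => inner 𝕜 (γ τ) (y τ)) volume s t := fun hγ h1 h2 h3 =>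
    (hγ.continuousOn.inner (𝕜 := 𝕜) (hy.mono (hsub h1 h2 h3))).intervalIntegrable
  have iw : ∀ {s t} {γ : ℝ → U}, Continuous γ → a ≤ s → s ≤ t → t ≤ b →
      IntervalIntegrable (fun τ => inner 𝕜 (γ τ) (w τ)) volume s t := fun hγ h1 h2 h3 =>
    intervalIntegrable_inner hγ (hw.mono_set (by rw [uIcc_of_le hab]; exact hsub h1 h2 h3))
  have iw' : ∀ {s t}, a ≤ s → s ≤ t → t ≤ b → IntervalIntegrable w volume s t :=
    fun h1 h2 h3 => hw.mono_set (by rw [uIcc_of_le hab]; exact hsub h1 h2 h3)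
  set F : ℝ → 𝕜 := fun τ => inner 𝕜 (φ' τ + α τ) (y τ) + inner 𝕜 (β τ) (w τ) with hF
  have iF : ∀ {s t}, a ≤ s → s ≤ t → t ≤ b → IntervalIntegrable F volume s t :=
    fun h1 h2 h3 => (iy (hφ'.add hα) h1 h2 h3).add (iw hβ h1 h2 h3)
  obtain ⟨C₁, hC₁⟩ := isCompact_Icc.exists_bound_of_continuousOn (hφ'.continuousOn (s := Icc a b))
  obtain ⟨C₂, hC₂⟩ := isCompact_Icc.exists_bound_of_continuousOn hy
  have hC₁0 : 0 ≤ C₁ := (norm_nonneg _).trans (hC₁ a ⟨le_rfl, hab⟩)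
  have hC₂0 : 0 ≤ C₂ := (norm_nonneg _).trans (hC₂ a ⟨le_rfl, hab⟩)
  have hm : ∀ {s t}, a ≤ s → s ≤ t → t ≤ b →
      IntervalIntegrable (fun τ => C₁ + C₂ + ‖w τ‖) volume s t :=
    fun h1 h2 h3 => intervalIntegrable_const.add (iw' h1 h2 h3).norm
  -- `y` is only weakly differentiable, so the identity is obtained from increments: the error over
  -- a short interval is `ε` times the increment of `m`, which dominates the `L¹` control.
  have key := eq_of_norm_sub_le_increment (a := a) (b := b)
    (h := fun t => inner 𝕜 (φ t) (y t) - ∫ τ in a..t, F τ)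
    (m := fun t => ∫ τ in a..t, (C₁ + C₂ + ‖w τ‖)) hab ?_
  · simp only [intervalIntegral.integral_same, sub_zero] at key
    rw [← key]; abel
  intro ε hε
  obtain ⟨δ₁, hδ₁, H₁⟩ := Metric.uniformContinuousOn_iff.1
    (isCompact_Icc.uniformContinuousOn_of_continuous hy) ε hε
  obtain ⟨δ₂, hδ₂, H₂⟩ := Metric.uniformContinuousOn_iff.1
    (isCompact_Icc.uniformContinuousOn_of_continuous (hα.continuousOn (s := Icc a b))) ε hε
  obtain ⟨δ₃, hδ₃, H₃⟩ := Metric.uniformContinuousOn_iff.1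
    (isCompact_Icc.uniformContinuousOn_of_continuous (hβ.continuousOn (s := Icc a b))) ε hε
  refine ⟨min δ₁ (min δ₂ δ₃), by positivity, fun s t h1 h2 h3 hst => ?_⟩
  have hs : s ∈ Icc a b := ⟨h1, h2.trans h3⟩
  have ht : t ∈ Icc a b := ⟨h1.trans h2, h3⟩
  have hφint : inner 𝕜 (φ t - φ s) (y t) = ∫ τ in s..t, inner 𝕜 (φ' τ) (y t) := by
    rw [intervalIntegral_inner_left (hφ'.intervalIntegrable _ _),
      intervalIntegral.integral_eq_sub_of_hasDerivAt (fun τ _ => hφ τ)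
        (hφ'.intervalIntegrable _ _)]
  -- Split the increment as `⟪φ t - φ s, y t⟫ + ⟪φ s, y t - y s⟫` and use the equation with the test
  -- vector frozen at `s`. What remains involves only the oscillations of `y`, `α` and `β` on `[s,
  -- t]`.
  have e1 : (inner 𝕜 (φ t) (y t) - ∫ τ in a..t, F τ) - (inner 𝕜 (φ s) (y s) - ∫ τ in a..s, F τ) =
      ∫ τ in s..t, (inner 𝕜 (φ' τ) (y t - y τ) + inner 𝕜 (α s - α τ) (y τ) +
        inner 𝕜 (β s - β τ) (w τ)) := by
    have i1 := iF le_rfl h1 (h2.trans h3)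
    have i2 := iF h1 h2 h3
    have j1 : IntervalIntegrable (fun τ => inner 𝕜 (φ' τ) (y t)) volume s t :=
      (hφ'.inner (𝕜 := 𝕜) continuous_const).intervalIntegrable _ _
    have j2 := (iy (γ := fun _ => α s) continuous_const h1 h2 h3).add
      (iw (γ := fun _ => β s) continuous_const h1 h2 h3)
    rw [← intervalIntegral.integral_add_adjacent_intervals i1 i2]
    calc _ = inner 𝕜 (φ t - φ s) (y t) + inner 𝕜 (φ s) (y t - y s) - ∫ τ in s..t, F τ := by
          rw [inner_sub_left, inner_sub_right]; abel
      _ = _ := by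
          rw [hφint, h s s t h1 (h2.trans h3) h1 h2 h3, ← intervalIntegral.integral_add j1 j2,
            ← intervalIntegral.integral_sub (j1.add j2) i2]
          refine intervalIntegral.integral_congr fun τ _ => ?_
          simp only [hF, inner_add_left, inner_sub_left, inner_sub_right]
          ring
  have e2 : (∫ τ in a..t, (C₁ + C₂ + ‖w τ‖)) - ∫ τ in a..s, (C₁ + C₂ + ‖w τ‖) =
      ∫ τ in s..t, (C₁ + C₂ + ‖w τ‖) := by
    rw [← intervalIntegral.integral_add_adjacent_intervals (hm le_rfl h1 (h2.trans h3))
      (hm h1 h2 h3), add_sub_cancel_left]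
  simp only [e1, e2]
  rw [← intervalIntegral.integral_const_mul]
  refine intervalIntegral.norm_integral_le_of_norm_le h2 (Eventually.of_forall fun τ hτ => ?_)
    ((hm h1 h2 h3).const_mul ε)
  have hτ' : τ ∈ Icc a b := ⟨h1.trans hτ.1.le, hτ.2.trans h3⟩
  have hd1 : dist t τ < δ₁ := by
    rw [Real.dist_eq, abs_of_nonneg (by linarith [hτ.2])]
    linarith [hτ.1, min_le_left δ₁ (min δ₂ δ₃)]
  have hd2 : dist s τ < min δ₂ δ₃ := by
    rw [dist_comm, Real.dist_eq, abs_of_nonneg (by linarith [hτ.1])]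
    linarith [hτ.2, min_le_right δ₁ (min δ₂ δ₃)]
  have b1 := H₁ t ht τ hτ' hd1
  have b2 := H₂ s hs τ hτ' (hd2.trans_le (min_le_left _ _))
  have b3 := H₃ s hs τ hτ' (hd2.trans_le (min_le_right _ _))
  rw [dist_eq_norm] at b1 b2 b3
  calc _ ≤ ‖inner 𝕜 (φ' τ) (y t - y τ)‖ + ‖inner 𝕜 (α s - α τ) (y τ)‖ +
        ‖inner 𝕜 (β s - β τ) (w τ)‖ := norm_add₃_le
    _ ≤ C₁ * ε + ε * C₂ + ε * ‖w τ‖ := by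
        gcongr
        · exact (norm_inner_le_norm _ _).trans (mul_le_mul (hC₁ τ hτ') b1.le (norm_nonneg _) hC₁0)
        · exact (norm_inner_le_norm _ _).trans (mul_le_mul b2.le (hC₂ τ hτ') (norm_nonneg _) hε.le)
        · exact (norm_inner_le_norm _ _).trans
            (mul_le_mul b3.le le_rfl (norm_nonneg _) hε.le)
    _ = _ := by ring

end Pairing

/-! ### The du Bois-Reymond lemma and weak solutions in integrated form. -/

section DuBoisReymond

variable {E : Type*} [NormedAddCommGroup E] [NormedSpace ℝ E] [CompleteSpace E]

/-- A compact subset of `(0, T)` is contained in a compact subinterval. -/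
theorem exists_Icc_of_isCompact_subset_Ioo {K : Set ℝ} {T : ℝ} (hT : 0 < T) (hK : IsCompact K)
    (hKT : K ⊆ Ioo 0 T) : ∃ a b, 0 < a ∧ a ≤ b ∧ b < T ∧ K ⊆ Icc a b := by
  rcases K.eq_empty_or_nonempty with rfl | hne
  · exact ⟨T / 2, T / 2, by linarith, le_rfl, by linarith, empty_subset _⟩
  · exact ⟨sInf K, sSup K, (hKT (hK.sInf_mem hne)).1,
      csInf_le_csSup hne hK.bddBelow hK.bddAbove,
      (hKT (hK.sSup_mem hne)).2, fun x hx => ⟨csInf_le hK.bddBelow hx, le_csSup hK.bddAbove hx⟩⟩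

/-- A test function on `(0, T)` with zero integral is the derivative of a test function. -/
theorem exists_primitive_of_integral_eq_zero {ψ : ℝ → ℝ} {T : ℝ} (hT : 0 < T)
    (hψ : ContDiff ℝ ∞ ψ) (hψc : HasCompactSupport ψ) (hψT : tsupport ψ ⊆ Ioo 0 T)
    (h0 : ∫ t in (0 : ℝ)..T, ψ t = 0) :
    ∃ η : ℝ → ℝ, ContDiff ℝ ∞ η ∧ HasCompactSupport η ∧ tsupport η ⊆ Ioo 0 T ∧ deriv η = ψ := by
  obtain ⟨a, b, ha, hab, hb, hK⟩ := exists_Icc_of_isCompact_subset_Ioo hT hψc hψT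
  have hz : ∀ t, t ∉ Icc a b → ψ t = 0 := fun t ht =>
    image_eq_zero_of_notMem_tsupport fun h => ht (hK h)
  have hd : ∀ t, HasDerivAt (fun t => ∫ s in (0 : ℝ)..t, ψ s) (ψ t) t := fun t =>
    (hψ.continuous.integral_hasStrictDerivAt 0 t).hasDerivAt
  have hderiv : deriv (fun t => ∫ s in (0 : ℝ)..t, ψ s) = ψ := funext fun t => (hd t).deriv
  have hsupp : Function.support (fun t => ∫ s in (0 : ℝ)..t, ψ s) ⊆ Icc a b := by
    intro t ht
    by_contra hn
    refine ht ?_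
    have hi : ∀ c d, IntervalIntegrable ψ volume c d := fun c d =>
      hψ.continuous.intervalIntegrable c d
    rcases lt_or_ge t a with h | h
    · have : ∀ s ∈ uIcc 0 t, ψ s = 0 := fun s hs => hz s fun h' => by
        have := (uIcc_subset_Icc (a₂ := min 0 t) (b₂ := max 0 t)
          (by simp) (by simp) hs).2
        have h3 : max 0 t < a := max_lt ha h
        linarith [h'.1]
      show ∫ s in (0 : ℝ)..t, ψ s = 0
      rw [intervalIntegral.integral_congr (g := fun _ => (0 : ℝ)) this]
      simp
    · have hbt : b < t := by
        by_contra h'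
        exact hn ⟨h, not_lt.1 h'⟩
      -- Beyond `b` the integral from `0` equals the integral from `T`; this is where the zero mean
      -- of `ψ` enters.
      have : ∀ s ∈ uIcc T t, ψ s = 0 := fun s hs => hz s fun h' => by
        have := (uIcc_subset_Icc (a₂ := min T t) (b₂ := max T t)
          (by simp) (by simp) hs).1
        have h3 : b < min T t := lt_min hb hbt
        linarith [h'.2]
      show ∫ s in (0 : ℝ)..t, ψ s = 0
      rw [← intervalIntegral.integral_add_adjacent_intervals (hi 0 T) (hi T t), h0, zero_add,
        intervalIntegral.integral_congr (g := fun _ => (0 : ℝ)) this]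
      simp
  have htsupp : tsupport (fun t => ∫ s in (0 : ℝ)..t, ψ s) ⊆ Icc a b :=
    closure_minimal hsupp isClosed_Icc
  refine ⟨_, ?_, isCompact_Icc.of_isClosed_subset (isClosed_tsupport _) htsupp,
    htsupp.trans fun t ht => ⟨by linarith [ht.1], by linarith [ht.2]⟩, hderiv⟩
  rw [contDiff_infty_iff_deriv, hderiv]
  exact ⟨fun t => (hd t).differentiableAt, hψ⟩

/-- A continuous function with zero distributional derivative is constant. -/
theorem eq_of_forall_integral_deriv_smul_eq_zero {k : ℝ → E} {T : ℝ} (hT : 0 < T)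
    (hk : ContinuousOn k (Icc 0 T))
    (h : ∀ η : ℝ → ℝ, ContDiff ℝ ∞ η → HasCompactSupport η → tsupport η ⊆ Ioo 0 T →
      ∫ t in (0 : ℝ)..T, deriv η t • k t = 0) :
    ∀ t ∈ Icc 0 T, k t = k 0 := by
  obtain ⟨ρ, hρ, hρc, hρT, hρ1⟩ : ∃ ρ : ℝ → ℝ, ContDiff ℝ ∞ ρ ∧ HasCompactSupport ρ ∧
      tsupport ρ ⊆ Ioo 0 T ∧ ∫ t in (0 : ℝ)..T, ρ t = 1 := by
    let f : ContDiffBump (T / 2) := ⟨T / 8, T / 4, by linarith, by linarith⟩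
    have hf : tsupport (f.normed volume) ⊆ Ioo 0 T := by
      rw [f.tsupport_normed_eq, Real.closedBall_eq_Icc]
      intro t ht
      have h1 : f.rOut = T / 4 := rfl
      rw [h1] at ht
      exact ⟨by linarith [ht.1], by linarith [ht.2]⟩
    refine ⟨f.normed volume, f.contDiff_normed, f.hasCompactSupport_normed, hf, ?_⟩
    rw [intervalIntegral.integral_of_le hT.le, setIntegral_eq_integral_of_forall_compl_eq_zero,
      f.integral_normed]
    intro t ht
    exact image_eq_zero_of_notMem_tsupport fun h' => ht ⟨(hf h').1, (hf h').2.le⟩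
  -- `c` is the only candidate for the constant value. For any test function `ψ`, the function `ψ -
  -- (∫ψ)ρ` has zero mean, hence is the derivative of a test function.
  set c : E := ∫ t in (0 : ℝ)..T, ρ t • k t with hc
  have hint : ∀ {g : ℝ → ℝ}, Continuous g → IntervalIntegrable (fun t => g t • k t) volume 0 T :=
    fun hg => (hg.continuousOn.smul (by rwa [uIcc_of_le hT.le])).intervalIntegrable
  have hae : ∀ᵐ t, t ∈ Ioo 0 T → k t - c = 0 := by
    refine isOpen_Ioo.ae_eq_zero_of_integral_contDiff_smul_eq_zero
      ((hk.mono Ioo_subset_Icc_self).sub continuousOn_const |>.locallyIntegrableOn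
        measurableSet_Ioo) ?_
    intro ψ hψ hψc hψT
    set d : ℝ := ∫ t in (0 : ℝ)..T, ψ t with hd
    have i1 : IntervalIntegrable ψ volume 0 T := hψ.continuous.intervalIntegrable _ _
    have i2 : IntervalIntegrable (fun t => d * ρ t) volume 0 T :=
      (hρ.continuous.intervalIntegrable _ _).const_mul d
    have hsupp : tsupport (fun t => ψ t - d * ρ t) ⊆ tsupport ψ ∪ tsupport ρ := by
      refine closure_minimal (fun t ht => ?_) ((isClosed_tsupport _).union (isClosed_tsupport _))
      by_contra hn
      rw [mem_union, not_or] at hn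
      refine ht ?_
      simp only [image_eq_zero_of_notMem_tsupport hn.1, image_eq_zero_of_notMem_tsupport hn.2,
        mul_zero, sub_zero]
    obtain ⟨η, hη, hηc, hηT, hηd⟩ := exists_primitive_of_integral_eq_zero
      (ψ := fun t => ψ t - d * ρ t) hT (hψ.sub (contDiff_const.mul hρ))
      ((IsCompact.union hψc hρc).of_isClosed_subset (isClosed_tsupport _) hsupp)
      (hsupp.trans (union_subset hψT hρT))
      (by rw [intervalIntegral.integral_sub i1 i2, intervalIntegral.integral_const_mul, hρ1, ← hd]
          ring)
    have h1 := h η hη hηc hηT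
    have h2 : ∫ t in (0 : ℝ)..T, ψ t • (k t - c) = 0 := by
      rw [← h1, hηd]
      have e1 : ∀ t, ψ t • (k t - c) = ψ t • k t - ψ t • c := fun t => smul_sub _ _ _
      have e2 : ∀ t, (ψ t - d * ρ t) • k t = ψ t • k t - d • ρ t • k t := fun t => by
        rw [sub_smul, mul_smul]
      simp_rw [e1, e2]
      have i3 : IntervalIntegrable (fun t => ψ t • c) volume 0 T :=
        (hψ.continuous.smul continuous_const).intervalIntegrable _ _
      have i4 : IntervalIntegrable (fun t => d • ρ t • k t) volume 0 T := (hint hρ.continuous).smul d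
      rw [intervalIntegral.integral_sub (hint hψ.continuous) i3,
        intervalIntegral.integral_sub (hint hψ.continuous) i4,
        intervalIntegral.integral_smul_const, intervalIntegral.integral_smul]
    rw [← h2, intervalIntegral.integral_of_le hT.le,
      setIntegral_eq_integral_of_forall_compl_eq_zero]
    intro t ht
    rw [image_eq_zero_of_notMem_tsupport fun h' => ht ⟨(hψT h').1, (hψT h').2.le⟩, zero_smul]
  have hEq : EqOn k (fun _ => c) (Icc 0 T) := by
    have h1 : EqOn k (fun _ => c) (Ioo 0 T) := by
      refine Measure.eqOn_open_of_ae_eq (μ := volume) ?_ isOpen_Ioo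
        (hk.mono Ioo_subset_Icc_self) continuousOn_const
      rw [Filter.EventuallyEq, ae_restrict_iff' measurableSet_Ioo]
      filter_upwards [hae] with t ht htm
      exact sub_eq_zero.1 (ht htm)
    exact h1.of_subset_closure hk continuousOn_const Ioo_subset_Icc_self
      (by rw [closure_Ioo hT.ne])
  intro t ht
  rw [hEq ht, hEq ⟨le_rfl, hT.le⟩]

end DuBoisReymond

/-- Integration by parts for `f` merely integrable: the product rule above with both spaces equal to
`𝕜`, `α = 0`, and the primitive of `f` as the weak solution. -/
theorem integral_deriv_smul_primitive {𝕜 : Type*} [RCLike 𝕜] {f : ℝ → 𝕜} {T : ℝ} (hT : 0 < T)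
    (hf : IntervalIntegrable f volume 0 T) {η : ℝ → ℝ} (hη : ContDiff ℝ ∞ η) (hηT : η T = 0) :
    ∫ t in (0 : ℝ)..T, deriv η t • (∫ s in (0 : ℝ)..t, f s) =
      -∫ t in (0 : ℝ)..T, η t • f t := by
  have hF : ContinuousOn (fun t => ∫ s in (0 : ℝ)..t, f s) (Icc 0 T) := by
    have := intervalIntegral.continuousOn_primitive_interval' hf left_mem_uIcc
    rwa [uIcc_of_le hT.le] at this
  have hη' : Continuous (deriv η) := hη.continuous_deriv (by simp)
  have hd : ∀ t, HasDerivAt (fun t => (η t : 𝕜)) ((deriv η t : ℝ) : 𝕜) t := fun t => by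
    have h1 : HasDerivAt η (deriv η t) t := (hη.differentiable (by simp) t).hasDerivAt
    exact (RCLike.ofRealCLM (K := 𝕜)).hasFDerivAt.comp_hasDerivAt t h1
  have h := inner_sub_inner_eq_integral (𝕜 := 𝕜) (φ := fun t => (η t : 𝕜))
    (φ' := fun t => ((deriv η t : ℝ) : 𝕜)) (α := fun _ => 0) (β := fun t => (η t : 𝕜))
    (y := fun t => ∫ s in (0 : ℝ)..t, f s) (w := f) hT.le hd
    (RCLike.continuous_ofReal.comp hη') continuous_const
    (RCLike.continuous_ofReal.comp hη.continuous) hF hf (fun s t₁ t₂ _ _ h1 h2 h3 => by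
      have j1 : IntervalIntegrable f volume 0 t₁ := hf.mono_set (by
        rw [uIcc_of_le hT.le, uIcc_of_le h1]; exact Icc_subset_Icc le_rfl (h2.trans h3))
      have j2 : IntervalIntegrable f volume t₁ t₂ := hf.mono_set (by
        rw [uIcc_of_le hT.le, uIcc_of_le h2]; exact Icc_subset_Icc h1 h3)
      rw [← intervalIntegral.integral_add_adjacent_intervals j1 j2, add_sub_cancel_left,
        ← intervalIntegral_inner j2]
      simp)
  have i1 : IntervalIntegrable (fun t => deriv η t • (∫ s in (0 : ℝ)..t, f s)) volume 0 T :=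
    (hη'.continuousOn.smul (by rwa [uIcc_of_le hT.le])).intervalIntegrable
  have i2 : IntervalIntegrable (fun t => η t • f t) volume 0 T :=
    hf.continuousOn_smul hη.continuous.continuousOn
  rw [eq_neg_iff_add_eq_zero, ← intervalIntegral.integral_add i1 i2]
  simp only [hηT, RCLike.ofReal_zero, inner_zero_left, intervalIntegral.integral_same,
    inner_zero_right, sub_zero] at h
  rw [h]
  refine intervalIntegral.integral_congr fun t _ => ?_
  simp [RCLike.real_smul_eq_coe_mul, mul_comm]

variable {𝕜 : Type*} [RCLike 𝕜] {H : Type*} [NormedAddCommGroup H] [InnerProductSpace 𝕜 H]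
  [CompleteSpace H] {A : H →ₗ.[𝕜] H} {f : ℝ → A.adjoint.domain → 𝕜} {T : ℝ} {y₀ : H} {y : ℝ → H}

/-- Weak solutions in the sense of distributions are weak solutions in the integrated sense. -/
theorem isWeakSolution_iff (hT : 0 < T) (hf : ∀ φ, IntervalIntegrable (fun t => f t φ) volume 0 T) :
    IsWeakSolution A f T y₀ y ↔ ContinuousOn y (Icc 0 T) ∧ y 0 = y₀ ∧
      ∀ (φ : A.adjoint.domain), ∀ t ∈ Icc 0 T, inner 𝕜 (φ : H) (y t) =
        inner 𝕜 (φ : H) y₀ + ∫ s in (0 : ℝ)..t, (inner 𝕜 (A.adjoint φ) (y s) + f s φ) := by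
  unfold IsWeakSolution
  refine and_congr_right fun hy => and_congr_right fun hy0 => forall_congr' fun φ => ?_
  set F : ℝ → 𝕜 := fun s => inner 𝕜 (A.adjoint φ) (y s) + f s φ with hF
  have iF : IntervalIntegrable F volume 0 T := by
    refine IntervalIntegrable.add (ContinuousOn.intervalIntegrable ?_) (hf φ)
    rw [uIcc_of_le hT.le]
    exact continuousOn_const.inner hy
  have hP : ContinuousOn (fun t => ∫ s in (0 : ℝ)..t, F s) (Icc 0 T) := by
    have := intervalIntegral.continuousOn_primitive_interval' iF left_mem_uIcc
    rwa [uIcc_of_le hT.le] at this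
  have hφy : ContinuousOn (fun t => inner 𝕜 (φ : H) (y t)) (Icc 0 T) :=
    continuousOn_const.inner hy
  have hηT : ∀ {η : ℝ → ℝ}, tsupport η ⊆ Ioo 0 T → η T = 0 := fun h =>
    image_eq_zero_of_notMem_tsupport fun h' => lt_irrefl _ (h h').2
  constructor
  · intro h t ht
    -- Subtracting the primitive of the right-hand side leaves a continuous function with zero
    -- distributional derivative.
    have := eq_of_forall_integral_deriv_smul_eq_zero
      (k := fun t => inner 𝕜 (φ : H) (y t) - ∫ s in (0 : ℝ)..t, F s) hT (hφy.sub hP) (fun η hη hηc hηs => by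
      have h1 := h η hη hηc hηs
      have h2 := integral_deriv_smul_primitive hT iF hη (hηT hηs)
      have hη' : Continuous (deriv η) := hη.continuous_deriv (by simp)
      simp only [smul_sub]
      rw [intervalIntegral.integral_sub, h2, ← h1, neg_neg, sub_self]
      · exact (hη'.continuousOn.smul (by rwa [uIcc_of_le hT.le])).intervalIntegrable
      · exact (hη'.continuousOn.smul (by rwa [uIcc_of_le hT.le])).intervalIntegrable) t ht
    simp only [intervalIntegral.integral_same, sub_zero, hy0] at this
    rw [← this]; abel
  · intro h η hη hηc hηs
    have h2 := integral_deriv_smul_primitive hT iF hη (hηT hηs)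
    rw [← neg_eq_iff_eq_neg] at h2
    rw [← h2]
    have hη' : Continuous (deriv η) := hη.continuous_deriv (by simp)
    -- The initial value contributes nothing, because `η` vanishes at both ends.
    have hc : ∫ t in (0 : ℝ)..T, deriv η t • (inner 𝕜 (φ : H) y₀ : 𝕜) = 0 := by
      rw [intervalIntegral.integral_smul_const, intervalIntegral.integral_deriv_eq_sub
        (fun t _ => hη.differentiable (by simp) t) (hη'.intervalIntegrable _ _), hηT hηs,
        image_eq_zero_of_notMem_tsupport fun h' => lt_irrefl _ (hηs h').1]
      simp
    congr 1
    rw [← zero_add (∫ t in (0 : ℝ)..T, deriv η t • ∫ s in (0 : ℝ)..t, F s), ← hc,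
      ← intervalIntegral.integral_add]
    · refine intervalIntegral.integral_congr fun t ht => ?_
      rw [uIcc_of_le hT.le] at ht
      simp only [h t ht, smul_add]
    · exact (hη'.smul continuous_const).intervalIntegrable _ _
    · exact (hη'.continuousOn.smul (by rwa [uIcc_of_le hT.le])).intervalIntegrable

/-! ### Continuous functions cut off in time, as elements of `L²`. -/

section Cutoff

variable {𝕜 : Type*} [RCLike 𝕜] {U : Type*} [NormedAddCommGroup U] [InnerProductSpace 𝕜 U]
  [CompleteSpace U]

theorem memLp_indicator_of_continuous {β : ℝ → U} (hβ : Continuous β) (T s : ℝ) :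
    MemLp ((Iic s).indicator β) 2 (volume.restrict (Ioo 0 T)) := by
  obtain ⟨C, hC⟩ := (isCompact_Icc (a := (0 : ℝ)) (b := T)).exists_bound_of_continuousOn
    hβ.continuousOn
  refine (MemLp.of_bound (C := C) hβ.aestronglyMeasurable ?_).indicator measurableSet_Iic
  filter_upwards [ae_restrict_mem measurableSet_Ioo] with t ht
  exact hC t (Ioo_subset_Icc_self ht)

/-- The class in `L²((0, T); U)` of a continuous function cut off after time `s`. -/
noncomputable def cutoffLp (T : ℝ) {β : ℝ → U} (hβ : Continuous β) (s : ℝ) :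
    Lp U 2 (volume.restrict (Ioo (0 : ℝ) T)) :=
  (memLp_indicator_of_continuous hβ T s).toLp _

theorem cutoffLp_ae {T : ℝ} {β : ℝ → U} (hβ : Continuous β) (s : ℝ) :
    cutoffLp T hβ s =ᵐ[volume.restrict (Ioo (0 : ℝ) T)] (Iic s).indicator β :=
  MemLp.coeFn_toLp _

theorem cutoffLp_self_ae {T : ℝ} {β : ℝ → U} (hβ : Continuous β) :
    cutoffLp T hβ T =ᵐ[volume.restrict (Ioo (0 : ℝ) T)] β := by
  filter_upwards [cutoffLp_ae hβ T, ae_restrict_mem measurableSet_Ioo] with t ht ht'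
  rw [ht, indicator_of_mem (by exact ht'.2.le)]

theorem IsL2.intervalIntegrable {T : ℝ} (hT : 0 ≤ T) {v : ℝ → U} (hv : IsL2 T v) :
    IntervalIntegrable v volume 0 T := by
  rw [intervalIntegrable_iff_integrableOn_Ioo_of_le hT]
  exact hv.integrable (by norm_num)

theorem isL2_coeFn {T : ℝ} (v : Lp U 2 (volume.restrict (Ioo (0 : ℝ) T))) : IsL2 T v :=
  Lp.memLp v

theorem setIntegral_indicator_Iic {E : Type*} [NormedAddCommGroup E] [NormedSpace ℝ E] {T s : ℝ}
    (hs : s ∈ Icc 0 T) (f : ℝ → E) :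
    ∫ t in Ioo 0 T, (Iic s).indicator f t = ∫ t in (0 : ℝ)..s, f t := by
  rw [← integral_Ioc_eq_integral_Ioo, setIntegral_indicator measurableSet_Iic, Ioc_inter_Iic,
    min_eq_right hs.2, intervalIntegral.integral_of_le hs.1]

/-- Integrals over all intervals `[0, s]`, `s ≤ T`, become inner products in one fixed Hilbert
space, so that uniform boundedness applies to all `s` at once. -/
theorem inner_cutoffLp {T s : ℝ} (hs : s ∈ Icc 0 T) {β : ℝ → U} (hβ : Continuous β)
    (v : Lp U 2 (volume.restrict (Ioo (0 : ℝ) T))) :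
    inner 𝕜 (cutoffLp T hβ s) v = ∫ t in (0 : ℝ)..s, inner 𝕜 (β t) (v t) := by
  rw [L2.inner_def, ← setIntegral_indicator_Iic hs]
  refine integral_congr_ae ?_
  filter_upwards [cutoffLp_ae hβ s] with t ht
  rw [ht]
  by_cases h : t ∈ Iic s
  · simp only [indicator_of_mem h]
  · simp only [indicator_of_notMem h, inner_zero_left]

theorem integral_inner_cutoffLp {T r s : ℝ} (hr : r ∈ Icc 0 T) (hs : s ∈ Icc 0 T) {β γ : ℝ → U}
    (hβ : Continuous β) :
    ∫ t in (0 : ℝ)..r, inner 𝕜 (γ t) (cutoffLp T hβ s t) =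
      ∫ t in (0 : ℝ)..min r s, inner 𝕜 (γ t) (β t) := by
  have hm : min r s ∈ Icc 0 T := ⟨le_min hr.1 hs.1, (min_le_left _ _).trans hr.2⟩
  rw [← setIntegral_indicator_Iic hr, ← setIntegral_indicator_Iic hm]
  refine integral_congr_ae ?_
  filter_upwards [cutoffLp_ae hβ s] with t ht
  have hI : Iic (min r s) = Iic r ∩ Iic s := Iic_inter_Iic.symm
  by_cases h1 : t ∈ Iic r
  · by_cases h2 : t ∈ Iic s
    · rw [indicator_of_mem h1, hI, indicator_of_mem (mem_inter h1 h2), ht, indicator_of_mem h2]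
    · rw [indicator_of_mem h1, hI, indicator_of_notMem (fun h => h2 h.2), ht,
        indicator_of_notMem h2, inner_zero_right]
  · rw [indicator_of_notMem h1, hI, indicator_of_notMem (fun h => h1 h.1)]

theorem cutoffLp_add (T : ℝ) {β γ : ℝ → U} (hβ : Continuous β) (hγ : Continuous γ) (s : ℝ)
    {δ : ℝ → U} (hδ : Continuous δ) (h : ∀ t, δ t = β t + γ t) :
    cutoffLp T hδ s = cutoffLp T hβ s + cutoffLp T hγ s := by
  obtain rfl : δ = β + γ := funext h
  rw [cutoffLp, cutoffLp, cutoffLp, ← MemLp.toLp_add]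
  congr 1
  exact indicator_add _ _ _

theorem cutoffLp_smul (T : ℝ) {β : ℝ → U} (hβ : Continuous β) (c : 𝕜) (s : ℝ)
    {δ : ℝ → U} (hδ : Continuous δ) (h : ∀ t, δ t = c • β t) :
    cutoffLp T hδ s = c • cutoffLp T hβ s := by
  obtain rfl : δ = c • β := funext h
  rw [cutoffLp, cutoffLp, ← MemLp.toLp_const_smul]
  congr 1
  exact indicator_const_smul _ _ _

end Cutoff

namespace IsC0Group

variable {𝕜 : Type*} [RCLike 𝕜] {H : Type*} [NormedAddCommGroup H] [InnerProductSpace 𝕜 H]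
  [CompleteSpace H] {S : ℝ → H →L[𝕜] H}

theorem neg (hS : IsC0Group S) : IsC0Group fun t => S (-t) := by
  refine ⟨by simpa using hS.map_zero, fun s t => ?_, fun x => ?_⟩
  · rw [← hS.map_add, neg_add]
  · have h : Tendsto (fun t : ℝ => -t) (𝓝 0) (𝓝 (-0)) := continuous_neg.tendsto 0
    rw [neg_zero] at h
    exact (hS.tendsto x).comp h

/-- Strong continuity and local boundedness: `S(t)f(t) = S(t)(f(t) - f(t₀)) + S(t)f(t₀)`. -/
theorem continuousOn_apply_apply (hS : IsC0Group S) {f : ℝ → H} {K : Set ℝ}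
    (hf : ContinuousOn f K) : ContinuousOn (fun t => S t (f t)) K := by
  intro t₀ ht₀
  obtain ⟨M, hM1, hM⟩ := hS.exists_norm_le_of_mem_Icc (|t₀| + 1)
  have h1 : Tendsto (fun t => S t (f t - f t₀)) (𝓝[K] t₀) (𝓝 0) := by
    have h2 : Tendsto (fun t => M * ‖f t - f t₀‖) (𝓝[K] t₀) (𝓝 0) := by
      have := ((hf t₀ ht₀).tendsto.sub (tendsto_const_nhds (x := f t₀))).norm.const_mul M
      simpa only [sub_self, norm_zero, mul_zero] using this
    refine squeeze_zero_norm' ?_ h2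
    have : ∀ᶠ t in 𝓝[K] t₀, t ∈ Icc (-(|t₀| + 1)) (|t₀| + 1) := by
      refine nhdsWithin_le_nhds (Icc_mem_nhds ?_ ?_)
      · linarith [neg_abs_le t₀]
      · linarith [le_abs_self t₀]
    filter_upwards [this] with t ht
    exact (S t).le_of_opNorm_le (hM t ht) _
  have h3 := h1.add ((hS.continuous_apply (f t₀)).continuousWithinAt (s := K) (x := t₀)).tendsto
  rw [zero_add] at h3
  refine h3.congr fun t => ?_
  rw [map_sub, sub_add_cancel]

end IsC0Group

/-! ### Duality: admissibility and controllability as bounds on the output `B* S(-t)* φ`. -/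

section Observation

variable {𝕜 : Type*} [RCLike 𝕜] {H : Type*} [NormedAddCommGroup H] [InnerProductSpace 𝕜 H]
  [CompleteSpace H] {U : Type*} [NormedAddCommGroup U] [InnerProductSpace 𝕜 U] [CompleteSpace U]
  [NormedSpace ℝ H] [IsScalarTower ℝ 𝕜 H]
  {S : ℝ → H →L[𝕜] H} {A : H →ₗ.[𝕜] H}

/-- The output `t ↦ B* S(-t)* φ`, for `φ ∈ D(A*)` and `B* = C₁ + C₂ A*`. -/
noncomputable def dualOutput (S : ℝ → H →L[𝕜] H) (C₁ C₂ : H →L[𝕜] U) (φ : A.adjoint.domain)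
    (t : ℝ) : U :=
  C₁ (dualGroup S t (φ : H)) + C₂ (dualGroup S t (A.adjoint φ))

variable {C₁ C₂ : H →L[𝕜] U}

theorem continuous_dualOutput (hS : IsC0Group S) (hA : IsGenerator S A) (φ : A.adjoint.domain) :
    Continuous (dualOutput S C₁ C₂ φ) :=
  (C₁.continuous.comp ((hS.isC0Group_dualGroup hA).continuous_apply _)).add
    (C₂.continuous.comp ((hS.isC0Group_dualGroup hA).continuous_apply _))

theorem dualOutput_add (φ ψ : A.adjoint.domain) (t : ℝ) :
    dualOutput S C₁ C₂ (φ + ψ) t = dualOutput S C₁ C₂ φ t + dualOutput S C₁ C₂ ψ t := by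
  simp only [dualOutput, Submodule.coe_add, LinearPMap.map_add, map_add]
  abel

theorem dualOutput_smul (c : 𝕜) (φ : A.adjoint.domain) (t : ℝ) :
    dualOutput S C₁ C₂ (c • φ) t = c • dualOutput S C₁ C₂ φ t := by
  simp only [dualOutput, Submodule.coe_smul, LinearPMap.map_smul, map_smul, smul_add]

variable {B : ControlOperator A U}

theorem control_adjointFlow (hS : IsC0Group S) (hA : IsGenerator S A)
    (hC : ∀ (w : U) (φ : A.adjoint.domain),
      B.toLinearMap w φ = inner 𝕜 (C₁ (φ : H) + C₂ (A.adjoint φ)) w)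
    (w : U) (φ : A.adjoint.domain) (t : ℝ) :
    B.toLinearMap w (adjointFlow hS hA (-t) φ) = inner 𝕜 (dualOutput S C₁ C₂ φ t) w := by
  rw [hC, hS.adjoint_adjointFlow hA]
  rfl

/-- The input map `v ↦ ∫₀ˢ S(-τ) B v(τ) dτ` is bounded on `L²`, uniformly for `s ∈ [0, T]`. -/
theorem exists_input_bound (hS : IsC0Group S) (hA : IsGenerator S A)
    (hC : ∀ (w : U) (φ : A.adjoint.domain),
      B.toLinearMap w φ = inner 𝕜 (C₁ (φ : H) + C₂ (A.adjoint φ)) w)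
    (hB : IsAdmissible hS hA B) {T : ℝ} (hT : 0 < T) :
    ∃ C : ℝ, 0 ≤ C ∧ ∀ v : Lp U 2 (volume.restrict (Ioo (0 : ℝ) T)), ∃ p : ℝ → H,
      ContinuousOn p (Icc 0 T) ∧ (∀ s ∈ Icc 0 T, ‖p s‖ ≤ C * ‖v‖) ∧
      ∀ s ∈ Icc 0 T, ∀ φ : A.adjoint.domain,
        inner 𝕜 (φ : H) (p s) = ∫ τ in (0 : ℝ)..s, inner 𝕜 (dualOutput S C₁ C₂ φ τ) (v τ) := by
  have hex : ∀ v : Lp U 2 (volume.restrict (Ioo (0 : ℝ) T)), ∃ p : ℝ → H,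
      ContinuousOn p (Icc 0 T) ∧ ∀ s ∈ Icc 0 T, ∀ φ : A.adjoint.domain,
        inner 𝕜 (φ : H) (p s) = ∫ τ in (0 : ℝ)..s, inner 𝕜 (dualOutput S C₁ C₂ φ τ) (v τ) := by
    intro v
    obtain ⟨Φ, hΦ, hΦp⟩ := hB T hT v (isL2_coeFn v)
    -- Applying `S(-s)` turns the kernel `S(s - τ)` into `S(-τ)`, which no longer depends on the end
    -- point `s`.
    refine ⟨fun s => S (-s) (Φ s), hS.neg.continuousOn_apply_apply hΦ, fun s hs φ => ?_⟩
    have h1 := hΦp s hs (adjointFlow hS hA (-s) φ)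
    have h2 : inner 𝕜 (φ : H) (S (-s) (Φ s)) =
        inner 𝕜 ((adjointFlow hS hA (-s) φ : A.adjoint.domain) : H) (Φ s) :=
      (ContinuousLinearMap.adjoint_inner_left _ _ _).symm
    rw [h2, h1]
    refine intervalIntegral.integral_congr fun τ _ => ?_
    rw [← control_adjointFlow hS hA hC]
    congr 1
    refine Subtype.ext ?_
    change (S (s - τ)).adjoint ((S (-s)).adjoint (φ : H)) = (S (-τ)).adjoint (φ : H)
    rw [← ContinuousLinearMap.comp_apply, ← ContinuousLinearMap.adjoint_comp, ← hS.map_add]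
    congr 3
    ring
  -- The family is indexed by the time as well as by the test vector, so the bound is uniform in
  -- `s`. For a fixed input it is bounded, since `p` is continuous on a compact interval.
  let ι := {q : ℝ × A.adjoint.domain // q.1 ∈ Icc 0 T ∧ ‖(q.2 : H)‖ ≤ 1}
  obtain ⟨C, hCb⟩ := banach_steinhaus (ι := ι)
    (g := fun q => innerSL 𝕜 (cutoffLp T (continuous_dualOutput hS hA (C₁ := C₁) (C₂ := C₂) q.1.2)
      q.1.1)) (fun v => by
    obtain ⟨p, hp, hpi⟩ := hex v
    obtain ⟨K, hK⟩ := isCompact_Icc.exists_bound_of_continuousOn hp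
    refine ⟨K, fun q => ?_⟩
    rw [innerSL_apply_apply, inner_cutoffLp q.2.1, ← hpi _ q.2.1]
    exact (norm_inner_le_norm _ _).trans
      ((mul_le_of_le_one_left (norm_nonneg _) q.2.2).trans (hK _ q.2.1)))
  have hC0 : 0 ≤ C := (norm_nonneg _).trans (hCb ⟨(0, 0), ⟨⟨le_rfl, hT.le⟩, by simp⟩⟩)
  refine ⟨C, hC0, fun v => ?_⟩
  obtain ⟨p, hp, hpi⟩ := hex v
  refine ⟨p, hp, fun s hs => ?_, hpi⟩
  refine norm_le_of_forall_dense_inner (𝕜 := 𝕜) (hS.dense_adjoint_domain hA) (by positivity)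
    fun φ hφ => ?_
  by_cases h0 : φ = 0
  · simp [h0]
  have hn : 0 < ‖φ‖ := norm_pos_iff.2 h0
  let ψ : A.adjoint.domain := ((‖φ‖⁻¹ : ℝ) : 𝕜) • ⟨φ, hφ⟩
  have hψ : (ψ : H) = ((‖φ‖⁻¹ : ℝ) : 𝕜) • φ := rfl
  have hψ1 : ‖(ψ : H)‖ ≤ 1 := by
    rw [hψ, norm_smul, RCLike.norm_ofReal, abs_of_pos (by positivity), inv_mul_cancel₀ hn.ne']
  have h1 := (innerSL 𝕜 (cutoffLp T (continuous_dualOutput hS hA (C₁ := C₁) (C₂ := C₂) ψ)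
    s)).le_of_opNorm_le (hCb ⟨(s, ψ), hs, hψ1⟩) v
  rw [innerSL_apply_apply, inner_cutoffLp hs, ← hpi _ hs, hψ, inner_smul_left, norm_mul,
    RCLike.norm_conj, RCLike.norm_ofReal, abs_of_pos (by positivity), inv_mul_le_iff₀ hn] at h1
  linarith

/-- The output map is bounded into `L²`. -/
theorem exists_norm_output_le (hS : IsC0Group S) (hA : IsGenerator S A)
    (hC : ∀ (w : U) (φ : A.adjoint.domain),
      B.toLinearMap w φ = inner 𝕜 (C₁ (φ : H) + C₂ (A.adjoint φ)) w)
    (hB : IsAdmissible hS hA B) {T : ℝ} (hT : 0 < T) :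
    ∃ C : ℝ, 0 ≤ C ∧ ∀ φ : A.adjoint.domain,
      ‖cutoffLp T (continuous_dualOutput hS hA (C₁ := C₁) (C₂ := C₂) φ) T‖ ≤ C * ‖(φ : H)‖ := by
  obtain ⟨C, hC0, h⟩ := exists_input_bound hS hA hC hB hT
  refine ⟨C, hC0, fun φ => ?_⟩
  -- The input is taken to be the output of `φ` itself, so that duality reads `‖v‖² = ⟪φ, p(T)⟫ ≤
  -- ‖φ‖ C ‖v‖`.
  set v := cutoffLp T (continuous_dualOutput hS hA (C₁ := C₁) (C₂ := C₂) φ) T with hv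
  obtain ⟨p, -, hpb, hpi⟩ := h v
  have hTm : T ∈ Icc 0 T := ⟨hT.le, le_rfl⟩
  have h1 := hpi T hTm φ
  rw [← inner_cutoffLp hTm (continuous_dualOutput hS hA φ), ← hv,
    inner_self_eq_norm_sq_to_K] at h1
  have h2 : ‖v‖ ^ 2 ≤ ‖(φ : H)‖ * (C * ‖v‖) := by
    have h3 := congrArg norm h1
    rw [norm_pow, RCLike.norm_ofReal, abs_norm] at h3
    rw [← h3]
    exact (norm_inner_le_norm _ _).trans
      (mul_le_mul_of_nonneg_left (hpb T hTm) (norm_nonneg _))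
  by_contra! hlt
  nlinarith [norm_nonneg v, mul_nonneg hC0 (norm_nonneg (φ : H))]

/-- The duality identity for weak solutions with a square integrable control. -/
theorem inner_dualGroup_weakSolution (hS : IsC0Group S) (hA : IsGenerator S A)
    (hC : ∀ (w : U) (φ : A.adjoint.domain),
      B.toLinearMap w φ = inner 𝕜 (C₁ (φ : H) + C₂ (A.adjoint φ)) w)
    {T : ℝ} (hT : 0 < T) {w : ℝ → U} (hw : IsL2 T w) {y₀ : H} {y : ℝ → H}
    (hy : IsWeakSolution A (fun t φ => B.toLinearMap (w t) φ) T y₀ y) (φ : A.adjoint.domain) :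
    inner 𝕜 (dualGroup S T (φ : H)) (y T) - inner 𝕜 (φ : H) y₀ =
      ∫ t in (0 : ℝ)..T, inner 𝕜 (dualOutput S C₁ C₂ φ t) (w t) := by
  have hV := hS.isC0Group_dualGroup hA
  have iw := hw.intervalIntegrable hT.le
  simp only [hC] at hy
  rw [isWeakSolution_iff hT (fun φ => intervalIntegrable_inner continuous_const iw)] at hy
  obtain ⟨hyc, hy0, hyi⟩ := hy
  -- Along the moving test vector `S(-t)*φ` the derivative of the test vector cancels the term with
  -- `A*`, and only the control remains.
  have h := inner_sub_inner_eq_integral (𝕜 := 𝕜) (φ := fun t => dualGroup S t (φ : H))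
    (φ' := fun t => -dualGroup S t (A.adjoint φ)) (α := fun t => dualGroup S t (A.adjoint φ))
    (β := dualOutput S C₁ C₂ φ) (y := y) (w := w) hT.le (hS.hasDerivAt_dualGroup hA φ)
    (hV.continuous_apply _).neg (hV.continuous_apply _) (continuous_dualOutput hS hA φ) hyc iw
    (fun s t₁ t₂ _ _ h1 h2 h3 => by
      have e1 := hyi (adjointFlow hS hA (-s) φ) t₁ ⟨h1, h2.trans h3⟩
      have e2 := hyi (adjointFlow hS hA (-s) φ) t₂ ⟨h1.trans h2, h3⟩
      rw [hS.adjoint_adjointFlow hA] at e1 e2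
      have hint : ∀ {a b}, 0 ≤ a → a ≤ b → b ≤ T → IntervalIntegrable
          (fun τ => inner 𝕜 (dualGroup S s (A.adjoint φ)) (y τ) +
            inner 𝕜 (dualOutput S C₁ C₂ φ s) (w τ)) volume a b := by
        intro a b h1 h2 h3
        have hsub : uIcc a b ⊆ Icc 0 T := by rw [uIcc_of_le h2]; exact Icc_subset_Icc h1 h3
        refine IntervalIntegrable.add
          (ContinuousOn.intervalIntegrable (continuousOn_const.inner (hyc.mono hsub)))
          (intervalIntegrable_inner continuous_const
            (iw.mono_set (by rwa [uIcc_of_le hT.le])))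
      have e3 := intervalIntegral.integral_add_adjacent_intervals
        (hint le_rfl h1 (h2.trans h3)) (hint h1 h2 h3)
      have e4 : inner 𝕜 (dualGroup S s (φ : H)) (y t₂) - inner 𝕜 (dualGroup S s (φ : H)) (y t₁) =
          (inner 𝕜 (dualGroup S s (φ : H)) y₀ + ∫ τ in (0 : ℝ)..t₂,
            (inner 𝕜 (dualGroup S s (A.adjoint φ)) (y τ) +
              inner 𝕜 (dualOutput S C₁ C₂ φ s) (w τ))) -
          (inner 𝕜 (dualGroup S s (φ : H)) y₀ + ∫ τ in (0 : ℝ)..t₁,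
            (inner 𝕜 (dualGroup S s (A.adjoint φ)) (y τ) +
              inner 𝕜 (dualOutput S C₁ C₂ φ s) (w τ))) := congrArg₂ _ e2 e1
      rw [inner_sub_right, e4, ← e3]
      ring)
  simp only [neg_add_cancel, inner_zero_left, zero_add, hS.dualGroup_zero, hy0] at h
  exact h

/-- Exact controllability implies the observability inequality. -/
theorem exists_norm_le_output (hS : IsC0Group S) (hA : IsGenerator S A)
    (hC : ∀ (w : U) (φ : A.adjoint.domain),
      B.toLinearMap w φ = inner 𝕜 (C₁ (φ : H) + C₂ (A.adjoint φ)) w)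
    {T : ℝ} (hT : 0 < T) (hc : IsExactlyControllable A B T) :
    ∃ C : ℝ, 0 ≤ C ∧ ∀ φ : A.adjoint.domain,
      ‖(φ : H)‖ ≤ C * ‖cutoffLp T (continuous_dualOutput hS hA (C₁ := C₁) (C₂ := C₂) φ) T‖ := by
  have hTm : T ∈ Icc 0 T := ⟨hT.le, le_rfl⟩
  let ι := {φ : A.adjoint.domain //
    ‖cutoffLp T (continuous_dualOutput hS hA (C₁ := C₁) (C₂ := C₂) φ) T‖ ≤ 1}
  -- Pointwise boundedness is null controllability: if `w` steers `y₀` to `0`, then `|⟪φ, y₀⟫|` is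
  -- at most the norm of `w` times that of the output of `φ`.
  obtain ⟨C, hCb⟩ := banach_steinhaus (ι := ι) (g := fun φ => innerSL 𝕜 (φ.1 : H)) (fun y₀ => by
    obtain ⟨w, y, hw, hy, hyT⟩ := hc y₀ 0
    refine ⟨‖hw.toLp w‖, fun φ => ?_⟩
    have h1 := inner_dualGroup_weakSolution hS hA hC hT hw hy φ.1
    have h2 : ∫ t in (0 : ℝ)..T, inner 𝕜 (dualOutput S C₁ C₂ φ.1 t) (w t) =
        inner 𝕜 (cutoffLp T (continuous_dualOutput hS hA (C₁ := C₁) (C₂ := C₂) φ.1) T)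
          (hw.toLp w) := by
      rw [inner_cutoffLp hTm, intervalIntegral.integral_of_le hT.le,
        intervalIntegral.integral_of_le hT.le, integral_Ioc_eq_integral_Ioo,
        integral_Ioc_eq_integral_Ioo]
      refine integral_congr_ae ?_
      filter_upwards [hw.coeFn_toLp] with t ht
      rw [ht]
    rw [hyT, inner_zero_right, zero_sub, h2] at h1
    rw [innerSL_apply_apply, ← norm_neg, h1]
    exact (norm_inner_le_norm _ _).trans (mul_le_of_le_one_left (norm_nonneg _) φ.2))
  have h0 : ‖cutoffLp T (continuous_dualOutput hS hA (C₁ := C₁) (C₂ := C₂)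
      (0 : A.adjoint.domain)) T‖ = 0 := by
    rw [cutoffLp_smul (𝕜 := 𝕜) T (continuous_dualOutput hS hA (C₁ := C₁) (C₂ := C₂)
      (0 : A.adjoint.domain)) (0 : 𝕜) T (continuous_dualOutput hS hA _)
      (fun t => by rw [← dualOutput_smul, smul_zero]), zero_smul, norm_zero]
  have hC0 : 0 ≤ C := (norm_nonneg _).trans (hCb ⟨0, by rw [h0]; exact zero_le_one⟩)
  refine ⟨C, hC0, fun φ => ?_⟩
  set n := ‖cutoffLp T (continuous_dualOutput hS hA (C₁ := C₁) (C₂ := C₂) φ) T‖ with hn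
  -- `n` is not known to be nonzero, so `φ` is normalized by any `r > n` and `r` then tends to `n`.
  have key : ∀ r > n, ‖(φ : H)‖ ≤ C * r := by
    intro r hr
    have hr0 : 0 < r := (norm_nonneg _).trans_lt hr
    have hr' : ‖((r⁻¹ : ℝ) : 𝕜)‖ = r⁻¹ := by
      rw [RCLike.norm_ofReal, abs_of_pos (by positivity)]
    have h1 := hCb ⟨((r⁻¹ : ℝ) : 𝕜) • φ, by
      rw [cutoffLp_smul (𝕜 := 𝕜) T (continuous_dualOutput hS hA (C₁ := C₁) (C₂ := C₂) φ)
        ((r⁻¹ : ℝ) : 𝕜) T (continuous_dualOutput hS hA _) (fun t => dualOutput_smul _ _ _),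
        norm_smul, ← hn, hr', inv_mul_le_iff₀ hr0, mul_one]
      exact hr.le⟩
    rw [innerSL_apply_norm, Submodule.coe_smul, norm_smul, hr', inv_mul_le_iff₀ hr0] at h1
    linarith
  have hcl : Tendsto (fun r : ℝ => C * r) (𝓝[>] n) (𝓝 (C * n)) :=
    ((continuous_const.mul continuous_id).tendsto n).mono_left nhdsWithin_le_nhds
  exact ge_of_tendsto hcl (by filter_upwards [self_mem_nhdsWithin] with r hr using key r hr)

end Observation

/-! ### Weighted Gramians and the Lyapunov equation. -/

section Gramian

variable {𝕜 : Type*} [RCLike 𝕜] {H : Type*} [NormedAddCommGroup H] [InnerProductSpace 𝕜 H]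
  [CompleteSpace H] {U : Type*} [NormedAddCommGroup U] [InnerProductSpace 𝕜 U] [CompleteSpace U]
  [NormedSpace ℝ H] [IsScalarTower ℝ 𝕜 H]
  {S : ℝ → H →L[𝕜] H} {A : H →ₗ.[𝕜] H} {C₁ C₂ : H →L[𝕜] U} {B : ControlOperator A U}

/-- Moving the initial vector along the dual group shifts the output in time; the Gramian evaluated
along a dual orbit thereby becomes an integral over a sliding window. -/
theorem dualOutput_adjointFlow (hS : IsC0Group S) (hA : IsGenerator S A) (φ : A.adjoint.domain)
    (s t : ℝ) : dualOutput S C₁ C₂ (adjointFlow hS hA (-t) φ) s = dualOutput S C₁ C₂ φ (s + t) := by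
  simp only [dualOutput, hS.adjoint_adjointFlow hA, hS.dualGroup_add]
  rfl

/-- The Gramian over `[0, T]` with weight `e^{-σ t}`. -/
theorem exists_gramian_form (hS : IsC0Group S) (hA : IsGenerator S A)
    (hC : ∀ (w : U) (φ : A.adjoint.domain),
      B.toLinearMap w φ = inner 𝕜 (C₁ (φ : H) + C₂ (A.adjoint φ)) w)
    (hB : IsAdmissible hS hA B) {T : ℝ} (hT : 0 < T) (hc : IsExactlyControllable A B T)
    {σ : ℝ} (hσ : 0 ≤ σ) :
    ∃ Q : H →L[𝕜] H, (∃ c > 0, ∀ x, c * ‖x‖ ^ 2 ≤ RCLike.re (inner 𝕜 x (Q x))) ∧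
      ∀ φ ψ : A.adjoint.domain, inner 𝕜 (φ : H) (Q ψ) = ∫ t in (0 : ℝ)..T,
        Real.exp (-σ * t) • inner 𝕜 (dualOutput S C₁ C₂ φ t) (dualOutput S C₁ C₂ ψ t) := by
  have hTm : T ∈ Icc 0 T := ⟨hT.le, le_rfl⟩
  -- The square root of the weight, so that the Gramian has the form `Ψ*Ψ`.
  let e : ℝ → 𝕜 := fun t => ((Real.exp (-σ * t / 2) : ℝ) : 𝕜)
  have he : ∀ t, ‖e t‖ = Real.exp (-σ * t / 2) := fun t => by
    simp only [e, RCLike.norm_ofReal, Real.abs_exp]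
  have hec : Continuous e := RCLike.continuous_ofReal.comp (by fun_prop)
  let β : A.adjoint.domain → ℝ → U := fun φ t => e t • dualOutput S C₁ C₂ φ t
  have hβ : ∀ φ, Continuous (β φ) := fun φ => hec.smul (continuous_dualOutput hS hA φ)
  let Ψ₀ : A.adjoint.domain →ₗ[𝕜] Lp U 2 (volume.restrict (Ioo (0 : ℝ) T)) :=
    { toFun := fun φ => cutoffLp T (hβ φ) T
      map_add' := fun φ ψ => cutoffLp_add T (hβ φ) (hβ ψ) T _ fun t => by
        simp only [β, dualOutput_add, smul_add]
      map_smul' := fun a φ => cutoffLp_smul T (hβ φ) a T _ fun t => by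
        simp only [β, dualOutput_smul, smul_comm a] }
  obtain ⟨K, hK0, hK⟩ := exists_norm_output_le hS hA hC hB hT
  obtain ⟨c, hc0, hc⟩ := exists_norm_le_output hS hA hC hT hc
  have hup : ∀ φ, ‖Ψ₀ φ‖ ≤ K * ‖(φ : H)‖ := by
    intro φ
    refine le_trans (Lp.norm_le_norm_of_ae_le ?_) (hK φ)
    filter_upwards [cutoffLp_self_ae (T := T) (hβ φ), cutoffLp_self_ae (T := T)
      (continuous_dualOutput hS hA (C₁ := C₁) (C₂ := C₂) φ),
      ae_restrict_mem measurableSet_Ioo] with t h1 h2 ht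
    rw [h2]
    change ‖cutoffLp T (hβ φ) T t‖ ≤ _
    rw [h1, norm_smul, he]
    refine mul_le_of_le_one_left (norm_nonneg _) (Real.exp_le_one_iff.2 ?_)
    nlinarith [ht.1]
  -- Observability survives the weight, which is at least `e^{-σT/2}` on `[0, T]`.
  have hlow : ∀ φ : A.adjoint.domain, ‖(φ : H)‖ ≤ c * Real.exp (σ * T / 2) * ‖Ψ₀ φ‖ := by
    intro φ
    rw [mul_assoc]
    refine (hc φ).trans (mul_le_mul_of_nonneg_left ?_ hc0)
    refine Lp.norm_le_mul_norm_of_ae_le_mul ?_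
    filter_upwards [cutoffLp_self_ae (T := T) (hβ φ), cutoffLp_self_ae (T := T)
      (continuous_dualOutput hS hA (C₁ := C₁) (C₂ := C₂) φ),
      ae_restrict_mem measurableSet_Ioo] with t h1 h2 ht
    rw [h2]
    change _ ≤ _ * ‖cutoffLp T (hβ φ) T t‖
    rw [h1, norm_smul, he, ← mul_assoc, ← Real.exp_add]
    refine le_mul_of_one_le_left (norm_nonneg _) (Real.one_le_exp ?_)
    nlinarith [ht.2]
  have hdense : DenseRange (A.adjoint.domain.subtype) := by
    simpa [DenseRange] using hS.dense_adjoint_domain hA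
  let Ψ : H →L[𝕜] Lp U 2 (volume.restrict (Ioo (0 : ℝ) T)) :=
    Ψ₀.extendOfNorm A.adjoint.domain.subtype
  have hΨ : ∀ φ : A.adjoint.domain, Ψ (φ : H) = Ψ₀ φ :=
    LinearMap.extendOfNorm_eq hdense ⟨K, hup⟩
  have hlow' : ∀ x : H, ‖x‖ ≤ c * Real.exp (σ * T / 2) * ‖Ψ x‖ := by
    intro x
    refine (hS.dense_adjoint_domain hA).induction
      (P := fun x => ‖x‖ ≤ c * Real.exp (σ * T / 2) * ‖Ψ x‖) (fun x hx => ?_) ?_ x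
    · have := hlow ⟨x, hx⟩
      rwa [← hΨ] at this
    · exact isClosed_le (by fun_prop) (by fun_prop)
  have hQ : ∀ x y, inner 𝕜 x ((Ψ.adjoint.comp Ψ) y) = inner 𝕜 (Ψ x) (Ψ y) := fun x y => by
    rw [ContinuousLinearMap.comp_apply, ContinuousLinearMap.adjoint_inner_right]
  -- The `+ 1` keeps the coercivity constant meaningful when the observability constant is `0`.
  refine ⟨Ψ.adjoint.comp Ψ, ⟨((c * Real.exp (σ * T / 2)) ^ 2 + 1)⁻¹, by positivity, fun x => ?_⟩,
    fun φ ψ => ?_⟩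
  · rw [hQ, inner_self_eq_norm_sq, inv_mul_le_iff₀ (by positivity)]
    have h1 := pow_le_pow_left₀ (norm_nonneg x) (hlow' x) 2
    rw [mul_pow] at h1
    nlinarith [sq_nonneg ‖Ψ x‖]
  · rw [hQ, hΨ, hΨ]
    change inner 𝕜 (cutoffLp T (hβ φ) T) (cutoffLp T (hβ ψ) T) = _
    rw [inner_cutoffLp hTm, integral_inner_cutoffLp hTm hTm, min_self]
    refine intervalIntegral.integral_congr fun t _ => ?_
    simp only [β, e, inner_smul_left, inner_smul_right, RCLike.conj_ofReal]
    rw [RCLike.real_smul_eq_coe_mul, ← mul_assoc, ← RCLike.ofReal_mul, ← Real.exp_add]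
    congr 3
    ring

/-- The Lyapunov identity with a boundary term for the Gramian over `[0, T]`. -/
theorem exists_gramian (hS : IsC0Group S) (hA : IsGenerator S A)
    (hC : ∀ (w : U) (φ : A.adjoint.domain),
      B.toLinearMap w φ = inner 𝕜 (C₁ (φ : H) + C₂ (A.adjoint φ)) w)
    (hB : IsAdmissible hS hA B) {T : ℝ} (hT : 0 < T) (hc : IsExactlyControllable A B T)
    {σ : ℝ} (hσ : 0 ≤ σ) :
    ∃ Q : H →L[𝕜] H, (∃ c > 0, ∀ x, c * ‖x‖ ^ 2 ≤ RCLike.re (inner 𝕜 x (Q x))) ∧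
      ∀ φ ψ : A.adjoint.domain, inner 𝕜 (A.adjoint φ) (Q ψ) + inner 𝕜 (φ : H) (Q (A.adjoint ψ)) +
        (σ : 𝕜) * inner 𝕜 (φ : H) (Q ψ) =
        inner 𝕜 (dualOutput S C₁ C₂ φ 0) (dualOutput S C₁ C₂ ψ 0) -
        (Real.exp (-σ * T) : 𝕜) *
          inner 𝕜 (dualOutput S C₁ C₂ φ T) (dualOutput S C₁ C₂ ψ T) := by
  obtain ⟨Q, hQc, hQ⟩ := exists_gramian_form hS hA hC hB hT hc hσ
  refine ⟨Q, hQc, fun φ ψ => ?_⟩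
  let a : ℝ → 𝕜 := fun t =>
    Real.exp (-σ * t) • inner 𝕜 (dualOutput S C₁ C₂ φ t) (dualOutput S C₁ C₂ ψ t)
  have ha : Continuous a := (by fun_prop : Continuous fun t : ℝ => Real.exp (-σ * t)).smul
    ((continuous_dualOutput hS hA φ).inner (continuous_dualOutput hS hA ψ))
  -- Both sides will be differentiated at `t = 0`: the left gives the Lyapunov terms up to sign, the
  -- right the boundary values of the integrand at `T` and `0`.
  have hF : ∀ t, Real.exp (-σ * t) • inner 𝕜 (dualGroup S t (φ : H)) (Q (dualGroup S t (ψ : H))) =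
      (∫ s in (0 : ℝ)..(T + t), a s) - ∫ s in (0 : ℝ)..t, a s := by
    intro t
    have h1 := hQ (adjointFlow hS hA (-t) φ) (adjointFlow hS hA (-t) ψ)
    have h2 : inner 𝕜 (dualGroup S t (φ : H)) (Q (dualGroup S t (ψ : H))) =
      inner 𝕜 ((adjointFlow hS hA (-t) φ : A.adjoint.domain) : H)
        (Q (adjointFlow hS hA (-t) ψ : A.adjoint.domain)) := rfl
    rw [intervalIntegral.integral_interval_sub_left (ha.intervalIntegrable _ _)
      (ha.intervalIntegrable _ _), h2, h1, ← intervalIntegral.integral_smul]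
    have h3 := intervalIntegral.integral_comp_add_right (a := 0) (b := T) a t
    rw [zero_add] at h3
    rw [← h3]
    refine intervalIntegral.integral_congr fun s _ => ?_
    simp only [a, dualOutput_adjointFlow]
    rw [smul_smul, ← Real.exp_add]
    congr 2
    ring
  have hd1 : HasDerivAt (fun t : ℝ => Real.exp (-σ * t)) (-σ) 0 := by
    have := ((hasDerivAt_id (0 : ℝ)).const_mul (-σ)).exp
    simpa using this
  have hd2 := (hS.hasDerivAt_dualGroup hA φ 0).inner 𝕜
    (((Q.restrictScalars ℝ).hasFDerivAt).comp_hasDerivAt 0 (hS.hasDerivAt_dualGroup hA ψ 0))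
  have hd3 := hd1.smul hd2
  have hd4 : HasDerivAt (fun t : ℝ => ∫ s in (0 : ℝ)..(T + t), a s) (a T) 0 := by
    have h1 := (ha.integral_hasStrictDerivAt 0 (T + 0)).hasDerivAt
    have h2 := h1.scomp 0 ((hasDerivAt_id (0 : ℝ)).const_add T)
    simp only [add_zero, one_smul] at h2
    exact h2
  have hd5 := hd4.sub (ha.integral_hasStrictDerivAt 0 0).hasDerivAt
  have hd6 := hd3.unique (hd5.congr_of_eventuallyEq (Eventually.of_forall fun t => hF t))
  simp only [hS.dualGroup_zero, ContinuousLinearMap.id_apply, Function.comp,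
    ContinuousLinearMap.coe_restrictScalars', map_neg, inner_neg_left, inner_neg_right, mul_zero,
    Real.exp_zero, one_smul, a] at hd6
  simp only [RCLike.real_smul_eq_coe_mul, RCLike.ofReal_neg] at hd6
  linear_combination -hd6

/-- The Gramian over `[0, ∞)` with weight `e^{-σ t}`: a coercive solution of a Lyapunov
equation. -/
theorem exists_lyapunov (hS : IsC0Group S) (hA : IsGenerator S A)
    (hC : ∀ (w : U) (φ : A.adjoint.domain),
      B.toLinearMap w φ = inner 𝕜 (C₁ (φ : H) + C₂ (A.adjoint φ)) w)
    (hB : IsAdmissible hS hA B) {T : ℝ} (hT : 0 < T) (hc : IsExactlyControllable A B T)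
    {σ : ℝ} (hσ : 0 ≤ σ) (hσT : Real.exp (-σ * T) * ‖S (-T)‖ ^ 2 < 1) :
    ∃ Λ : H →L[𝕜] H, (∃ c > 0, ∀ x, c * ‖x‖ ^ 2 ≤ RCLike.re (inner 𝕜 x (Λ x))) ∧
      ∀ φ ψ : A.adjoint.domain, inner 𝕜 (A.adjoint φ) (Λ ψ) + inner 𝕜 (φ : H) (Λ (A.adjoint ψ)) +
        (σ : 𝕜) * inner 𝕜 (φ : H) (Λ ψ) =
        inner 𝕜 (C₁ (φ : H) + C₂ (A.adjoint φ)) (C₁ (ψ : H) + C₂ (A.adjoint ψ)) := by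
  obtain ⟨Q, ⟨c, hc0, hQc⟩, hQ⟩ := exists_gramian hS hA hC hB hT hc hσ
  set V := dualGroup S T with hV
  set κ := Real.exp (-σ * T) with hκ
  have hκ0 : 0 < κ := Real.exp_pos _
  set q := κ * ‖S (-T)‖ ^ 2 with hq
  have hq0 : 0 ≤ q := by positivity
  have hVn : ‖V‖ = ‖S (-T)‖ := IsC0Group.norm_dualGroup T
  -- Splitting `[0, ∞)` at `T` shows that the infinite-horizon Gramian must satisfy `Λ = Q + κ S(-T)
  -- Λ S(-T)*`. It is defined as the fixed point of this map, a contraction with ratio `q`.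
  obtain ⟨Λ, hΛ⟩ : ∃ Λ : H →L[𝕜] H, Q + (κ : 𝕜) • (S (-T)).comp (Λ.comp V) = Λ := by
    have hcon : ContractingWith ⟨q, hq0⟩
        (fun X : H →L[𝕜] H => Q + (κ : 𝕜) • (S (-T)).comp (X.comp V)) := by
      refine ⟨hσT, LipschitzWith.of_dist_le_mul fun X Y => ?_⟩
      rw [dist_add_left, dist_eq_norm, dist_eq_norm, ← smul_sub, ← ContinuousLinearMap.comp_sub,
        ← ContinuousLinearMap.sub_comp, norm_smul, RCLike.norm_ofReal, abs_of_pos hκ0]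
      calc κ * ‖(S (-T)).comp ((X - Y).comp V)‖ ≤ κ * (‖S (-T)‖ * (‖X - Y‖ * ‖V‖)) := by
            gcongr
            exact (ContinuousLinearMap.opNorm_comp_le _ _).trans
              (mul_le_mul_of_nonneg_left (ContinuousLinearMap.opNorm_comp_le _ _) (norm_nonneg _))
        _ = q * ‖X - Y‖ := by rw [hVn, hq]; ring
    exact ⟨hcon.fixedPoint, hcon.fixedPoint_isFixedPt⟩
  have hfix : ∀ x y, inner 𝕜 x (Λ y) = inner 𝕜 x (Q y) + (κ : 𝕜) * inner 𝕜 (V x) (Λ (V y)) := by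
    intro x y
    conv_lhs => rw [← hΛ]
    rw [add_apply, inner_add_right, smul_apply, inner_smul_right]
    congr 2
    exact (IsC0Group.dualGroup_inner_left _ _ _).symm
  have hlim : ∀ K : ℝ, Tendsto (fun n : ℕ => q ^ n * K) atTop (𝓝 0) := fun K => by
    simpa using (tendsto_pow_atTop_nhds_zero_of_lt_one hq0 hσT).mul_const K
  refine ⟨Λ, ⟨c, hc0, fun x => ?_⟩, fun φ ψ => ?_⟩
  · have hre : ∀ x, RCLike.re (inner 𝕜 x (Λ x)) =
        RCLike.re (inner 𝕜 x (Q x)) + κ * RCLike.re (inner 𝕜 (V x) (Λ (V x))) := fun x => by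
      rw [hfix, map_add, RCLike.re_ofReal_mul]
    -- Iterating the fixed-point relation and dropping the nonnegative contributions of `Q` leaves a
    -- remainder of order `q ^ n`, so `Λ` is nonnegative. One more use of the relation gives `Λ ≥
    -- Q`, hence coercivity.
    have hind : ∀ (n : ℕ) (x : H), 0 ≤ RCLike.re (inner 𝕜 x (Λ x)) + q ^ n * (‖Λ‖ * ‖x‖ ^ 2) := by
      intro n
      induction n with
      | zero =>
        intro x
        have h1 := (RCLike.abs_re_le_norm (inner 𝕜 x (Λ x))).trans (norm_inner_le_norm _ _)
        have h2 := mul_le_mul_of_nonneg_left (Λ.le_opNorm x) (norm_nonneg x)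
        have h3 := neg_abs_le (RCLike.re (inner 𝕜 x (Λ x)))
        rw [pow_zero]
        nlinarith
      | succ n ih =>
        intro x
        have h1 := mul_nonneg hκ0.le (ih (V x))
        have h2 := hQc x
        have h3 : ‖V x‖ ^ 2 ≤ (‖S (-T)‖ * ‖x‖) ^ 2 := by
          rw [← hVn]
          exact pow_le_pow_left₀ (norm_nonneg _) (V.le_opNorm x) 2
        have h4 : κ * (q ^ n * (‖Λ‖ * ‖V x‖ ^ 2)) ≤ q ^ (n + 1) * (‖Λ‖ * ‖x‖ ^ 2) := by
          calc κ * (q ^ n * (‖Λ‖ * ‖V x‖ ^ 2)) ≤ κ * (q ^ n * (‖Λ‖ * (‖S (-T)‖ * ‖x‖) ^ 2)) := by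
                gcongr
            _ = _ := by rw [pow_succ, hq]; ring
        have h5 : 0 ≤ c * ‖x‖ ^ 2 := by positivity
        rw [hre]
        nlinarith
    have hpos : ∀ x, 0 ≤ RCLike.re (inner 𝕜 x (Λ x)) := fun x => by
      have h1 := (hlim (‖Λ‖ * ‖x‖ ^ 2)).const_add (RCLike.re (inner 𝕜 x (Λ x)))
      rw [add_zero] at h1
      exact ge_of_tendsto' h1 fun n => hind n x
    rw [hre]
    have := mul_nonneg hκ0.le (hpos (V x))
    linarith [hQc x]
  -- `δ` is the defect in the Lyapunov equation. The boundary term of `Q` at time `T` is exactly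
  -- what gives `δ(φ, ψ) = κ δ(Jφ, Jψ)`. Since `J` commutes with `A*` and has norm at most
  -- `‖S(-T)‖`, iteration bounds `δ` by `q ^ n` times graph norms.
  · let δ : A.adjoint.domain → A.adjoint.domain → 𝕜 := fun φ ψ =>
      inner 𝕜 (A.adjoint φ) (Λ ψ) + inner 𝕜 (φ : H) (Λ (A.adjoint ψ)) +
        (σ : 𝕜) * inner 𝕜 (φ : H) (Λ ψ) -
        inner 𝕜 (C₁ (φ : H) + C₂ (A.adjoint φ)) (C₁ (ψ : H) + C₂ (A.adjoint ψ))
    let J : A.adjoint.domain → A.adjoint.domain := adjointFlow hS hA (-T)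
    have hJ : ∀ φ, ((J φ : A.adjoint.domain) : H) = V φ := fun φ => rfl
    have hJA : ∀ φ, A.adjoint (J φ) = V (A.adjoint φ) := fun φ => hS.adjoint_adjointFlow hA _ φ
    have hδ : ∀ φ ψ, δ φ ψ = (κ : 𝕜) * δ (J φ) (J ψ) := by
      intro φ ψ
      have h1 := hQ φ ψ
      simp only [dualOutput, hS.dualGroup_zero, ContinuousLinearMap.id_apply, ← hV] at h1
      simp only [δ, hJ, hJA]
      rw [hfix (A.adjoint φ), hfix (φ : H) (A.adjoint ψ), hfix (φ : H) (ψ : H)]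
      linear_combination h1
    let g : A.adjoint.domain → ℝ := fun φ => ‖(φ : H)‖ + ‖A.adjoint φ‖
    have hg0 : ∀ φ, 0 ≤ g φ := fun φ => by positivity
    have hgJ : ∀ φ, g (J φ) ≤ ‖S (-T)‖ * g φ := fun φ => by
      simp only [g, hJ, hJA, mul_add]
      rw [← hVn]
      exact add_le_add (V.le_opNorm _) (V.le_opNorm _)
    let K : ℝ := ‖Λ‖ + ‖Λ‖ + |σ| * ‖Λ‖ + (‖C₁‖ + ‖C₂‖) * (‖C₁‖ + ‖C₂‖)
    have hK0 : 0 ≤ K := by positivity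
    have hbd : ∀ φ ψ, ‖δ φ ψ‖ ≤ K * (g φ * g ψ) := by
      intro φ ψ
      have g1 : ∀ φ : A.adjoint.domain, ‖(φ : H)‖ ≤ g φ := fun φ =>
        le_add_of_nonneg_right (norm_nonneg _)
      have g2 : ∀ φ : A.adjoint.domain, ‖A.adjoint φ‖ ≤ g φ := fun φ =>
        le_add_of_nonneg_left (norm_nonneg _)
      have g3 : ∀ φ : A.adjoint.domain, ‖C₁ (φ : H) + C₂ (A.adjoint φ)‖ ≤ (‖C₁‖ + ‖C₂‖) * g φ :=
        fun φ => by
          rw [add_mul]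
          exact (norm_add_le _ _).trans (add_le_add (C₁.le_opNorm_of_le (g1 φ))
            (C₂.le_opNorm_of_le (g2 φ)))
      have b1 : ∀ {x y : H}, ‖x‖ ≤ g φ → ‖y‖ ≤ g ψ → ‖inner 𝕜 x (Λ y)‖ ≤ ‖Λ‖ * (g φ * g ψ) := by
        intro x y hx hy
        calc _ ≤ ‖x‖ * ‖Λ y‖ := norm_inner_le_norm _ _
          _ ≤ g φ * (‖Λ‖ * g ψ) := mul_le_mul hx (Λ.le_opNorm_of_le hy) (norm_nonneg _) (hg0 φ)
          _ = _ := by ring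
      have b2 : ‖(σ : 𝕜) * inner 𝕜 (φ : H) (Λ ψ)‖ ≤ |σ| * (‖Λ‖ * (g φ * g ψ)) := by
        rw [norm_mul, RCLike.norm_ofReal]
        exact mul_le_mul_of_nonneg_left (b1 (g1 φ) (g1 ψ)) (abs_nonneg _)
      have b3 := (norm_inner_le_norm (𝕜 := 𝕜) (C₁ (φ : H) + C₂ (A.adjoint φ))
        (C₁ (ψ : H) + C₂ (A.adjoint ψ))).trans
        (mul_le_mul (g3 φ) (g3 ψ) (norm_nonneg _) (by positivity))
      calc ‖δ φ ψ‖ ≤ _ := norm_sub_le _ _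
        _ ≤ _ := add_le_add norm_add₃_le le_rfl
        _ ≤ _ := add_le_add (add_le_add (add_le_add (b1 (g2 φ) (g1 ψ)) (b1 (g1 φ) (g2 ψ))) b2) b3
        _ = _ := by simp only [K]; ring
    have hind : ∀ (n : ℕ) (φ ψ), ‖δ φ ψ‖ ≤ q ^ n * (K * (g φ * g ψ)) := by
      intro n
      induction n with
      | zero => intro φ ψ; rw [pow_zero, one_mul]; exact hbd φ ψ
      | succ n ih =>
        intro φ ψ
        rw [hδ, norm_mul, RCLike.norm_ofReal, abs_of_pos hκ0]
        calc _ ≤ κ * (q ^ n * (K * (g (J φ) * g (J ψ)))) := by gcongr; exact ih _ _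
          _ ≤ κ * (q ^ n * (K * ((‖S (-T)‖ * g φ) * (‖S (-T)‖ * g ψ)))) := by
              have := hg0 (J ψ)
              have := hg0 φ
              gcongr
              · exact hgJ φ
              · exact hgJ ψ
          _ = _ := by rw [pow_succ, hq]; ring
    have hzero : δ φ ψ = 0 := by
      refine norm_le_zero_iff.1 (ge_of_tendsto' (hlim (K * (g φ * g ψ))) fun n => hind n φ ψ)
    exact sub_eq_zero.1 hzero

end Gramian

/-! ### The auxiliary dynamics and the closed-loop equations integrated in time. -/

section Feedback

variable {𝕜 : Type*} [RCLike 𝕜] {H : Type u} [NormedAddCommGroup H] [InnerProductSpace 𝕜 H]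
  [CompleteSpace H]

/-- The damped dual group `t ↦ e^{-c t} S(-t)*`. -/
noncomputable def dampedDual (S : ℝ → H →L[𝕜] H) (c : ℝ) (t : ℝ) : H →L[𝕜] H :=
  ((Real.exp (-c * t) : ℝ) : 𝕜) • dualGroup S t

/-- The operator `-A* - c` on `D(A*)`. -/
noncomputable def dampedAdjoint (A : H →ₗ.[𝕜] H) (c : ℝ) : H →ₗ.[𝕜] H where
  domain := A.adjoint.domain
  toFun := -A.adjoint.toFun - (c : 𝕜) • A.adjoint.domain.subtype

theorem dampedAdjoint_apply (A : H →ₗ.[𝕜] H) (c : ℝ) (x : A.adjoint.domain) :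
    dampedAdjoint A c x = -A.adjoint x - (c : 𝕜) • (x : H) := rfl

theorem mem_dampedAdjoint_graph_iff {A : H →ₗ.[𝕜] H} {c : ℝ} {x y : H} :
    (x, y) ∈ (dampedAdjoint A c).graph ↔
      ∃ x' : A.adjoint.domain, (x' : H) = x ∧ -A.adjoint x' - (c : 𝕜) • x = y := by
  rw [LinearPMap.mem_graph_iff]
  constructor
  · rintro ⟨x', h1, h2⟩
    obtain rfl : ((x' : A.adjoint.domain) : H) = x := h1
    exact ⟨x', rfl, h2⟩
  · rintro ⟨x', rfl, h2⟩
    exact ⟨x', rfl, h2⟩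

variable [NormedSpace ℝ H] [IsScalarTower ℝ 𝕜 H] {S : ℝ → H →L[𝕜] H} {A : H →ₗ.[𝕜] H}

namespace IsC0Group

theorem isC0Group_dampedDual (hS : IsC0Group S) (hA : IsGenerator S A) (c : ℝ) :
    IsC0Group (dampedDual S c) := by
  refine ⟨?_, fun s t => ?_, fun x => ?_⟩
  · simp [dampedDual, hS.dualGroup_zero]
  · rw [dampedDual, dampedDual, dampedDual, hS.dualGroup_add, ContinuousLinearMap.smul_comp,
      ContinuousLinearMap.comp_smul, smul_smul, ← RCLike.ofReal_mul, ← Real.exp_add, mul_add]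
  · have h1 : Tendsto (fun t : ℝ => ((Real.exp (-c * t) : ℝ) : 𝕜)) (𝓝 0) (𝓝 1) := by
      have : Continuous fun t : ℝ => ((Real.exp (-c * t) : ℝ) : 𝕜) :=
        RCLike.continuous_ofReal.comp (by fun_prop)
      simpa using this.tendsto 0
    have h2 := h1.smul ((hS.isC0Group_dualGroup hA).tendsto x)
    rwa [one_smul] at h2

theorem hasDerivAt_exp_smul {c t : ℝ} {f : ℝ → H} {f' : H} (hf : HasDerivAt f f' t) :
    HasDerivAt (fun s => ((Real.exp (-c * s) : ℝ) : 𝕜) • f s)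
      (((Real.exp (-c * t) : ℝ) : 𝕜) • (f' - (c : 𝕜) • f t)) t := by
  have h1 : HasDerivAt (fun s : ℝ => Real.exp (-c * s)) (Real.exp (-c * t) * -c) t := by
    have := ((hasDerivAt_id t).const_mul (-c)).exp
    simpa using this
  have h2 := h1.smul hf
  have e1 : ∀ (r : ℝ) (x : H), (r : 𝕜) • x = r • x := fun r x =>
    (RCLike.real_smul_eq_coe_smul (K := 𝕜) r x).symm
  simp only [e1]
  convert! h2 using 1
  rw [smul_sub, smul_smul, mul_neg, neg_smul]
  abel

theorem hasDerivAt_dampedDual (hS : IsC0Group S) (hA : IsGenerator S A) (c : ℝ)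
    (φ : A.adjoint.domain) (t : ℝ) :
    HasDerivAt (fun s => dampedDual S c s (φ : H))
      (dampedDual S c t (-A.adjoint φ - (c : 𝕜) • (φ : H))) t := by
  have := hasDerivAt_exp_smul (𝕜 := 𝕜) (c := c) (hS.hasDerivAt_dualGroup hA φ t)
  convert! this using 1
  simp only [dampedDual, smul_apply, map_sub, map_neg, map_smul, smul_sub, smul_neg]
  rw [smul_comm (c : 𝕜)]

theorem inner_dampedDual (c t : ℝ) (x y : H) : inner 𝕜 x (dampedDual S c t y) =
    inner 𝕜 (((Real.exp (-c * t) : ℝ) : 𝕜) • S (-t) x) y := by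
  rw [dampedDual, smul_apply, inner_smul_right, inner_smul_left, RCLike.conj_ofReal, dualGroup,
    ContinuousLinearMap.adjoint_inner_right]

theorem hasDerivAt_apply_neg (hS : IsC0Group S) (hA : IsGenerator S A) (x : A.domain) (t : ℝ) :
    HasDerivAt (fun s => S (-s) (x : H)) (-S (-t) (A x)) t := by
  have := (hS.hasDerivAt_apply hA x (-t)).scomp t (hasDerivAt_neg t)
  rw [neg_one_smul] at this
  exact this

/-- For the converse inclusion, pair the convergent difference quotients with `a ∈ D(A)` and move
the group to the other side: the limit represents `a ↦ ⟪x, A a⟫`, which puts `x` in `D(A*)`. -/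
theorem isGenerator_dampedDual (hS : IsC0Group S) (hA : IsGenerator S A) (c : ℝ) :
    IsGenerator (dampedDual S c) (dampedAdjoint A c) := by
  have h0 := (hS.isC0Group_dampedDual hA c).map_zero_apply
  have hslope : ∀ {f : ℝ → H} {f' : H}, HasDerivAt f f' 0 →
      Tendsto (fun t : ℝ => ((t : 𝕜)⁻¹) • (f t - f 0)) (𝓝[>] 0) (𝓝 f') := by
    intro f f' hf
    have ht := hf.hasDerivWithinAt (s := Ioi 0)
    rw [hasDerivWithinAt_iff_tendsto_slope' (by simp)] at ht
    refine ht.congr fun t => ?_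
    rw [inv_ofReal_smul]
    simp [slope]
  intro x y
  rw [mem_dampedAdjoint_graph_iff]
  constructor
  · rintro ⟨φ, rfl, rfl⟩
    have := hslope (hS.hasDerivAt_dampedDual hA c φ 0)
    simpa only [h0] using this
  · intro h
    have key : ∀ a : A.domain, inner 𝕜 (-y - (c : 𝕜) • x) (a : H) = inner 𝕜 x (A a) := by
      intro a
      have hd := hasDerivAt_exp_smul (𝕜 := 𝕜) (c := c) (hS.hasDerivAt_apply_neg hA a 0)
      have h1 := (hslope hd).inner (𝕜 := 𝕜) (tendsto_const_nhds (x := x))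
      have h2 := (tendsto_const_nhds (x := (a : H))).inner (𝕜 := 𝕜) h
      have h3 := tendsto_nhds_unique h2 (h1.congr fun t => ?_)
      · simp only [mul_zero, Real.exp_zero, RCLike.ofReal_one, one_smul, neg_zero,
          hS.map_zero_apply, inner_sub_left, inner_neg_left, inner_smul_left,
          RCLike.conj_ofReal] at h3
        rw [inner_sub_left, inner_neg_left, inner_smul_left, RCLike.conj_ofReal]
        have h4 := congrArg (starRingEnd 𝕜) h3
        simp only [map_sub, map_neg, map_mul, inner_conj_symm, RCLike.conj_ofReal] at h4
        rw [h4]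
        ring
      · rw [inner_smul_left, inner_smul_right, inner_sub_left, inner_sub_right, inner_dampedDual]
        simp [hS.map_zero_apply]
    have hx : x ∈ A.adjoint.domain := LinearPMap.mem_adjoint_domain_of_exists _ ⟨_, key⟩
    refine ⟨⟨x, hx⟩, rfl, ?_⟩
    rw [LinearPMap.adjoint_apply_eq (hS.dense_domain hA) ⟨x, hx⟩ key]
    abel

theorem dense_dampedAdjoint_domain (hS : IsC0Group S) (hA : IsGenerator S A) (c : ℝ) :
    Dense ((dampedAdjoint A c).domain : Set H) :=
  hS.dense_adjoint_domain hA

/-- The adjoint's domain contains `D(A)`. This provides enough test vectors to read the weak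
equation for `z` as an identity in `H`. -/
theorem dense_dampedAdjoint_adjoint_domain (hS : IsC0Group S) (hA : IsGenerator S A) (c : ℝ) :
    Dense ((dampedAdjoint A c).adjoint.domain : Set H) := by
  refine (hS.dense_domain hA).mono fun a ha => ?_
  refine LinearPMap.mem_adjoint_domain_of_exists _ ⟨-A ⟨a, ha⟩ - (c : 𝕜) • a, fun x => ?_⟩
  have h1 := hS.adjoint_inner hA x ⟨a, ha⟩
  have h2 := congrArg (starRingEnd 𝕜) h1
  simp only [inner_conj_symm] at h2
  change _ = inner 𝕜 a (-A.adjoint x - (c : 𝕜) • (x : H))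
  simp only [inner_sub_left, inner_sub_right, inner_neg_left, inner_neg_right, inner_smul_left,
    inner_smul_right, RCLike.conj_ofReal]
  rw [← h2]

end IsC0Group

variable {U : Type v} [NormedAddCommGroup U] [InnerProductSpace 𝕜 U] [CompleteSpace U]

theorem le_graphNorm_left {H' : Type*} [NormedAddCommGroup H'] [InnerProductSpace 𝕜 H']
    (A : H →ₗ.[𝕜] H') (x : A.domain) : ‖(x : H)‖ ≤ graphNorm A x :=
  Real.le_sqrt_of_sq_le (by nlinarith [sq_nonneg ‖A x‖])

theorem le_graphNorm_right {H' : Type*} [NormedAddCommGroup H'] [InnerProductSpace 𝕜 H']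
    (A : H →ₗ.[𝕜] H') (x : A.domain) : ‖A x‖ ≤ graphNorm A x :=
  Real.le_sqrt_of_sq_le (by nlinarith [sq_nonneg ‖(x : H)‖])

/-- The operator `C₁ + C₂ A*` on `D(A*)`. -/
noncomputable def outputMap (A : H →ₗ.[𝕜] H) (C₁ C₂ : H →L[𝕜] U) : A.adjoint.domain →ₗ[𝕜] U :=
  C₁.toLinearMap.comp A.adjoint.domain.subtype + C₂.toLinearMap.comp A.adjoint.toFun

theorem outputMap_apply (A : H →ₗ.[𝕜] H) (C₁ C₂ : H →L[𝕜] U) (x : A.adjoint.domain) :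
    outputMap A C₁ C₂ x = C₁ (x : H) + C₂ (A.adjoint x) := rfl

theorem exists_norm_outputMap_le (A : H →ₗ.[𝕜] H) (C₁ C₂ : H →L[𝕜] U) (c : ℝ) :
    ∃ C : ℝ, ∀ x : (dampedAdjoint A c).domain,
      ‖(-outputMap A C₁ C₂) x‖ ≤ C * graphNorm (dampedAdjoint A c) x := by
  refine ⟨‖C₁‖ + ‖C₂‖ * (1 + |c|), fun (x : A.adjoint.domain) => ?_⟩
  have h1 := le_graphNorm_left (dampedAdjoint A c) x
  have h2 := le_graphNorm_right (dampedAdjoint A c) x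
  have h3 : ‖A.adjoint x‖ ≤ (1 + |c|) * graphNorm (dampedAdjoint A c) x := by
    have e : A.adjoint x = -(-A.adjoint x - (c : 𝕜) • (x : H)) - (c : 𝕜) • (x : H) := by abel
    rw [e]
    refine (norm_sub_le _ _).trans ?_
    rw [norm_neg, norm_smul, RCLike.norm_ofReal, add_mul, one_mul]
    exact add_le_add h2 (mul_le_mul_of_nonneg_left h1 (abs_nonneg c))
  change ‖-(C₁ (x : H) + C₂ (A.adjoint x))‖ ≤ _
  rw [norm_neg]
  calc _ ≤ ‖C₁‖ * graphNorm (dampedAdjoint A c) x +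
        ‖C₂‖ * ((1 + |c|) * graphNorm (dampedAdjoint A c) x) :=
        (norm_add_le _ _).trans (add_le_add (C₁.le_opNorm_of_le h1) (C₂.le_opNorm_of_le h3))
    _ = _ := by ring

/-- The dynamic feedback with auxiliary dynamics `z' = -(A* + c) z + L y` and control
`w = -(C₁ + C₂ A*) z`. -/
noncomputable def dualFeedback (hS : IsC0Group S) (hA : IsGenerator S A) (c : ℝ) (L : H →L[𝕜] H)
    (C₁ C₂ : H →L[𝕜] U) : DynamicFeedback 𝕜 H U where
  Z := H
  G := dampedDual S c
  isC0Semigroup := (hS.isC0Group_dampedDual hA c).isC0Semigroup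
  N := dampedAdjoint A c
  isGenerator := hS.isGenerator_dampedDual hA c
  L := L
  F := 0
  K := -outputMap A C₁ C₂
  K_bound := exists_norm_outputMap_le A C₁ C₂ c

/-- The closed-loop equations, integrated in time. -/
theorem dualFeedback_isSolution_iff (hS : IsC0Group S) (hA : IsGenerator S A) {c : ℝ}
    {L : H →L[𝕜] H} {C₁ C₂ : H →L[𝕜] U} {B : ControlOperator A U}
    (hC : ∀ (w : U) (φ : A.adjoint.domain),
      B.toLinearMap w φ = inner 𝕜 (C₁ (φ : H) + C₂ (A.adjoint φ)) w)
    {T : ℝ} (hT : 0 < T) {y₀ z₀ : H} {y z : ℝ → H} :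
    (dualFeedback hS hA c L C₁ C₂).IsSolution B T y₀ z₀ y z ↔
      (ContinuousOn y (Icc 0 T) ∧ ContinuousOn z (Icc 0 T) ∧ y 0 = y₀ ∧ z 0 = z₀ ∧
        ∀ t ∈ Icc 0 T, ∃ x : A.adjoint.domain, (x : H) = ∫ s in (0 : ℝ)..t, z s ∧
          z t = z₀ + dampedAdjoint A c x + L (∫ s in (0 : ℝ)..t, y s) ∧
          ∀ φ : A.adjoint.domain, inner 𝕜 (φ : H) (y t) = inner 𝕜 (φ : H) y₀ +
            inner 𝕜 (A.adjoint φ) (∫ s in (0 : ℝ)..t, y s) -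
            inner 𝕜 (outputMap A C₁ C₂ φ) (outputMap A C₁ C₂ x)) ∧
      ∃ w : ℝ → U, IsL2 T w ∧ ∀ t ∈ Icc 0 T, ∀ x : A.adjoint.domain,
        (x : H) = ∫ s in (0 : ℝ)..t, z s → ∀ ξ : U,
          inner 𝕜 ξ (-outputMap A C₁ C₂ x) = ∫ s in (0 : ℝ)..t, inner 𝕜 ξ (w s) := by
  have hdef : (dualFeedback hS hA c L C₁ C₂).IsSolution B T y₀ z₀ y z ↔
      ∃ w : ℝ → U, (IsL2 T w ∧ ∀ t ∈ Icc 0 T, ∃ x : A.adjoint.domain,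
        (∀ ζ : H, inner 𝕜 ζ (x : H) = ∫ s in (0 : ℝ)..t, inner 𝕜 ζ (z s)) ∧
        ∀ ξ : U, inner 𝕜 ξ (-outputMap A C₁ C₂ x) = ∫ s in (0 : ℝ)..t, inner 𝕜 ξ (w s)) ∧
      IsWeakSolution A (fun t φ => B.toLinearMap ((0 : H →L[𝕜] U) (y t) + w t) φ) T y₀ y ∧
      IsWeakSolution (dampedAdjoint A c) (fun t φ => inner 𝕜 (φ : H) (L (y t))) T z₀ z := Iff.rfl
  rw [hdef]
  simp only [zero_apply, zero_add, hC]
  have hsub : ∀ {t}, t ∈ Icc 0 T → uIcc 0 t ⊆ Icc 0 T := fun ht => by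
    rw [uIcc_of_le ht.1]; exact Icc_subset_Icc le_rfl ht.2
  have ic : ∀ {g : ℝ → H} {t}, ContinuousOn g (Icc 0 T) → t ∈ Icc 0 T →
      IntervalIntegrable g volume 0 t := fun hg ht => (hg.mono (hsub ht)).intervalIntegrable
  have hy_iff : ∀ {w : ℝ → U}, IsL2 T w → (IsWeakSolution A
      (fun t φ => inner 𝕜 (C₁ (φ : H) + C₂ (A.adjoint φ)) (w t)) T y₀ y ↔
      ContinuousOn y (Icc 0 T) ∧ y 0 = y₀ ∧
      ∀ (φ : A.adjoint.domain), ∀ t ∈ Icc 0 T, inner 𝕜 (φ : H) (y t) = inner 𝕜 (φ : H) y₀ +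
        (inner 𝕜 (A.adjoint φ) (∫ s in (0 : ℝ)..t, y s) +
          ∫ s in (0 : ℝ)..t, inner 𝕜 (outputMap A C₁ C₂ φ) (w s))) := by
    intro w hw
    have iw := hw.intervalIntegrable hT.le
    rw [isWeakSolution_iff hT (fun φ => intervalIntegrable_inner continuous_const iw)]
    refine and_congr_right fun hyc => and_congr_right fun _ => forall_congr' fun φ =>
      forall₂_congr fun t ht => ?_
    rw [intervalIntegral.integral_add, intervalIntegral_inner (ic hyc ht)]
    · rfl
    · exact intervalIntegrable_inner continuous_const (ic hyc ht)
    · exact intervalIntegrable_inner continuous_const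
        (iw.mono_set ((hsub ht).trans (by rw [uIcc_of_le hT.le])))
  have hz_iff : ContinuousOn y (Icc 0 T) → (IsWeakSolution (dampedAdjoint A c)
      (fun t φ => inner 𝕜 (φ : H) (L (y t))) T z₀ z ↔
      ContinuousOn z (Icc 0 T) ∧ z 0 = z₀ ∧
      ∀ (φ : (dampedAdjoint A c).adjoint.domain), ∀ t ∈ Icc 0 T,
        inner 𝕜 (φ : H) (z t) = inner 𝕜 (φ : H) z₀ +
          (inner 𝕜 ((dampedAdjoint A c).adjoint φ) (∫ s in (0 : ℝ)..t, z s) +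
            inner 𝕜 (φ : H) (L (∫ s in (0 : ℝ)..t, y s)))) := by
    intro hyc
    have hLy : ContinuousOn (fun t => L (y t)) (Icc 0 T) := L.continuous.comp_continuousOn hyc
    have hTm : T ∈ Icc 0 T := ⟨hT.le, le_rfl⟩
    rw [isWeakSolution_iff hT (fun φ => intervalIntegrable_inner continuous_const (ic hLy hTm))]
    refine and_congr_right fun hzc => and_congr_right fun _ => forall_congr' fun φ =>
      forall₂_congr fun t ht => ?_
    rw [intervalIntegral.integral_add, intervalIntegral_inner (ic hzc ht),
      intervalIntegral_inner (ic hLy ht), L.intervalIntegral_comp_comm (ic hyc ht)]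
    · exact intervalIntegrable_inner continuous_const (ic hzc ht)
    · exact intervalIntegrable_inner continuous_const (ic hLy ht)
  -- Once `∫₀ᵗ z` is known to lie in `D(A*)`, this moves the operator off the test vector.
  have hformal : ∀ (φ : (dampedAdjoint A c).adjoint.domain) (x : A.adjoint.domain),
      inner 𝕜 ((dampedAdjoint A c).adjoint φ) (x : H) =
        inner 𝕜 (φ : H) (dampedAdjoint A c x) := fun φ x =>
    LinearPMap.adjoint_isFormalAdjoint (hS.dense_dampedAdjoint_domain hA c) φ x
  constructor
  · rintro ⟨w, ⟨hw, hout⟩, hy, hz⟩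
    obtain ⟨hyc, hy0, hyi⟩ := (hy_iff hw).1 hy
    obtain ⟨hzc, hz0, hzi⟩ := (hz_iff hyc).1 hz
    -- The integral of the control is `-B*∫₀ᵗ z`, so `w` disappears from the equation for `y`; only
    -- the existence of an `L²` density remains as a separate condition.
    have hx : ∀ t ∈ Icc 0 T, ∃ x : A.adjoint.domain, (x : H) = ∫ s in (0 : ℝ)..t, z s ∧
        ∀ ξ : U, inner 𝕜 ξ (-outputMap A C₁ C₂ x) = ∫ s in (0 : ℝ)..t, inner 𝕜 ξ (w s) := by
      intro t ht
      obtain ⟨x, hx1, hx2⟩ := hout t ht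
      refine ⟨x, ext_inner_left 𝕜 fun ζ => ?_, hx2⟩
      rw [hx1, intervalIntegral_inner (ic hzc ht)]
    refine ⟨⟨hyc, hzc, hy0, hz0, fun t ht => ?_⟩, w, hw, fun t ht x hxz ξ => ?_⟩
    · obtain ⟨x, hx1, hx2⟩ := hx t ht
      refine ⟨x, hx1, ?_, fun φ => ?_⟩
      · refine (hS.dense_dampedAdjoint_adjoint_domain hA c).eq_of_inner_right (𝕜 := 𝕜)
          fun φ hφ => ?_
        rw [hzi ⟨φ, hφ⟩ t ht, ← hx1, hformal, inner_add_right, inner_add_right, add_assoc]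
      · rw [hyi φ t ht, ← hx2, inner_neg_right]
        ring
    · obtain ⟨x', hx1, hx2⟩ := hx t ht
      obtain rfl : x' = x := Subtype.ext (hx1.trans hxz.symm)
      exact hx2 ξ
  · rintro ⟨⟨hyc, hzc, hy0, hz0, h⟩, w, hw, hwi⟩
    refine ⟨w, ⟨hw, fun t ht => ?_⟩, (hy_iff hw).2 ⟨hyc, hy0, fun φ t ht => ?_⟩,
      (hz_iff hyc).2 ⟨hzc, hz0, fun φ t ht => ?_⟩⟩
    · obtain ⟨x, hx1, -⟩ := h t ht
      refine ⟨x, fun ζ => ?_, hwi t ht x hx1⟩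
      rw [hx1, intervalIntegral_inner (ic hzc ht)]
    · obtain ⟨x, hx1, -, hx3⟩ := h t ht
      rw [hx3, ← hwi t ht x hx1, inner_neg_right]
      ring
    · obtain ⟨x, hx1, hx2, -⟩ := h t ht
      rw [hx2, ← hx1, hformal, inner_add_right, inner_add_right, add_assoc]

end Feedback

/-! ### Uniqueness for the closed loop. -/

section ClosedLoop

variable {𝕜 : Type*} [RCLike 𝕜] {H : Type u} [NormedAddCommGroup H] [InnerProductSpace 𝕜 H]
  [CompleteSpace H]

theorem eq_zero_of_hasDerivAt_neg_mul {h : ℝ → 𝕜} {r T : ℝ}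
    (hd : ∀ t ∈ Icc 0 T, HasDerivAt h (-(r : 𝕜) * h t) t) (h0 : h 0 = 0) :
    ∀ t ∈ Icc 0 T, h t = 0 := by
  have hd' : ∀ t ∈ Icc 0 T, HasDerivAt (fun s => Real.exp (r * s) • h s) 0 t := by
    intro t ht
    have h1 : HasDerivAt (fun s : ℝ => Real.exp (r * s)) (Real.exp (r * t) * r) t := by
      have := ((hasDerivAt_id t).const_mul r).exp
      simpa using this
    have h2 := h1.smul (hd t ht)
    convert! h2 using 1
    simp only [RCLike.real_smul_eq_coe_mul, RCLike.ofReal_mul]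
    ring
  intro t ht
  have h1 := constant_of_has_deriv_right_zero (f := fun s => Real.exp (r * s) • h s) (a := 0)
    (b := T) (fun s hs => (hd' s hs).continuousAt.continuousWithinAt)
    (fun s hs => (hd' s ⟨hs.1, hs.2.le⟩).hasDerivWithinAt) t ht
  simp only [h0, smul_zero] at h1
  exact (smul_eq_zero.1 h1).resolve_left (Real.exp_ne_zero _)

theorem eqOn_zero_of_integral_eq_zero [NormedSpace ℝ H] {f : ℝ → H} (hf : Continuous f) {T : ℝ}
    (hT : 0 < T) (h : ∀ t ∈ Icc 0 T, ∫ s in (0 : ℝ)..t, f s = 0) : ∀ t ∈ Icc 0 T, f t = 0 := by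
  intro t ht
  have h1 := (hf.integral_hasStrictDerivAt 0 t).hasDerivAt.hasDerivWithinAt (s := Icc 0 T)
  have h2 : HasDerivWithinAt (fun u => ∫ s in (0 : ℝ)..u, f s) 0 (Icc 0 T) t :=
    (hasDerivWithinAt_const t _ (0 : H)).congr (fun s hs => h s hs) (h t ht)
  exact (uniqueDiffOn_Icc hT t ht).eq_deriv _ h1 h2

variable [NormedSpace ℝ H] [IsScalarTower ℝ 𝕜 H] {S : ℝ → H →L[𝕜] H} {A : H →ₗ.[𝕜] H}
  {U : Type v} [NormedAddCommGroup U] [InnerProductSpace 𝕜 U] [CompleteSpace U]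
  {C₁ C₂ : H →L[𝕜] U}

/-- The integrated closed-loop equations with zero initial data only have the zero solution. -/
theorem closedLoop_eq_zero (hS : IsC0Group S) (hA : IsGenerator S A) {σ k : ℝ} {Λ Γ : H →L[𝕜] H}
    (hΛΓ : ∀ x, Λ (Γ x) = x) (hΓΛ : ∀ x, Γ (Λ x) = x)
    (hLyap : ∀ φ ψ : A.adjoint.domain, inner 𝕜 (A.adjoint φ) (Λ ψ) +
      inner 𝕜 (φ : H) (Λ (A.adjoint ψ)) + (σ : 𝕜) * inner 𝕜 (φ : H) (Λ ψ) =
        inner 𝕜 (outputMap A C₁ C₂ φ) (outputMap A C₁ C₂ ψ))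
    {T : ℝ} (hT : 0 < T) {y z : ℝ → H} (hy : Continuous y) (hz : Continuous z)
    (h : ∀ t ∈ Icc 0 T, ∃ x : A.adjoint.domain, (x : H) = ∫ s in (0 : ℝ)..t, z s ∧
      z t = dampedAdjoint A (σ + k) x + ((k : 𝕜) • Γ) (∫ s in (0 : ℝ)..t, y s) ∧
      ∀ φ : A.adjoint.domain, inner 𝕜 (φ : H) (y t) =
        inner 𝕜 (A.adjoint φ) (∫ s in (0 : ℝ)..t, y s) -
        inner 𝕜 (outputMap A C₁ C₂ φ) (outputMap A C₁ C₂ x)) :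
    ∀ t ∈ Icc 0 T, y t = 0 ∧ z t = 0 := by
  have hdY : ∀ t, HasDerivAt (fun t => ∫ s in (0 : ℝ)..t, y s) (y t) t := fun t =>
    (hy.integral_hasStrictDerivAt 0 t).hasDerivAt
  have hdX : ∀ t, HasDerivAt (fun t => ∫ s in (0 : ℝ)..t, z s) (z t) t := fun t =>
    (hz.integral_hasStrictDerivAt 0 t).hasDerivAt
  have hdE : ∀ t, HasDerivAt (fun t => (∫ s in (0 : ℝ)..t, y s) - Λ (∫ s in (0 : ℝ)..t, z s))
      (y t - Λ (z t)) t := fun t =>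
    (hdY t).sub ((Λ.restrictScalars ℝ).hasFDerivAt.comp_hasDerivAt t (hdX t))
  -- With `Y = ∫y` and `X = ∫z`, the Lyapunov identity at `X ∈ D(A*)` shows that `Y - ΛX` solves `E'
  -- = (A - k)E` weakly with zero initial value.
  have hE : ∀ t ∈ Icc 0 T, ∫ s in (0 : ℝ)..t, y s = Λ (∫ s in (0 : ℝ)..t, z s) := by
    intro t ht
    rw [← sub_eq_zero]
    refine (hS.dense_adjoint_domain hA).eq_zero_of_inner_right (𝕜 := 𝕜) fun φ hφ => ?_
    -- Writing `φ = S(-t)*S(t)*φ` makes the pairing the value at time `t` of one along a dual orbit,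
    -- whose derivative cancels `A` and leaves a scalar equation.
    have hφ' : φ = dualGroup S t ((adjointFlow hS hA t ⟨φ, hφ⟩ : A.adjoint.domain) : H) := by
      refine ext_inner_right 𝕜 fun x => ?_
      rw [IsC0Group.dualGroup_inner_left]
      change _ = inner 𝕜 ((S t).adjoint φ) _
      rw [ContinuousLinearMap.adjoint_inner_left, hS.apply_neg_apply]
    have key := eq_zero_of_hasDerivAt_neg_mul (r := k) (T := T)
      (h := fun s => inner 𝕜 (dualGroup S s ((adjointFlow hS hA t ⟨φ, hφ⟩ : A.adjoint.domain) : H))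
        ((∫ s in (0 : ℝ)..s, y s) - Λ (∫ s in (0 : ℝ)..s, z s))) (fun s hs => ?_) (by simp) t ht
    · simp only [← hφ'] at key
      exact key
    · have h1 := (hS.hasDerivAt_dualGroup hA (adjointFlow hS hA t ⟨φ, hφ⟩) s).inner 𝕜 (hdE s)
      convert! h1 using 1
      obtain ⟨x, hx1, hx2, hx3⟩ := h s hs
      set ψ : A.adjoint.domain := adjointFlow hS hA (-s) (adjointFlow hS hA t ⟨φ, hφ⟩) with hψ
      have e1 : dualGroup S s ((adjointFlow hS hA t ⟨φ, hφ⟩ : A.adjoint.domain) : H) = ψ := rfl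
      have e2 : dualGroup S s (A.adjoint (adjointFlow hS hA t ⟨φ, hφ⟩)) = A.adjoint ψ :=
        (hS.adjoint_adjointFlow hA _ _).symm
      rw [e1, e2, ← hx1, hx2, dampedAdjoint_apply]
      have h3 := hx3 ψ
      have h4 := hLyap ψ x
      simp only [inner_sub_right, inner_neg_left, map_add, map_sub, map_neg, map_smul, smul_apply,
        inner_add_right, inner_neg_right, inner_smul_right, hΛΓ]
      linear_combination -h3 - h4
  -- Now `kΓY = kX`, so `X' = -(A* + σ)X`. Test vectors follow the orbit `S(s)S(-t)a`, which cancels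
  -- `A*`.
  have hX : ∀ t ∈ Icc 0 T, ∫ s in (0 : ℝ)..t, z s = 0 := by
    intro t ht
    refine (hS.dense_domain hA).eq_zero_of_inner_right (𝕜 := 𝕜) fun a ha => ?_
    obtain ⟨a', ha', -⟩ := (LinearPMap.mem_graph_iff A).1 (hS.apply_mem_graph hA (-t) ⟨a, ha⟩)
    simp only at ha'
    have key := eq_zero_of_hasDerivAt_neg_mul (r := σ) (T := T)
      (h := fun s => inner 𝕜 (S s (a' : H)) (∫ s in (0 : ℝ)..s, z s)) (fun s hs => ?_) (by simp) t ht
    · simp only [ha', hS.apply_neg_apply] at key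
      exact key
    · have h1 := (hS.hasDerivAt_apply hA a' s).inner 𝕜 (hdX s)
      convert! h1 using 1
      obtain ⟨x, hx1, hx2, -⟩ := h s hs
      obtain ⟨b, hb1, hb2⟩ := (LinearPMap.mem_graph_iff A).1 (hS.apply_mem_graph hA s a')
      simp only at hb1 hb2
      have h2 := congrArg (starRingEnd 𝕜) (hS.adjoint_inner hA x b)
      simp only [inner_conj_symm] at h2
      rw [← hb1, ← hb2, hx2, hE s hs, ← hx1, dampedAdjoint_apply]
      simp only [smul_apply, hΓΛ, inner_add_right, inner_sub_right, inner_neg_right,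
        inner_smul_right, RCLike.ofReal_add]
      linear_combination h2
  have hz0 := eqOn_zero_of_integral_eq_zero hz hT hX
  have hy0 := eqOn_zero_of_integral_eq_zero hy hT fun t ht => by rw [hE t ht, hX t ht, map_zero]
  exact fun t ht => ⟨hy0 t ht, hz0 t ht⟩

/-- A globally continuous extension makes primitives differentiable at the end points too. -/
theorem exists_continuous_eqOn {f : ℝ → H} {T : ℝ} (hT : 0 ≤ T) (hf : ContinuousOn f (Icc 0 T)) :
    ∃ g : ℝ → H, Continuous g ∧ EqOn g f (Icc 0 T) :=
  ⟨IccExtend hT ((Icc 0 T).domRestrict f), hf.domRestrict.Icc_extend', fun _ ht =>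
    IccExtend_of_mem hT _ ht⟩

/-- Uniqueness for the closed-loop system. -/
theorem dualFeedback_unique (hS : IsC0Group S) (hA : IsGenerator S A) {σ k : ℝ} {Λ Γ : H →L[𝕜] H}
    (hΛΓ : ∀ x, Λ (Γ x) = x) (hΓΛ : ∀ x, Γ (Λ x) = x)
    (hLyap : ∀ φ ψ : A.adjoint.domain, inner 𝕜 (A.adjoint φ) (Λ ψ) +
      inner 𝕜 (φ : H) (Λ (A.adjoint ψ)) + (σ : 𝕜) * inner 𝕜 (φ : H) (Λ ψ) =
        inner 𝕜 (outputMap A C₁ C₂ φ) (outputMap A C₁ C₂ ψ))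
    {B : ControlOperator A U} (hC : ∀ (w : U) (φ : A.adjoint.domain),
      B.toLinearMap w φ = inner 𝕜 (C₁ (φ : H) + C₂ (A.adjoint φ)) w)
    {T : ℝ} (hT : 0 < T) {y₀ z₀ : H} {y y' z z' : ℝ → H}
    (h : (dualFeedback hS hA (σ + k) ((k : 𝕜) • Γ) C₁ C₂).IsSolution B T y₀ z₀ y z)
    (h' : (dualFeedback hS hA (σ + k) ((k : 𝕜) • Γ) C₁ C₂).IsSolution B T y₀ z₀ y' z') :
    EqOn y y' (Icc 0 T) ∧ EqOn z z' (Icc 0 T) := by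
  rw [dualFeedback_isSolution_iff hS hA hC hT] at h h'
  obtain ⟨⟨hy, hz, -, -, hi⟩, -⟩ := h
  obtain ⟨⟨hy', hz', -, -, hi'⟩, -⟩ := h'
  obtain ⟨f, hf, hfe⟩ := exists_continuous_eqOn hT.le (hy.sub hy')
  obtain ⟨g, hg, hge⟩ := exists_continuous_eqOn hT.le (hz.sub hz')
  have hsub : ∀ {t}, t ∈ Icc 0 T → uIcc 0 t ⊆ Icc 0 T := fun ht => by
    rw [uIcc_of_le ht.1]; exact Icc_subset_Icc le_rfl ht.2
  have hint : ∀ {f p p' : ℝ → H} {t}, t ∈ Icc 0 T → ContinuousOn p (Icc 0 T) →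
      ContinuousOn p' (Icc 0 T) → EqOn f (p - p') (Icc 0 T) →
      ∫ s in (0 : ℝ)..t, f s = (∫ s in (0 : ℝ)..t, p s) - ∫ s in (0 : ℝ)..t, p' s := by
    intro f p p' t ht hp hp' he
    rw [← intervalIntegral.integral_sub (hp.mono (hsub ht)).intervalIntegrable
      (hp'.mono (hsub ht)).intervalIntegrable]
    exact intervalIntegral.integral_congr fun s hs => he (hsub ht hs)
  have key := closedLoop_eq_zero hS hA (k := k) hΛΓ hΓΛ hLyap hT hf hg (fun t ht => by
    obtain ⟨x, hx1, hx2, hx3⟩ := hi t ht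
    obtain ⟨x', hx1', hx2', hx3'⟩ := hi' t ht
    refine ⟨x - x', ?_, ?_, fun φ => ?_⟩
    · rw [hint ht hz hz' hge, Submodule.coe_sub, hx1, hx1']
    · rw [hge ht, hint ht hy hy' hfe, map_sub]
      have e : dampedAdjoint A (σ + k) (x - x') =
          dampedAdjoint A (σ + k) x - dampedAdjoint A (σ + k) x' :=
        map_sub (dampedAdjoint A (σ + k)).toFun x x'
      rw [e, Pi.sub_apply, hx2, hx2']
      abel
    · rw [hfe ht, hint ht hy hy' hfe, Pi.sub_apply, inner_sub_right, hx3, hx3', map_sub,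
        inner_sub_right, inner_sub_right]
      ring)
  refine ⟨fun t ht => ?_, fun t ht => ?_⟩
  · have := (key t ht).1
    rw [hfe ht, Pi.sub_apply] at this
    exact sub_eq_zero.1 this
  · have := (key t ht).2
    rw [hge ht, Pi.sub_apply] at this
    exact sub_eq_zero.1 this

end ClosedLoop

/-! ### Mild solutions of the auxiliary equation and their `L²` output. -/

section Existence

variable {𝕜 : Type*} [RCLike 𝕜] {H : Type u} [NormedAddCommGroup H] [InnerProductSpace 𝕜 H]
  [CompleteSpace H] [NormedSpace ℝ H] [IsScalarTower ℝ 𝕜 H] {S : ℝ → H →L[𝕜] H} {A : H →ₗ.[𝕜] H}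
  {U : Type v} [NormedAddCommGroup U] [InnerProductSpace 𝕜 U] [CompleteSpace U]
  {C₁ C₂ : H →L[𝕜] U}

theorem IsC0Group.continuous_apply_apply (hS : IsC0Group S) {f : ℝ → H} (hf : Continuous f) :
    Continuous fun t => S t (f t) :=
  continuousOn_univ.1 (hS.continuousOn_apply_apply hf.continuousOn)

/-- The solution `z(t) = R(t) z₀ + ∫₀ᵗ R(t - s) g(s) ds` of `z' = -(A* + σ) z + g`, where
`R(t) = e^{-σ t} S(-t)*`. -/
noncomputable def dualDuhamel (S : ℝ → H →L[𝕜] H) (σ : ℝ) (z₀ : H) (g : ℝ → H) (t : ℝ) : H :=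
  dampedDual S σ t (z₀ + ∫ s in (0 : ℝ)..t, dampedDual S σ (-s) (g s))

section Duhamel

variable {σ : ℝ} {z₀ : H} {g : ℝ → H}

theorem continuous_dampedDual_neg_apply (hS : IsC0Group S) (hA : IsGenerator S A) (σ : ℝ)
    (hg : Continuous g) : Continuous fun s => dampedDual S σ (-s) (g s) :=
  (hS.isC0Group_dampedDual hA σ).neg.continuous_apply_apply hg

theorem hasDerivAt_integral_dampedDual (hS : IsC0Group S) (hA : IsGenerator S A) (σ : ℝ) (z₀ : H)
    (hg : Continuous g) (t : ℝ) :
    HasDerivAt (fun t => z₀ + ∫ s in (0 : ℝ)..t, dampedDual S σ (-s) (g s))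
      (dampedDual S σ (-t) (g t)) t :=
  ((continuous_dampedDual_neg_apply hS hA σ hg).integral_hasStrictDerivAt 0 t).hasDerivAt.const_add _

theorem continuous_dualDuhamel (hS : IsC0Group S) (hA : IsGenerator S A) (σ : ℝ) (z₀ : H)
    (hg : Continuous g) : Continuous (dualDuhamel S σ z₀ g) :=
  (hS.isC0Group_dampedDual hA σ).continuous_apply_apply (continuous_iff_continuousAt.2 fun t =>
    (hasDerivAt_integral_dampedDual hS hA σ z₀ hg t).continuousAt)

theorem dualDuhamel_zero (hS : IsC0Group S) (hA : IsGenerator S A) (σ : ℝ) (z₀ : H) (g : ℝ → H) :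
    dualDuhamel S σ z₀ g 0 = z₀ := by
  simp [dualDuhamel, (hS.isC0Group_dampedDual hA σ).map_zero_apply]

/-- The solution given by Duhamel's formula satisfies the integrated equation. -/
theorem dualDuhamel_integral (hS : IsC0Group S) (hA : IsGenerator S A) (σ : ℝ) (z₀ : H)
    (hg : Continuous g) (t : ℝ) :
    ∃ x : A.adjoint.domain, (x : H) = ∫ s in (0 : ℝ)..t, dualDuhamel S σ z₀ g s ∧
      A.adjoint x = z₀ + (∫ s in (0 : ℝ)..t, g s) - dualDuhamel S σ z₀ g t - (σ : 𝕜) • (x : H) := by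
  have hR := hS.isC0Group_dampedDual hA σ
  set z := dualDuhamel S σ z₀ g with hz
  have hzc : Continuous z := continuous_dualDuhamel hS hA σ z₀ hg
  have hd : ∀ (a : A.domain) (s : ℝ), HasDerivAt (fun s => inner 𝕜 (a : H) (z s))
      (inner 𝕜 (a : H) (g s) + inner 𝕜 (-A a - (σ : 𝕜) • (a : H)) (z s)) s := by
    intro a s
    have h1 := (IsC0Group.hasDerivAt_exp_smul (𝕜 := 𝕜) (c := σ)
      (hS.hasDerivAt_apply_neg hA a s)).inner 𝕜 (hasDerivAt_integral_dampedDual hS hA σ z₀ hg s)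
    have e1 : (fun s => inner 𝕜 (a : H) (z s)) = fun s =>
        inner 𝕜 (((Real.exp (-σ * s) : ℝ) : 𝕜) • S (-s) (a : H))
          (z₀ + ∫ s in (0 : ℝ)..s, dampedDual S σ (-s) (g s)) := by
      funext s
      exact IsC0Group.inner_dampedDual _ _ _ _
    rw [e1]
    convert! h1 using 1
    congr 1
    · rw [← IsC0Group.inner_dampedDual, hR.apply_neg_apply]
    · have e2 : ((Real.exp (-σ * s) : ℝ) : 𝕜) • (-S (-s) (A a) - (σ : 𝕜) • S (-s) (a : H)) =
          ((Real.exp (-σ * s) : ℝ) : 𝕜) • S (-s) (-A a - (σ : 𝕜) • (a : H)) := by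
        rw [map_sub, map_neg, map_smul]
      rw [e2, ← IsC0Group.inner_dampedDual]
      rfl
  -- The functional `a ↦ ⟪∫₀ᵗ z, A a⟫` is represented by a vector, so the integral lies in `D(A*)`
  -- even though `z` itself need not.
  have key : ∀ a : A.domain, inner 𝕜 (z₀ + (∫ s in (0 : ℝ)..t, g s) - z t -
      (σ : 𝕜) • ∫ s in (0 : ℝ)..t, z s) (a : H) = inner 𝕜 (∫ s in (0 : ℝ)..t, z s) (A a) := by
    intro a
    have h1 := intervalIntegral.integral_eq_sub_of_hasDerivAt (a := 0) (b := t)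
      (fun s _ => hd a s) (((continuous_const.inner hg).add
        (continuous_const.inner hzc)).intervalIntegrable _ _)
    rw [intervalIntegral.integral_add ((continuous_const.inner hg).intervalIntegrable _ _)
      ((continuous_const.inner hzc).intervalIntegrable _ _),
      intervalIntegral_inner (hg.intervalIntegrable _ _),
      intervalIntegral_inner (hzc.intervalIntegrable _ _),
      show z 0 = z₀ from dualDuhamel_zero hS hA σ z₀ g, inner_sub_left, inner_neg_left,
      inner_smul_left, RCLike.conj_ofReal] at h1
    have h2 := congrArg (starRingEnd 𝕜) h1
    simp only [map_add, map_sub, map_neg, map_mul, inner_conj_symm, RCLike.conj_ofReal] at h2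
    rw [inner_sub_left, inner_sub_left, inner_add_left, inner_smul_left, RCLike.conj_ofReal]
    linear_combination h2
  have hx : ∫ s in (0 : ℝ)..t, z s ∈ A.adjoint.domain :=
    LinearPMap.mem_adjoint_domain_of_exists _ ⟨_, key⟩
  exact ⟨⟨_, hx⟩, rfl, LinearPMap.adjoint_apply_eq (hS.dense_domain hA) ⟨_, hx⟩ key⟩

/-- Pulled back by `S(t)*`, a mild solution is differentiable for every initial value in `H`; this
permits the integration by parts that defines the output. -/
theorem hasDerivAt_dualGroup_neg_dualDuhamel (hS : IsC0Group S) (hA : IsGenerator S A) (σ : ℝ)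
    (z₀ : H) (hg : Continuous g) (t : ℝ) :
    HasDerivAt (fun t => dualGroup S (-t) (dualDuhamel S σ z₀ g t))
      (dualGroup S (-t) (g t - (σ : 𝕜) • dualDuhamel S σ z₀ g t)) t := by
  have hV := hS.isC0Group_dualGroup hA
  have h1 := IsC0Group.hasDerivAt_exp_smul (𝕜 := 𝕜) (c := σ)
    (hasDerivAt_integral_dampedDual hS hA σ z₀ hg t)
  have e1 : ∀ t, dualGroup S (-t) (dualDuhamel S σ z₀ g t) = ((Real.exp (-σ * t) : ℝ) : 𝕜) •
      (z₀ + ∫ s in (0 : ℝ)..t, dampedDual S σ (-s) (g s)) := fun t => by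
    rw [dualDuhamel, dampedDual, smul_apply, map_smul, hV.neg_apply_apply]
  rw [funext e1]
  convert! h1 using 1
  rw [map_sub, map_smul, e1, smul_sub, smul_comm (σ : 𝕜)]
  congr 1
  rw [dampedDual, smul_apply, smul_smul, ← RCLike.ofReal_mul, ← Real.exp_add]
  simp

end Duhamel

variable {B : ControlOperator A U}

/-- The input `∫₀ʳ S(-τ) B ξ dτ` for a constant control, in terms of `B* = C₁ + C₂ A*`. -/
theorem integral_inner_dualOutput_const (hS : IsC0Group S) (hA : IsGenerator S A)
    (φ : A.adjoint.domain) (ξ : U) (r : ℝ) :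
    ∫ τ in (0 : ℝ)..r, inner 𝕜 (dualOutput S C₁ C₂ φ τ) ξ =
      inner 𝕜 (φ : H) ((∫ τ in (0 : ℝ)..r, S (-τ) (C₁.adjoint ξ)) +
        (C₂.adjoint ξ - S (-r) (C₂.adjoint ξ))) := by
  have hV := hS.isC0Group_dualGroup hA
  have hc : ∀ x : H, Continuous fun τ => S (-τ) x := fun x => hS.neg.continuous_apply x
  have e : ∀ τ, inner 𝕜 (dualOutput S C₁ C₂ φ τ) ξ =
      inner 𝕜 (φ : H) (S (-τ) (C₁.adjoint ξ)) + inner 𝕜 (A.adjoint φ) (S (-τ) (C₂.adjoint ξ)) := by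
    intro τ
    rw [dualOutput, inner_add_left, ← ContinuousLinearMap.adjoint_inner_right C₁,
      ← ContinuousLinearMap.adjoint_inner_right C₂, IsC0Group.dualGroup_inner_left,
      IsC0Group.dualGroup_inner_left]
  simp only [e]
  rw [intervalIntegral.integral_add ((continuous_const.inner (hc _)).intervalIntegrable _ _)
    ((continuous_const.inner (hc _)).intervalIntegrable _ _),
    intervalIntegral_inner ((hc _).intervalIntegrable _ _),
    intervalIntegral_inner ((hc _).intervalIntegrable _ _), inner_add_right]
  -- The part with `A*` integrates exactly: `∫₀ʳ ⟪A*φ, S(-τ)x⟫ dτ = ⟪φ, x - S(-r)x⟫`.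
  congr 1
  rw [intervalIntegral.integral_comp_neg (fun s => S s (C₂.adjoint ξ)), neg_zero,
    intervalIntegral.integral_symm, inner_neg_right, ← hS.inner_apply_neg_sub hA, ← inner_neg_right,
    neg_sub]

/-- The output `-(C₁ + C₂ A*) z` of the solution given by Duhamel's formula exists in `L²`. -/
theorem exists_output (hS : IsC0Group S) (hA : IsGenerator S A)
    (hC : ∀ (w : U) (φ : A.adjoint.domain),
      B.toLinearMap w φ = inner 𝕜 (C₁ (φ : H) + C₂ (A.adjoint φ)) w)
    (hB : IsAdmissible hS hA B) (σ : ℝ) (z₀ : H) {g : ℝ → H} (hg : Continuous g)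
    {T : ℝ} (hT : 0 < T) :
    ∃ w : ℝ → U, IsL2 T w ∧ ∀ t ∈ Icc 0 T, ∀ x : A.adjoint.domain,
      (x : H) = ∫ s in (0 : ℝ)..t, dualDuhamel S σ z₀ g s → ∀ ξ : U,
        inner 𝕜 ξ (-outputMap A C₁ C₂ x) = ∫ s in (0 : ℝ)..t, inner 𝕜 ξ (w s) := by
  have hV := hS.isC0Group_dualGroup hA
  have hTm : T ∈ Icc 0 T := ⟨hT.le, le_rfl⟩
  set z := dualDuhamel S σ z₀ g with hz
  have hzc : Continuous z := continuous_dualDuhamel hS hA σ z₀ hg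
  have hz0 : z 0 = z₀ := dualDuhamel_zero hS hA σ z₀ g
  set ζ : ℝ → H := fun t => dualGroup S (-t) (z t) with hζ
  set ζ' : ℝ → H := fun t => dualGroup S (-t) (g t - (σ : 𝕜) • z t) with hζ'
  have hζd : ∀ t, HasDerivAt ζ (ζ' t) t := hasDerivAt_dualGroup_neg_dualDuhamel hS hA σ z₀ hg
  have hζ'c : Continuous ζ' := hV.neg.continuous_apply_apply (hg.sub (hzc.const_smul _))
  have hVζ : ∀ t, dualGroup S t (ζ t) = z t := fun t => hV.apply_neg_apply t _
  have hVζ' : ∀ t, dualGroup S t (ζ' t) = g t - (σ : 𝕜) • z t := fun t => hV.apply_neg_apply t _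
  obtain ⟨C, hC0, hin⟩ := exists_input_bound hS hA hC hB hT
  choose p hp hpb hpi using hin
  have hpint : ∀ v, IntervalIntegrable (fun s => inner 𝕜 (ζ' s) (p v s)) volume 0 T := fun v =>
    ContinuousOn.intervalIntegrable (hζ'c.continuousOn.inner (by rw [uIcc_of_le hT.le]; exact hp v))
  have hunique : ∀ {s} {x x' : H}, (∀ φ : A.adjoint.domain, inner 𝕜 (φ : H) x =
      inner 𝕜 (φ : H) x') → s ∈ Icc 0 T → x = x' := fun h _ =>
    (hS.dense_adjoint_domain hA).eq_of_inner_right (𝕜 := 𝕜) fun φ hφ => h ⟨φ, hφ⟩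
  have hv_int : ∀ (v : Lp U 2 (volume.restrict (Ioo (0 : ℝ) T))) (φ : A.adjoint.domain) {s},
      s ∈ Icc 0 T → IntervalIntegrable
        (fun τ => inner 𝕜 (dualOutput S C₁ C₂ φ τ) (v τ)) volume 0 s := by
    intro v φ s hs
    refine intervalIntegrable_inner (continuous_dualOutput hS hA φ)
      (((isL2_coeFn v).intervalIntegrable hT.le).mono_set ?_)
    rw [uIcc_of_le hs.1, uIcc_of_le hT.le]
    exact Icc_subset_Icc le_rfl hs.2
  have hae : ∀ {s} {f f' : ℝ → 𝕜}, s ∈ Icc 0 T → f =ᵐ[volume.restrict (Ioo 0 T)] f' →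
      ∫ τ in (0 : ℝ)..s, f τ = ∫ τ in (0 : ℝ)..s, f' τ := by
    intro s f f' hs h
    rw [← setIntegral_indicator_Iic hs, ← setIntegral_indicator_Iic hs]
    refine integral_congr_ae ?_
    filter_upwards [h] with τ hτ
    by_cases hm : τ ∈ Iic s
    · rw [indicator_of_mem hm, indicator_of_mem hm, hτ]
    · rw [indicator_of_notMem hm, indicator_of_notMem hm]
  have hpadd : ∀ v v', ∀ s ∈ Icc 0 T, p (v + v') s = p v s + p v' s := by
    intro v v' s hs
    refine hunique (s := s) (fun φ => ?_) hs
    rw [inner_add_right, hpi _ s hs, hpi _ s hs, hpi _ s hs,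
      ← intervalIntegral.integral_add (hv_int v φ hs) (hv_int v' φ hs)]
    refine hae hs ?_
    filter_upwards [Lp.coeFn_add v v'] with τ hτ
    rw [hτ, Pi.add_apply, inner_add_right]
  have hpsmul : ∀ (c : 𝕜) v, ∀ s ∈ Icc 0 T, p (c • v) s = c • p v s := by
    intro c v s hs
    refine hunique (s := s) (fun φ => ?_) hs
    rw [inner_smul_right, hpi _ s hs, hpi _ s hs, ← intervalIntegral.integral_const_mul]
    refine hae hs ?_
    filter_upwards [Lp.coeFn_smul c v] with τ hτ
    rw [hτ, Pi.smul_apply, inner_smul_right]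
  obtain ⟨K, hK⟩ := isCompact_Icc.exists_bound_of_continuousOn (hζ'c.continuousOn (s := Icc 0 T))
  -- Formally `ℓ v = ∫₀ᵀ ⟪B*z, v⟫`: since `z = S(-s)*ζ`, this is the pairing of `ζ` with `dp/ds`,
  -- integrated by parts so that only `ζ'` and the bounded input map `p` occur.
  let ℓ : Lp U 2 (volume.restrict (Ioo (0 : ℝ) T)) →L[𝕜] 𝕜 := LinearMap.mkContinuous
    { toFun := fun v => inner 𝕜 (ζ T) (p v T) - ∫ s in (0 : ℝ)..T, inner 𝕜 (ζ' s) (p v s)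
      map_add' := fun v v' => by
        have e : ∫ s in (0 : ℝ)..T, inner 𝕜 (ζ' s) (p (v + v') s) =
            (∫ s in (0 : ℝ)..T, inner 𝕜 (ζ' s) (p v s)) +
              ∫ s in (0 : ℝ)..T, inner 𝕜 (ζ' s) (p v' s) := by
          rw [← intervalIntegral.integral_add (hpint v) (hpint v')]
          refine intervalIntegral.integral_congr fun s hs => ?_
          rw [uIcc_of_le hT.le] at hs
          simp only [hpadd v v' s hs, inner_add_right]
        rw [hpadd v v' T hTm, e, inner_add_right]
        ring
      map_smul' := fun c v => by
        have e : ∫ s in (0 : ℝ)..T, inner 𝕜 (ζ' s) (p (c • v) s) =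
            c * ∫ s in (0 : ℝ)..T, inner 𝕜 (ζ' s) (p v s) := by
          rw [← intervalIntegral.integral_const_mul]
          refine intervalIntegral.integral_congr fun s hs => ?_
          rw [uIcc_of_le hT.le] at hs
          simp only [hpsmul c v s hs, inner_smul_right]
        rw [hpsmul c v T hTm, e, inner_smul_right, RingHom.id_apply, smul_eq_mul, mul_sub] }
    (‖ζ T‖ * C + K * C * T) (fun v => by
      have h1 : ‖inner 𝕜 (ζ T) (p v T)‖ ≤ ‖ζ T‖ * (C * ‖v‖) := (norm_inner_le_norm _ _).trans
        (mul_le_mul_of_nonneg_left (hpb v T hTm) (norm_nonneg _))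
      have h2 := intervalIntegral.norm_integral_le_of_norm_le_const (a := 0) (b := T)
        (f := fun s => inner 𝕜 (ζ' s) (p v s)) (C := K * (C * ‖v‖)) (fun s hs => by
          rw [uIoc_of_le hT.le] at hs
          have hs' := Ioc_subset_Icc_self hs
          exact (norm_inner_le_norm _ _).trans (mul_le_mul (hK s hs') (hpb v s hs')
            (norm_nonneg _) ((norm_nonneg _).trans (hK s hs'))))
      rw [sub_zero, abs_of_pos hT] at h2
      refine (norm_sub_le _ _).trans ((add_le_add h1 h2).trans (le_of_eq ?_))
      ring)
  let W : Lp U 2 (volume.restrict (Ioo (0 : ℝ) T)) := -(InnerProductSpace.toDual 𝕜 _).symm ℓ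
  refine ⟨W, isL2_coeFn W, fun t ht x hx ξ => ?_⟩
  have hcξ : Continuous fun _ : ℝ => ξ := continuous_const
  rw [← inner_cutoffLp ht hcξ]
  -- Testing with `ξ` cut off at `t` recovers the integral of the output over `[0, t]`; for this
  -- input `p` is explicit and constant after time `t`.
  set v := cutoffLp T hcξ t with hv
  have hℓ : inner 𝕜 v W = -(starRingEnd 𝕜) (ℓ v) := by
    simp only [W]
    rw [inner_neg_right, ← inner_conj_symm, InnerProductSpace.toDual_symm_apply]
  rw [hℓ, inner_neg_right, neg_inj, ← inner_conj_symm]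
  congr 1
  let h₁ := C₁.adjoint ξ
  let h₂ := C₂.adjoint ξ
  let I : ℝ → H := fun r => ∫ τ in (0 : ℝ)..r, S (-τ) h₁
  let q : ℝ → H := fun r => I r + (h₂ - S (-r) h₂)
  have hSc : ∀ x : H, Continuous fun τ => S (-τ) x := fun x => hS.neg.continuous_apply x
  have hId : ∀ r, HasDerivAt I (S (-r) h₁) r := fun r =>
    ((hSc h₁).integral_hasStrictDerivAt 0 r).hasDerivAt
  have hIc : Continuous I := continuous_iff_continuousAt.2 fun r => (hId r).continuousAt
  have hqc : Continuous q := hIc.add (continuous_const.sub (hSc h₂))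
  have hpq : ∀ s ∈ Icc 0 T, p v s = q (min s t) := by
    intro s hs
    refine hunique (s := s) (fun φ => ?_) hs
    rw [hpi v s hs, integral_inner_cutoffLp hs ht hcξ, integral_inner_dualOutput_const hS hA]
  have hζint : ∀ a b (y : H), ∫ s in a..b, inner 𝕜 (ζ' s) y = inner 𝕜 (ζ b - ζ a) y := by
    intro a b y
    rw [intervalIntegral_inner_left (hζ'c.intervalIntegrable _ _),
      intervalIntegral.integral_eq_sub_of_hasDerivAt (fun s _ => hζd s)
        (hζ'c.intervalIntegrable _ _)]
  have i1 : ∀ {f f' : ℝ → H} {a b}, Continuous f → Continuous f' →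
      IntervalIntegrable (fun s => inner 𝕜 (f s) (f' s)) volume a b := fun hf hf' =>
    (hf.inner hf').intervalIntegrable _ _
  have hℓq : ℓ v = inner 𝕜 (ζ t) (q t) - ∫ s in (0 : ℝ)..t, inner 𝕜 (ζ' s) (q s) := by
    have e1 : ℓ v = inner 𝕜 (ζ T) (p v T) - ∫ s in (0 : ℝ)..T, inner 𝕜 (ζ' s) (p v s) := rfl
    have e2 : ∫ s in (0 : ℝ)..T, inner 𝕜 (ζ' s) (p v s) =
        ∫ s in (0 : ℝ)..T, inner 𝕜 (ζ' s) (q (min s t)) := by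
      refine intervalIntegral.integral_congr fun s hs => ?_
      rw [uIcc_of_le hT.le] at hs
      simp only [hpq s hs]
    have hqm : Continuous fun s => q (min s t) := hqc.comp (continuous_id.min continuous_const)
    have e3 : ∫ s in (0 : ℝ)..t, inner 𝕜 (ζ' s) (q (min s t)) =
        ∫ s in (0 : ℝ)..t, inner 𝕜 (ζ' s) (q s) := by
      refine intervalIntegral.integral_congr fun s hs => ?_
      rw [uIcc_of_le ht.1] at hs
      simp only [min_eq_left hs.2]
    have e4 : ∫ s in t..T, inner 𝕜 (ζ' s) (q (min s t)) = inner 𝕜 (ζ T - ζ t) (q t) := by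
      rw [← hζint]
      refine intervalIntegral.integral_congr fun s hs => ?_
      rw [uIcc_of_le ht.2] at hs
      simp only [min_eq_right hs.1]
    rw [e1, e2, ← intervalIntegral.integral_add_adjacent_intervals (b := t) (i1 hζ'c hqm)
      (i1 hζ'c hqm), e3, e4, hpq T hTm, min_eq_right ht.2, inner_sub_left]
    ring
  -- The second integration by parts undoes the first, now on explicit differentiable functions, and
  -- brings out `∫₀ᵗ z` paired with `C₁*ξ`.
  have f1 : ∫ s in (0 : ℝ)..t, inner 𝕜 (ζ' s) (I s) =
      inner 𝕜 (ζ t) (I t) - inner 𝕜 (∫ s in (0 : ℝ)..t, z s) h₁ := by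
    have hd : ∀ s, HasDerivAt (fun s => inner 𝕜 (ζ s) (I s))
        (inner 𝕜 (z s) h₁ + inner 𝕜 (ζ' s) (I s)) s := by
      intro s
      have := (hζd s).inner 𝕜 (hId s)
      rwa [← IsC0Group.dualGroup_inner_left, hVζ] at this
    have h1 := intervalIntegral.integral_eq_sub_of_hasDerivAt (a := 0) (b := t) (fun s _ => hd s)
      ((i1 hzc continuous_const).add (i1 hζ'c hIc))
    rw [intervalIntegral.integral_add (i1 hzc continuous_const) (i1 hζ'c hIc),
      intervalIntegral_inner_left (hzc.intervalIntegrable _ _)] at h1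
    have h2 : I 0 = 0 := intervalIntegral.integral_same
    rw [h2, inner_zero_right, sub_zero] at h1
    linear_combination h1
  have f2 : ∫ s in (0 : ℝ)..t, inner 𝕜 (ζ' s) (S (-s) h₂) =
      inner 𝕜 ((∫ s in (0 : ℝ)..t, g s) - (σ : 𝕜) • ∫ s in (0 : ℝ)..t, z s) h₂ := by
    have h1 : ∀ s, inner 𝕜 (ζ' s) (S (-s) h₂) = inner 𝕜 (g s - (σ : 𝕜) • z s) h₂ := fun s => by
      rw [← IsC0Group.dualGroup_inner_left, hVζ']
    simp only [h1]
    have hσz : Continuous fun s => (σ : 𝕜) • z s := hzc.const_smul _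
    rw [intervalIntegral_inner_left (f := fun s => g s - (σ : 𝕜) • z s)
        ((hg.sub hσz).intervalIntegrable _ _),
      intervalIntegral.integral_sub (hg.intervalIntegrable _ _) (hσz.intervalIntegrable _ _),
      intervalIntegral.integral_smul]
  have f3 : ∫ s in (0 : ℝ)..t, inner 𝕜 (ζ' s) (q s) =
      (∫ s in (0 : ℝ)..t, inner 𝕜 (ζ' s) (I s)) + ((∫ s in (0 : ℝ)..t, inner 𝕜 (ζ' s) h₂) -
        ∫ s in (0 : ℝ)..t, inner 𝕜 (ζ' s) (S (-s) h₂)) := by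
    rw [← intervalIntegral.integral_sub (i1 hζ'c continuous_const) (i1 hζ'c (hSc h₂)),
      ← intervalIntegral.integral_add (i1 hζ'c hIc)
        ((i1 hζ'c continuous_const).sub (i1 hζ'c (hSc h₂)))]
    refine intervalIntegral.integral_congr fun s _ => ?_
    simp only [q, inner_add_right, inner_sub_right]
  -- The terms with `C₂*ξ` assemble into `A*∫₀ᵗ z`, as computed from the integrated equation.
  obtain ⟨x', hx', hAx⟩ := dualDuhamel_integral hS hA σ z₀ hg t
  obtain rfl : x' = x := Subtype.ext (hx'.trans hx.symm)
  have f4 : inner 𝕜 (ζ t) (S (-t) h₂) = inner 𝕜 (z t) h₂ := by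
    rw [← IsC0Group.dualGroup_inner_left, hVζ]
  have f5 : ζ 0 = z₀ := by
    simp only [hζ, neg_zero, hV.map_zero_apply, hz0]
  rw [hℓq, f3, f1, f2, hζint, f5, ← hx, outputMap_apply, inner_add_left,
    ← ContinuousLinearMap.adjoint_inner_right C₁, ← ContinuousLinearMap.adjoint_inner_right C₂,
    hAx]
  simp only [q, inner_add_right, inner_sub_right, inner_sub_left, inner_add_left, f4]
  ring

end Existence

/-! ### Existence through the triangular form, and exponential decay. -/

section ClosedLoop

variable {𝕜 : Type*} [RCLike 𝕜] {H : Type u} [NormedAddCommGroup H] [InnerProductSpace 𝕜 H]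
  [CompleteSpace H] [NormedSpace ℝ H] [IsScalarTower ℝ 𝕜 H] {S : ℝ → H →L[𝕜] H} {A : H →ₗ.[𝕜] H}
  {U : Type v} [NormedAddCommGroup U] [InnerProductSpace 𝕜 U] [CompleteSpace U]
  {C₁ C₂ : H →L[𝕜] U}

/-- The damped trajectory `t ↦ e^{-k t} S(t) x`. -/
noncomputable def dampedFlow (S : ℝ → H →L[𝕜] H) (k : ℝ) (x : H) (t : ℝ) : H :=
  ((Real.exp (-k * t) : ℝ) : 𝕜) • S t x

theorem continuous_dampedFlow (hS : IsC0Group S) (k : ℝ) (x : H) :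
    Continuous (dampedFlow S k x) :=
  (RCLike.continuous_ofReal.comp (by fun_prop)).smul (hS.continuous_apply x)

theorem dampedFlow_zero (hS : IsC0Group S) (k : ℝ) (x : H) : dampedFlow S k x 0 = x := by
  simp [dampedFlow, hS.map_zero_apply]

/-- The damped trajectory solves `e' = A e - k e` weakly. -/
theorem inner_dampedFlow (hS : IsC0Group S) (hA : IsGenerator S A) (k : ℝ) (x : H)
    (φ : A.adjoint.domain) (t : ℝ) :
    inner 𝕜 (φ : H) (dampedFlow S k x t) = inner 𝕜 (φ : H) x +
      inner 𝕜 (A.adjoint φ) (∫ s in (0 : ℝ)..t, dampedFlow S k x s) -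
      (k : 𝕜) * inner 𝕜 (φ : H) (∫ s in (0 : ℝ)..t, dampedFlow S k x s) := by
  have hc := continuous_dampedFlow hS k x
  have e : ∀ (ψ : H) s, inner 𝕜 ψ (dampedFlow S k x s) =
      inner 𝕜 (((Real.exp (-k * s) : ℝ) : 𝕜) • dualGroup S (-s) ψ) x := fun ψ s => by
    rw [dampedFlow, inner_smul_right, inner_smul_left, RCLike.conj_ofReal,
      IsC0Group.dualGroup_inner_left, neg_neg]
  have hd : ∀ s, HasDerivAt (fun s => inner 𝕜 (φ : H) (dampedFlow S k x s))
      (inner 𝕜 (A.adjoint φ - (k : 𝕜) • (φ : H)) (dampedFlow S k x s)) s := by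
    intro s
    have h0 := (hS.hasDerivAt_dualGroup hA φ (-s)).scomp s (hasDerivAt_neg s)
    have h1 := (IsC0Group.hasDerivAt_exp_smul (𝕜 := 𝕜) (c := k) h0).inner 𝕜 (hasDerivAt_const s x)
    rw [funext (e φ), e]
    convert! h1 using 1
    simp [map_sub]
  have h := intervalIntegral.integral_eq_sub_of_hasDerivAt (a := 0) (b := t) (fun s _ => hd s)
    ((continuous_const.inner hc).intervalIntegrable _ _)
  rw [intervalIntegral_inner (hc.intervalIntegrable _ _), dampedFlow_zero hS, inner_sub_left,
    inner_smul_left, RCLike.conj_ofReal] at h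
  linear_combination -h

variable {σ k : ℝ} {Λ Γ : H →L[𝕜] H} {B : ControlOperator A U}

/-- In the variables `e = y - Λ z` and `z`, the closed-loop system is triangular. -/
theorem dualFeedback_isSolution_dualDuhamel (hS : IsC0Group S) (hA : IsGenerator S A)
    (hΛΓ : ∀ x, Λ (Γ x) = x) (hΓΛ : ∀ x, Γ (Λ x) = x)
    (hLyap : ∀ φ ψ : A.adjoint.domain, inner 𝕜 (A.adjoint φ) (Λ ψ) +
      inner 𝕜 (φ : H) (Λ (A.adjoint ψ)) + (σ : 𝕜) * inner 𝕜 (φ : H) (Λ ψ) =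
        inner 𝕜 (outputMap A C₁ C₂ φ) (outputMap A C₁ C₂ ψ))
    (hC : ∀ (w : U) (φ : A.adjoint.domain),
      B.toLinearMap w φ = inner 𝕜 (C₁ (φ : H) + C₂ (A.adjoint φ)) w)
    (hB : IsAdmissible hS hA B) {e z : ℝ → H} {y₀ z₀ : H}
    (he : e = dampedFlow S k (y₀ - Λ z₀))
    (hz : z = dualDuhamel S σ z₀ fun t => ((k : 𝕜) • Γ) (e t)) {T : ℝ} (hT : 0 < T) :
    (dualFeedback hS hA (σ + k) ((k : 𝕜) • Γ) C₁ C₂).IsSolution B T y₀ z₀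
      (fun t => e t + Λ (z t)) z := by
  rw [dualFeedback_isSolution_iff hS hA hC hT]
  have hec : Continuous e := he ▸ continuous_dampedFlow hS k _
  have hg : Continuous fun t => ((k : 𝕜) • Γ) (e t) := ((k : 𝕜) • Γ).continuous.comp hec
  have hzc : Continuous z := hz ▸ continuous_dualDuhamel hS hA σ z₀ hg
  have hyc : Continuous fun t => e t + Λ (z t) := hec.add (Λ.continuous.comp hzc)
  have hz0 : z 0 = z₀ := by rw [hz, dualDuhamel_zero hS hA]
  have he0 : e 0 = y₀ - Λ z₀ := by rw [he, dampedFlow_zero hS]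
  refine ⟨⟨hyc.continuousOn, hzc.continuousOn, by rw [he0, hz0, sub_add_cancel], hz0,
    fun t _ => ?_⟩, ?_⟩
  · obtain ⟨x, hx, hAx⟩ := dualDuhamel_integral hS hA σ z₀ hg t
    rw [← hz] at hx hAx
    have hyi : ∫ s in (0 : ℝ)..t, (e s + Λ (z s)) = (∫ s in (0 : ℝ)..t, e s) + Λ (x : H) := by
      have hΛz : Continuous fun s => Λ (z s) := Λ.continuous.comp hzc
      rw [intervalIntegral.integral_add (hec.intervalIntegrable _ _) (hΛz.intervalIntegrable _ _),
        Λ.intervalIntegral_comp_comm (hzc.intervalIntegrable _ _), hx]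
    rw [ContinuousLinearMap.intervalIntegral_comp_comm _ (hec.intervalIntegrable _ _)] at hAx
    set E := ∫ s in (0 : ℝ)..t, e s with hE
    have hzt : z t = z₀ + ((k : 𝕜) • Γ) E - A.adjoint x - (σ : 𝕜) • (x : H) := by
      rw [hAx]; abel
    refine ⟨x, hx, ?_, fun φ => ?_⟩
    -- The damping of `z` drops from `σ + k` to `σ` because `kΓΛ` is multiplication by `k`.
    · rw [hyi, dampedAdjoint_apply, hzt, map_add, smul_apply _ _ (Λ (x : H)), hΓΛ,
        RCLike.ofReal_add, add_smul]
      abel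
    · have h1 := inner_dampedFlow hS hA k (y₀ - Λ z₀) φ t
      rw [← he, ← hE] at h1
      -- The Lyapunov identity at `x = ∫₀ᵗ z` replaces the unbounded term `BB*x` by terms in `Λ`.
      rw [hyi, inner_add_right, h1, hzt, ← hLyap]
      simp only [map_sub, map_add, map_smul, smul_apply, hΛΓ, inner_add_right, inner_sub_right,
        inner_smul_right]
      ring
  · rw [hz]
    exact exists_output hS hA hC hB σ z₀ hg hT

theorem norm_dampedFlow_le {M a μ : ℝ} (hM : ∀ t, ‖S t‖ ≤ M * Real.exp (a * |t|)) {x : H}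
    {t : ℝ} (ht : 0 ≤ t) : ‖dampedFlow S (μ + a) x t‖ ≤ M * Real.exp (-μ * t) * ‖x‖ := by
  rw [dampedFlow, norm_smul, RCLike.norm_ofReal, abs_of_pos (Real.exp_pos _)]
  have h1 := (S t).le_of_opNorm_le (hM t) x
  rw [abs_of_nonneg ht] at h1
  refine (mul_le_mul_of_nonneg_left h1 (Real.exp_pos _).le).trans (le_of_eq ?_)
  have e : Real.exp (-μ * t) = Real.exp (-(μ + a) * t) * Real.exp (a * t) := by
    rw [← Real.exp_add]; ring_nf
  rw [e]; ring

theorem norm_dampedDual_apply_le {M a ν : ℝ} (hM : ∀ t, ‖S t‖ ≤ M * Real.exp (a * |t|))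
    (hσ : ν + a ≤ σ) {x : H} {t : ℝ} (ht : 0 ≤ t) (hM0 : 0 ≤ M) :
    ‖dampedDual S σ t x‖ ≤ M * Real.exp (-ν * t) * ‖x‖ := by
  rw [dampedDual, smul_apply, norm_smul, RCLike.norm_ofReal, abs_of_pos (Real.exp_pos _)]
  have hV : ‖dualGroup S t‖ ≤ M * Real.exp (a * t) := by
    rw [IsC0Group.norm_dualGroup]
    simpa [abs_of_nonneg ht] using hM (-t)
  refine (mul_le_mul_of_nonneg_left ((dualGroup S t).le_of_opNorm_le hV x)
    (Real.exp_pos _).le).trans ?_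
  have e : Real.exp (-σ * t) * Real.exp (a * t) ≤ Real.exp (-ν * t) := by
    rw [← Real.exp_add, Real.exp_le_exp]; nlinarith
  calc _ = M * (Real.exp (-σ * t) * Real.exp (a * t)) * ‖x‖ := by ring
    _ ≤ _ := by gcongr

/-- The homogeneous flow decays at rate `μ + 1`, one unit faster than the forcing, so the
convolution is controlled by `∫₀ᵗ e^{s-t} ds ≤ 1` and no factor `t` spoils the rate `μ`. -/
theorem norm_dualDuhamel_le (hS : IsC0Group S) (hA : IsGenerator S A) {M a μ K : ℝ}
    (hM0 : 0 ≤ M) (hM : ∀ t, ‖S t‖ ≤ M * Real.exp (a * |t|)) (hσ : μ + 1 + a ≤ σ) {z₀ : H}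
    {g : ℝ → H} (hg : Continuous g) (hK0 : 0 ≤ K) (hgK : ∀ s, 0 ≤ s → ‖g s‖ ≤ K * Real.exp (-μ * s))
    {t : ℝ} (ht : 0 ≤ t) :
    ‖dualDuhamel S σ z₀ g t‖ ≤ M * Real.exp (-μ * t) * (‖z₀‖ + K) := by
  have hR := hS.isC0Group_dampedDual hA σ
  have hi := continuous_dampedDual_neg_apply hS hA σ hg
  rw [dualDuhamel, map_add, ← ContinuousLinearMap.intervalIntegral_comp_comm _
    (hi.intervalIntegrable _ _)]
  have h1 : ‖dampedDual S σ t z₀‖ ≤ M * Real.exp (-μ * t) * ‖z₀‖ :=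
    norm_dampedDual_apply_le hM (by linarith) ht hM0
  have h2 : ‖∫ s in (0 : ℝ)..t, dampedDual S σ t (dampedDual S σ (-s) (g s))‖ ≤
      ∫ s in (0 : ℝ)..t, M * K * Real.exp (-μ * t) * Real.exp (s - t) := by
    refine intervalIntegral.norm_integral_le_of_norm_le ht ?_
      (Continuous.intervalIntegrable (by fun_prop) _ _)
    refine ae_of_all _ fun s hs => ?_
    rw [← hR.map_add_apply]
    refine (norm_dampedDual_apply_le (ν := μ + 1) hM hσ (t := t + -s)
      (by linarith [hs.2]) hM0).trans ?_
    have e : Real.exp (-(μ + 1) * (t + -s)) * Real.exp (-μ * s) =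
        Real.exp (-μ * t) * Real.exp (s - t) := by
      rw [← Real.exp_add, ← Real.exp_add]; ring_nf
    calc _ ≤ M * Real.exp (-(μ + 1) * (t + -s)) * (K * Real.exp (-μ * s)) := by
          gcongr
          exact hgK s hs.1.le
      _ = M * K * (Real.exp (-(μ + 1) * (t + -s)) * Real.exp (-μ * s)) := by ring
      _ = _ := by rw [e]; ring
  have h3 : ∫ s in (0 : ℝ)..t, Real.exp (s - t) ≤ 1 := by
    rw [intervalIntegral.integral_comp_sub_right (fun s => Real.exp s), integral_exp]
    simp only [sub_self, Real.exp_zero]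
    linarith [Real.exp_pos (0 - t)]
  rw [intervalIntegral.integral_const_mul] at h2
  have h4 : M * K * Real.exp (-μ * t) * ∫ s in (0 : ℝ)..t, Real.exp (s - t) ≤
      M * K * Real.exp (-μ * t) * 1 := by gcongr
  refine (norm_add_le _ _).trans ((add_le_add h1 (h2.trans h4)).trans (le_of_eq ?_))
  ring

/-- The Lax–Milgram argument: coercivity alone gives bounded invertibility. -/
theorem exists_inverse_of_coercive {c : ℝ} (hc : 0 < c)
    (h : ∀ x, c * ‖x‖ ^ 2 ≤ RCLike.re (inner 𝕜 x (Λ x))) :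
    ∃ Γ : H →L[𝕜] H, (∀ x, Λ (Γ x) = x) ∧ ∀ x, Γ (Λ x) = x := by
  have hu : IsUnit Λ := by
    refine ContinuousLinearMap.isUnit_of_forall_le_norm_inner_map Λ (c := ⟨c, hc.le⟩) hc
      fun x => ?_
    rw [← inner_conj_symm, RCLike.norm_conj, mul_comm]
    exact (h x).trans (RCLike.re_le_norm _)
  obtain ⟨⟨Λ', Γ, h1, h2⟩, rfl⟩ := hu
  exact ⟨Γ, fun x => congrArg (fun L => L x) h1, fun x => congrArg (fun L => L x) h2⟩

/-- A large weight exponent serves both the contraction that defines `Λ` and the decay of `z`. -/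
theorem exists_damping (S : ℝ → H →L[𝕜] H) {T : ℝ} (hT : 0 < T) (b : ℝ) :
    ∃ σ : ℝ, 0 ≤ σ ∧ b ≤ σ ∧ Real.exp (-σ * T) * ‖S (-T)‖ ^ 2 < 1 := by
  have h1 : Tendsto (fun σ : ℝ => Real.exp (-σ * T) * ‖S (-T)‖ ^ 2) atTop (𝓝 0) := by
    have h2 : Tendsto (fun σ : ℝ => -σ * T) atTop atBot :=
      tendsto_neg_atTop_atBot.atBot_mul_const hT
    simpa using (Real.tendsto_exp_atBot.comp h2).mul_const (‖S (-T)‖ ^ 2)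
  exact ((eventually_ge_atTop 0).and ((eventually_ge_atTop b).and
    (h1.eventually (gt_mem_nhds one_pos)))).exists

theorem isDynamicallyStabilizable_of_isExactlyControllable (hS : IsC0Group S)
    (hA : IsGenerator S A) (hB : IsAdmissible hS hA B) {T : ℝ} (hT : 0 < T)
    (hc : IsExactlyControllable A B T) (μ : ℝ) :
    IsDynamicallyStabilizable A B μ := by
  obtain ⟨C₁, C₂, hC⟩ := B.exists_observation
  obtain ⟨M, a, hM1, ha, hM⟩ := hS.exists_norm_le_exp
  obtain ⟨σ, hσ0, hσ, hσT⟩ := exists_damping S hT (μ + 1 + a)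
  obtain ⟨Λ, ⟨c, hc0, hΛ⟩, hLyap⟩ := exists_lyapunov hS hA hC hB hT hc hσ0 hσT
  obtain ⟨Γ, hΛΓ, hΓΛ⟩ := exists_inverse_of_coercive hc0 hΛ
  have hM0 : 0 ≤ M := zero_le_one.trans hM1
  -- The growth rate `a` of the group is compensated, leaving decay at rate `μ` for `e`.
  let k := μ + a
  let e : H → H → ℝ → H := fun y₀ z₀ => dampedFlow S k (y₀ - Λ z₀)
  let z : H → H → ℝ → H := fun y₀ z₀ => dualDuhamel S σ z₀ fun t => ((k : 𝕜) • Γ) (e y₀ z₀ t)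
  have hsol : ∀ y₀ z₀ (T : ℝ), 0 < T → (dualFeedback hS hA (σ + k) ((k : 𝕜) • Γ) C₁ C₂).IsSolution
      B T y₀ z₀ (fun t => e y₀ z₀ t + Λ (z y₀ z₀ t)) (z y₀ z₀) := fun y₀ z₀ T hT =>
    dualFeedback_isSolution_dualDuhamel hS hA hΛΓ hΓΛ hLyap hC hB rfl rfl hT
  refine ⟨dualFeedback hS hA (σ + k) ((k : 𝕜) • Γ) C₁ C₂, fun y₀ z₀ =>
    ⟨⟨_, _, hsol y₀ z₀⟩, fun T hT y y' z z' h h' =>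
      dualFeedback_unique hS hA hΛΓ hΓΛ hLyap hC hT h h'⟩, ?_⟩
  set K := ‖(k : 𝕜) • Γ‖ with hK
  set b := 1 + ‖Λ‖ with hb
  have hb1 : 1 ≤ b := by rw [hb]; linarith [norm_nonneg Λ]
  have hK0 : 0 ≤ K := norm_nonneg _
  -- The first summand bounds `e`, with `b` absorbing `‖y₀ - Λz₀‖`; the second bounds `z` together
  -- with `Λz`, whence the factor `b = 1 + ‖Λ‖`.
  refine ⟨M * b + b * M * (1 + K * M * b), by positivity,
    fun y₀ z₀ T hT y z' h t ht => ?_⟩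
  change H at z₀
  -- By uniqueness only the explicit solution has to be estimated.
  obtain ⟨hy, hz⟩ := dualFeedback_unique hS hA hΛΓ hΓΛ hLyap hC hT h (hsol y₀ z₀ T hT)
  rw [hy ht, hz ht]
  have he0 : ‖y₀ - Λ z₀‖ ≤ b * (‖y₀‖ + ‖z₀‖) := by
    have h1 := Λ.le_opNorm z₀
    refine (norm_sub_le _ _).trans ?_
    rw [hb]
    nlinarith [norm_nonneg Λ, norm_nonneg y₀, norm_nonneg z₀,
      mul_nonneg (norm_nonneg Λ) (norm_nonneg y₀)]
  set n := ‖y₀‖ + ‖z₀‖ with hn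
  have hn0 : 0 ≤ n := by positivity
  have he : ∀ s, 0 ≤ s → ‖e y₀ z₀ s‖ ≤ M * Real.exp (-μ * s) * (b * n) := fun s hs =>
    (norm_dampedFlow_le hM hs).trans (by gcongr)
  have hz' : ‖z y₀ z₀ t‖ ≤ M * Real.exp (-μ * t) * (‖z₀‖ + K * M * b * n) := by
    refine norm_dualDuhamel_le hS hA hM0 hM hσ
      (((k : 𝕜) • Γ).continuous.comp (continuous_dampedFlow hS k _)) (by positivity)
      (fun s hs => ?_) ht.1
    refine (((k : 𝕜) • Γ).le_opNorm_of_le (he s hs)).trans (le_of_eq ?_)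
    rw [← hK]; ring
  have hz'' : ‖z y₀ z₀ t‖ ≤ M * Real.exp (-μ * t) * ((1 + K * M * b) * n) := by
    refine hz'.trans ?_
    gcongr
    rw [add_mul, one_mul]
    gcongr
    rw [hn]; linarith [norm_nonneg y₀]
  calc ‖e y₀ z₀ t + Λ (z y₀ z₀ t)‖ + ‖z y₀ z₀ t‖
      ≤ ‖e y₀ z₀ t‖ + ‖Λ‖ * ‖z y₀ z₀ t‖ + ‖z y₀ z₀ t‖ := by
        gcongr
        exact (norm_add_le _ _).trans (by gcongr; exact Λ.le_opNorm _)
    _ = ‖e y₀ z₀ t‖ + b * ‖z y₀ z₀ t‖ := by rw [hb]; ring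
    _ ≤ M * Real.exp (-μ * t) * (b * n) +
        b * (M * Real.exp (-μ * t) * ((1 + K * M * b) * n)) := by
        gcongr
        exact he t ht.1
    _ = (M * b + b * M * (1 + K * M * b)) * Real.exp (-μ * t) * n := by ring

end ClosedLoop

end ControlSystem

theorem mainTheorem8 {𝕜 : Type*} [RCLike 𝕜]
    {H : Type*} [NormedAddCommGroup H] [InnerProductSpace 𝕜 H] [CompleteSpace H]
    {U : Type*} [NormedAddCommGroup U] [InnerProductSpace 𝕜 U] [CompleteSpace U]
    (S : ℝ → H →L[𝕜] H) (hS : ControlSystem.IsC0Group S)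
    (A : H →ₗ.[𝕜] H) (hA : ControlSystem.IsGenerator S A)
    (B : ControlSystem.ControlOperator A U)
    (hB : ControlSystem.IsAdmissible hS hA B)
    (hcontr : ∃ T : ℝ, 0 < T ∧ ControlSystem.IsExactlyControllable A B T) :
    ControlSystem.IsRapidlyDynamicallyStabilizable A B := by
  -- Integrals and derivatives in `H` use its real structure, obtained from `𝕜` by restriction of
  -- scalars.
  let _ : NormedSpace ℝ H := NormedSpace.restrictScalars ℝ 𝕜 H
  have _ : IsScalarTower ℝ 𝕜 H := RestrictScalars.isScalarTower ℝ 𝕜 H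
  obtain ⟨T, hT, hc⟩ := hcontr
  exact fun μ _ =>
    ControlSystem.isDynamicallyStabilizable_of_isExactlyControllable hS hA hB hT hc μ
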